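/- Let $\Sigma$ be a compact Riemann surface, possibly with smooth boundary $\partial\Sigma$ (given the boundary orientation induced by the complex orientation), and let $D\subset\Sigma\setminus\partial\Sigma$ be a finite set. Write $\mathcal A^k(\Sigma,\star D)$ for the space of complex-valued $k$-forms $\omega$ that are smooth on $\Sigma\setminus D$ (up to $\partial\Sigma$) and that near each $p\in D$ have the form $\omega=\eta/z^n$, where $z$ is a local holomorphic coordinate with $z(p)=0$, $n\ge 0$ is an integer and $\eta$ is a smooth $k$-form near $p$. Let $\mathcal A^2(\Sigma,\log D)\subset\mathcal A^2(\Sigma,\star D)$ be the subspace of forms for which one can take $n\le 1$ at every $p\in D$, and let $\mathcal A^{0,1}(\Sigma,\star D)\subset\mathcal A^1(\Sigma,\star D)$ be the subspace of forms of type $(0,1)$. For $\omega\in\mathcal A^2(\Sigma,\star D)$ the regularized integral is defined by $$\mathrm{reg}\!\!\int_\Sigma\omega:=\int_\Sigma\eta+\int_{\partial\Sigma}\beta,\qquad \omega=\eta+\partial\beta,\quad \eta\in\mathcal A^2(\Sigma,\log D),\ \beta\in\mathcal A^{0,1}(\Sigma,\star D).$$ For $\alpha\in\mathcal A^1(\Sigma,\star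 D)$ and $p\in D$ the residue is $$\operatorname{Res}_p(\alpha):=\frac1{2\pi i}\lim_{\epsilon\to0^+}\int_{|z|=\epsilon}\alpha ,$$ where $z$ is a local holomorphic coordinate with $z(p)=0$ and the circle is oriented counter-clockwise, and $\operatorname{Res}_\Sigma(\alpha):=\sum_{p\in D}\operatorname{Res}_p(\alpha)$. **Theorem.** Let $\alpha\in\mathcal A^1(\Sigma,\star D)$. Then $d\alpha\in\mathcal A^2(\Sigma,\star D)$. For each $p\in D$, the limit defining $\operatorname{Res}_p(\alpha)$ exists and does not depend on the coordinate $z$. The regularized integral of $d\alpha$ is well defined: a decomposition $d\alpha=\eta+\partial\beta$ as above exists, for every such decomposition $\int_\Sigma\eta$ converges absolutely, and $\int_\Sigma\eta+\int_{\partial\Sigma}\beta$ does not depend on the decomposition. Moreover $$\mathrm{reg}\!\!\int_\Sigma d\alpha=-2\pi i\,\operatorname{Res}_\Sigma(\alpha)+\int_{\partial\Sigma}\alpha .$$ -/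

import Mathlib

open scoped Manifold ContDiff Topology

/-- The closed upper half-plane, the local model of a Riemann surface with boundary. -/
abbrev HalfPlane : Type := {z : ℂ // 0 ≤ z.im}

namespace HalfPlane

/-- The inclusion of the closed upper half-plane into `ℂ`. -/
noncomputable def inclusion : PartialEquiv HalfPlane ℂ where
  toFun := Subtype.val
  invFun z := ⟨⟨z.re, max z.im 0⟩, le_max_right _ _⟩
  source := Set.univ
  target := {z | 0 ≤ z.im}
  map_source' z _ := z.2
  map_target' _ _ := Set.mem_univ _
  left_inv' z _ := Subtype.ext (Complex.ext rfl (max_eq_left z.2))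
  right_inv' _ hz := Complex.ext rfl (max_eq_left hz)

theorem range_inclusion : Set.range inclusion = {z : ℂ | 0 ≤ z.im} := Subtype.range_val

theorem interior_range_inclusion : (interior (Set.range inclusion)).Nonempty := by
  rw [range_inclusion]
  refine ⟨Complex.I, mem_interior.2 ⟨{z : ℂ | 0 < z.im}, fun z hz =>
    show (0 : ℝ) ≤ z.im from (show (0 : ℝ) < z.im from hz).le,
    isOpen_lt continuous_const Complex.continuous_im, ?_⟩⟩
  simp

theorem convex_range_inclusion : Convex ℝ (Set.range inclusion) := by
  rw [range_inclusion]
  exact convex_halfSpace_im_ge 0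

theorem continuous_inclusion_symm : Continuous inclusion.symm := by
  have h : Continuous fun z : ℂ => (⟨z.re, max z.im 0⟩ : ℂ) := by
    have : (fun z : ℂ => (⟨z.re, max z.im 0⟩ : ℂ))
        = fun z : ℂ => (z.re : ℂ) + ((max z.im 0 : ℝ) : ℂ) * Complex.I := by
      funext z
      apply Complex.ext <;> simp
    rw [this]
    fun_prop
  exact h.subtype_mk _

end HalfPlane

/-- The half-plane as a model for complex one-dimensional manifolds with boundary. -/
noncomputable def complexHalfModel : ModelWithCorners ℂ ℂ HalfPlane where
  toPartialEquiv := HalfPlane.inclusion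
  source_eq := rfl
  convex_range' := by
    simp only [instIsRCLikeNormedField, ↓reduceDIte]
    apply Convex.convex_isRCLikeNormedField
    exact HalfPlane.convex_range_inclusion
  nonempty_interior' := HalfPlane.interior_range_inclusion
  continuous_toFun := continuous_subtype_val
  continuous_invFun := HalfPlane.continuous_inclusion_symm

/-- The half-plane as a model for smooth real surfaces with boundary. -/
noncomputable def realHalfModel : ModelWithCorners ℝ ℂ HalfPlane where
  toPartialEquiv := HalfPlane.inclusion
  source_eq := rfl
  convex_range' := by
    simp only [instIsRCLikeNormedField, ↓reduceDIte]
    apply Convex.convex_isRCLikeNormedField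
    exact HalfPlane.convex_range_inclusion
  nonempty_interior' := HalfPlane.interior_range_inclusion
  continuous_toFun := continuous_subtype_val
  continuous_invFun := HalfPlane.continuous_inclusion_symm

/-- A Riemann surface with (possibly empty) boundary: charts in the closed upper half-plane whose
transition maps are complex differentiable and smooth up to the boundary. -/
abbrev IsRiemannSurface (X : Type*) [TopologicalSpace X] [ChartedSpace HalfPlane X] : Prop :=
  IsManifold complexHalfModel ∞ X

/-- The smooth real surface with boundary underlying a Riemann surface. -/
instance isManifold_realHalfModel (X : Type*) [TopologicalSpace X] [ChartedSpace HalfPlane X]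
    [IsRiemannSurface X] : IsManifold realHalfModel ∞ X := by
  apply isManifold_of_contDiffOn
  intro e e' he he'
  have h := (contDiffGroupoid ∞ complexHalfModel).compatible he he'
  rw [contDiffGroupoid, mem_groupoid_of_pregroupoid] at h
  have h1 : ContDiffOn ℂ ∞ (complexHalfModel ∘ (e.symm.trans e') ∘ complexHalfModel.symm)
    (complexHalfModel.symm ⁻¹' (e.symm.trans e').source ∩ Set.range complexHalfModel) := h.1
  exact h1.restrict_scalars ℝ

namespace RiemannSurface

section Forms

variable {X : Type*} [TopologicalSpace X] [ChartedSpace HalfPlane X]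

/-- Complex-valued differential `k`-forms on the surface, without any regularity. -/
abbrev DForm (X : Type*) [TopologicalSpace X] [ChartedSpace HalfPlane X] (k : ℕ) : Type _ :=
  ∀ p : X, TangentSpace realHalfModel p [⋀^Fin k]→L[ℝ] ℂ

/-- The chart around `p`, seen as a partial map from the surface to `ℂ`. -/
noncomputable abbrev chart (p : X) : PartialEquiv X ℂ := extChartAt realHalfModel p

/-- The expression `(φ⁻¹)^* w` of a form in the chart `φ` around `p`. -/
noncomputable def inChart {k : ℕ} (p : X) (w : DForm X k) (z : ℂ) : ℂ [⋀^Fin k]→L[ℝ] ℂ :=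
  (w ((chart p).symm z)).compContinuousLinearMap
    (mfderivWithin 𝓘(ℝ, ℂ) realHalfModel (chart p).symm (Set.range realHalfModel) z)

/-- The pullback `φ^* W` to the tangent space at `p` of an alternating form on `ℂ`, where `φ` is
the chart around `p`. -/
noncomputable def ofChart {k : ℕ} (p : X) (W : ℂ [⋀^Fin k]→L[ℝ] ℂ) :
    TangentSpace realHalfModel p [⋀^Fin k]→L[ℝ] ℂ :=
  W.compContinuousLinearMap (mfderiv realHalfModel 𝓘(ℝ, ℂ) (chart p) p)

/-- The exterior derivative `d`, computed at each point in the chart around that point. -/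
noncomputable def extD {k : ℕ} (w : DForm X k) : DForm X (k + 1) := fun p =>
  ofChart p (extDerivWithin (inChart p w) (Set.range realHalfModel) (chart p p))

/-- The `(1,1)`-component of an alternating `2`-form on `ℂ`. -/
noncomputable def typeOneOne (W : ℂ [⋀^Fin 2]→L[ℝ] ℂ) : ℂ [⋀^Fin 2]→L[ℝ] ℂ :=
  (1 / 2 : ℂ) • (W + W.compContinuousLinearMap
    ((Complex.I • ContinuousLinearMap.id ℂ ℂ : ℂ →L[ℂ] ℂ).restrictScalars ℝ))

/-- The operator `∂` from `(0,1)`-forms to `(1,1)`-forms: the `(1,1)`-component of `d`. -/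
noncomputable def del (β : DForm X 1) : DForm X 2 := fun p =>
  ofChart p (typeOneOne (extDerivWithin (inChart p β) (Set.range realHalfModel) (chart p p)))

/-- `w` is smooth (up to the boundary) on the complement of `D`. -/
def SmoothOff {k : ℕ} (D : Finset X) (w : DForm X k) : Prop :=
  ∀ p : X, ContDiffOn ℝ ∞ (inChart p w) {z ∈ (chart p).target | (chart p).symm z ∉ D}

/-- Near the interior point `p`, the form `w` is `η / z ^ n` with `η` smooth, where `z` is a local
holomorphic coordinate vanishing at `p`. The value of `w` at `p` itself plays no role. -/
def PoleOrderLE {k : ℕ} (w : DForm X k) (p : X) (n : ℕ) : Prop :=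
  ∃ η : ℂ → ℂ [⋀^Fin k]→L[ℝ] ℂ, ContDiffAt ℝ ∞ η (chart p p) ∧
    ∀ᶠ z in 𝓝[≠] (chart p p), inChart p w z = ((z - chart p p) ^ n)⁻¹ • η z

/-- The space `𝒜^k(X, ⋆D)` of `k`-forms, smooth off `D`, with holomorphic poles along `D`. -/
def HasPoles {k : ℕ} (D : Finset X) (w : DForm X k) : Prop :=
  SmoothOff D w ∧ ∀ p ∈ D, ∃ n : ℕ, PoleOrderLE w p n

/-- The space `𝒜^2(X, log D)`. A logarithmic `2`-form is locally `b dz̄ ∧ dz / z` with `b` smooth,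
i.e. it has poles of order at most one. -/
def HasLogPoles (D : Finset X) (w : DForm X 2) : Prop :=
  SmoothOff D w ∧ ∀ p ∈ D, PoleOrderLE w p 1

/-- Off `D`, the `1`-form `β` is of type `(0,1)`: in each holomorphic chart it is `b dz̄`. -/
def IsTypeZeroOne (D : Finset X) (β : DForm X 1) : Prop :=
  ∀ p : X, ∀ z ∈ (chart p).target, (chart p).symm z ∉ D →
    ∀ v : ℂ, inChart p β z ![v] = inChart p β z ![1] * (starRingEnd ℂ) v

end Forms

section Integration

variable {X : Type*} [TopologicalSpace X] [ChartedSpace HalfPlane X] [IsRiemannSurface X]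
  [T2Space X] [CompactSpace X]

/-- A smooth partition of unity subordinate to the chart domains (the integrals defined with it do
not depend on the choice). -/
noncomputable def partition (X : Type*) [TopologicalSpace X] [ChartedSpace HalfPlane X]
    [IsRiemannSurface X] [T2Space X] [CompactSpace X] :
    SmoothPartitionOfUnity X realHalfModel X Set.univ :=
  (SmoothPartitionOfUnity.exists_isSubordinate_chartAt_source realHalfModel X).choose

/-- The coefficient of `dx ∧ dy` of `ρ_p w` in the chart around `p`, where `ρ` is the partition of
unity. -/
noncomputable def surfaceDensity (w : DForm X 2) (p : X) (z : ℂ) : ℂ :=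
  (partition X p ((chart p).symm z) : ℂ) * inChart p w z ![1, Complex.I]

/-- Absolute convergence of the integral of a `2`-form over the surface. -/
def AbsIntegrable (w : DForm X 2) : Prop :=
  ∀ p : X, MeasureTheory.IntegrableOn (surfaceDensity w p) (chart p).target

/-- The integral of a `2`-form over the surface, with the orientation given by the complex
structure. -/
noncomputable def surfaceIntegral (w : DForm X 2) : ℂ :=
  ∑ᶠ p : X, ∫ z in (chart p).target, surfaceDensity w p z

/-- The integral of a `1`-form over the boundary. In a half-plane chart the boundary is the real
axis, and the boundary orientation is that of increasing real part. -/
noncomputable def boundaryIntegral (β : DForm X 1) : ℂ :=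
  ∑ᶠ p : X, ∫ x : ℝ in {x : ℝ | (x : ℂ) ∈ (chart p).target},
    (partition X p ((chart p).symm x) : ℂ) * inChart p β x ![1]

/-- A decomposition `w = η + ∂β` off `D`, with `η` logarithmic along `D` and `β` of type `(0,1)` with
holomorphic poles along `D`. -/
def IsDecomposition (D : Finset X) (w η : DForm X 2) (β : DForm X 1) : Prop :=
  HasLogPoles D η ∧ HasPoles D β ∧ IsTypeZeroOne D β ∧ ∀ p : X, p ∉ D → w p = η p + del β p

/-- The regularized integral of `w` is well defined and equal to `c`: there is a decomposition
`w = η + ∂β` as above, and for each of them the integral of `η` converges absolutely and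
`∫_X η + ∫_{∂X} β = c`. -/
def HasRegularizedIntegral (D : Finset X) (w : DForm X 2) (c : ℂ) : Prop :=
  (∃ (η : DForm X 2) (β : DForm X 1), IsDecomposition D w η β) ∧
    ∀ (η : DForm X 2) (β : DForm X 1), IsDecomposition D w η β →
      AbsIntegrable η ∧ surfaceIntegral η + boundaryIntegral β = c

open Classical in
/-- The regularized integral of a `2`-form with holomorphic poles along `D` (zero if it is not well
defined). -/
noncomputable def regularizedIntegral (D : Finset X) (w : DForm X 2) : ℂ :=
  if h : ∃ c : ℂ, HasRegularizedIntegral D w c then h.choose else 0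

end Integration

section Residues

variable {X : Type*} [TopologicalSpace X] [ChartedSpace HalfPlane X]

/-- `e` is a local holomorphic coordinate on the surface, defined around `p` and vanishing there. -/
structure IsLocalCoordinate (p : X) (e : OpenPartialHomeomorph X ℂ) : Prop where
  mem_source : p ∈ e.source
  map_eq_zero : e p = 0
  holomorphic : MDifferentiableOn complexHalfModel 𝓘(ℂ, ℂ) e e.source
  holomorphic_symm : MDifferentiableOn 𝓘(ℂ, ℂ) complexHalfModel e.symm e.target

/-- The integral of `α` over the counter-clockwise circle `|z| = ε` in the local coordinate `e`
(meaningful if the circle lies in the range of the coordinate). -/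
noncomputable def coordCircleIntegral (α : DForm X 1) (e : OpenPartialHomeomorph X ℂ) (ε : ℝ) : ℂ :=
  ∫ θ in (0 : ℝ)..2 * Real.pi,
    ((α (e.symm (circleMap 0 ε θ))).compContinuousLinearMap
      (mfderiv 𝓘(ℝ, ℂ) realHalfModel e.symm (circleMap 0 ε θ)) :
        ℂ [⋀^Fin 1]→L[ℝ] ℂ) ![deriv (circleMap 0 ε) θ]

/-- `r` is the residue of `α` at `p`: in every local coordinate `z` vanishing at `p`, the limit of
`∫_{|z| = ε} α` as `ε → 0` exists and equals `2πi r`. -/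
def HasResidueAt (α : DForm X 1) (p : X) (r : ℂ) : Prop :=
  ∀ e : OpenPartialHomeomorph X ℂ, IsLocalCoordinate p e →
    Filter.Tendsto (coordCircleIntegral α e) (𝓝[>] 0) (𝓝 (2 * Real.pi * Complex.I * r))

open Classical in
/-- The residue of `α` at `p` (zero if it is not well defined). -/
noncomputable def residueAt (α : DForm X 1) (p : X) : ℂ :=
  if h : ∃ r : ℂ, HasResidueAt α p r then h.choose else 0

/-- The global residue: the sum of the residues at the points of `D`. -/
noncomputable def residue (D : Finset X) (α : DForm X 1) : ℂ := ∑ p ∈ D, residueAt α p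

end Residues

end RiemannSurface

section

open Filter MeasureTheory Set Complex

/-! ### Parametric integrals and Fourier coefficients on small circles -/

/-! Near `p ∈ D` write `α = (a dz + b dz̄) / z^n` with `z(p) = 0`. Integration by parts, `a /
z^(k+2) = ∂(-a / ((k+1) z^(k+1))) + ∂a / ((k+1) z^(k+1))`, lowers the order of the pole of the
`dz`-coefficient until `α = dF + h dz / z + b dz̄ / z^n`, where `F = f / z^n` and `f`, `h` and a new
`b` are smooth (`exists_pole_reduction`, `PoleOrderLE.exists_expansion`).

On a small circle in any holomorphic coordinate `w`, the term `dF` integrates to zero and `h dz / z`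
contributes `2πi h(p)` in the limit. The last term becomes `w^(-m) w̄` times a smooth function, so
its circle integral sees only the Fourier mode `m + 1` of that function. This mode is `O(r^(m+1))`
by `circleFourier_isBigO`, and the integral is `O(r^2)`. Hence the residue is `h(p)` in every
coordinate (`tendsto_circle_integral_pullback`).

Let `dα = η + ∂β` be a decomposition and `γ = α - β`. On a surface every 2-form has type (1,1), so
`∂β = dβ` and `dγ = η` off `D`. A pole `1/z` is integrable in the plane, so `∫ η` converges
absolutely. As `β` has only a `dz̄`-term, it has no residue, so `γ` and `α` have the same residues.
Stokes' theorem on the punctured surface (`surfaceIntegral_extD`) gives `∫ η = ∫_∂ γ - 2πi Res α`.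
Adding `∫_∂ β` yields the formula for every decomposition at once, and with it the independence
(`IsDecomposition.integral_eq`).

A decomposition exists because `F` can be cut off to a global function: for `β` the (0,1)-part of `α
- dF`, the form `α - β` equals `dF + h dz / z` near `p`, and its differential `∂̄h ∧ dz / z` is
logarithmic (`exists_isDecomposition`).

Stokes' theorem itself is reduced by cut-off functions to forms supported in one chart: smooth forms
on the half-plane, treated by Fubini, and forms on the plane with one singular point, treated in
polar coordinates. -/

/-- Differentiation under an interval integral with jointly continuous derivative. -/
theorem hasDerivAt_intervalIntegral_of_continuousOn {E : Type*} [NormedAddCommGroup E]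
    [NormedSpace ℝ E] {G G' : ℝ → ℝ → E} {s : Set ℝ} (hs : IsOpen s) {r₀ : ℝ} (hr : r₀ ∈ s)
    (a b : ℝ) (hG : ∀ r ∈ s, ∀ t, HasDerivAt (fun x => G x t) (G' r t) r)
    (hGc : ∀ r ∈ s, Continuous (G r))
    (hG' : ContinuousOn (Function.uncurry G') (s ×ˢ univ)) :
    HasDerivAt (fun r => ∫ t in a..b, G r t) (∫ t in a..b, G' r₀ t) r₀ := by
  obtain ⟨ε, hε, hsub⟩ := Metric.nhds_basis_closedBall.mem_iff.1 (hs.mem_nhds hr)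
  have hK : IsCompact (Metric.closedBall r₀ ε ×ˢ uIcc a b) :=
    (isCompact_closedBall _ _).prod isCompact_uIcc
  obtain ⟨C, hC⟩ := hK.exists_bound_of_continuousOn
    (hG'.mono (prod_mono hsub (subset_univ _)))
  have hc' : Continuous (G' r₀) := by
    have : ContinuousOn (fun t => Function.uncurry G' (r₀, t)) univ :=
      hG'.comp (by fun_prop) fun t _ => ⟨hr, mem_univ _⟩
    exact continuousOn_univ.1 this
  refine (intervalIntegral.hasDerivAt_integral_of_dominated_loc_of_deriv_le
    (F := G) (F' := G') (bound := fun _ => C) (Metric.closedBall_mem_nhds r₀ hε) ?_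
    ((hGc r₀ hr).intervalIntegrable _ _) hc'.aestronglyMeasurable ?_ (by simp) ?_).2
  · filter_upwards [hs.mem_nhds hr] with r hr
    exact (hGc r hr).aestronglyMeasurable
  · exact Eventually.of_forall fun t ht r hr => hC (r, t) ⟨hr, uIoc_subset_uIcc ht⟩
  · exact Eventually.of_forall fun t _ r hr => hG r (hsub hr) t

/-! ### Wirtinger calculus -/

/-- The Wirtinger derivative `∂/∂z`. -/
noncomputable def wirtinger (a : ℂ → ℂ) (z : ℂ) : ℂ :=
  (fderiv ℝ a z 1 - I * fderiv ℝ a z I) / 2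

/-- The Wirtinger derivative `∂/∂z̄`. -/
noncomputable def wirtingerBar (a : ℂ → ℂ) (z : ℂ) : ℂ :=
  (fderiv ℝ a z 1 + I * fderiv ℝ a z I) / 2

/-- Expanding `v` in the real basis `1, I` separates the complex-linear from the antilinear part;
this supplies the `dz`- and `dz̄`-coefficients both of derivatives and of alternating 1-forms. -/
theorem real_linear_apply (f : ℂ →L[ℝ] ℂ) (v : ℂ) :
    f v = (f 1 - I * f I) / 2 * v + (f 1 + I * f I) / 2 * (starRingEnd ℂ) v := by
  have h : f v = v.re * f 1 + v.im * f I := by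
    conv_lhs => rw [← Complex.re_add_im v]
    have e1 : (v.re : ℂ) = v.re • (1 : ℂ) := by simp
    have e2 : (v.im : ℂ) * I = v.im • I := by simp
    rw [map_add, e1, e2, map_smul, map_smul]
    simp
  have hI : I * I = -1 := I_mul_I
  rw [h]
  conv_rhs => rw [← Complex.re_add_im v]
  simp only [map_add, map_mul, conj_ofReal, conj_I]
  linear_combination ((v.im : ℂ) * f I) * hI

theorem fderiv_eq_wirtinger (a : ℂ → ℂ) (z v : ℂ) :
    fderiv ℝ a z v = wirtinger a z * v + wirtingerBar a z * (starRingEnd ℂ) v :=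
  real_linear_apply _ _

theorem ContDiffAt.wirtinger {a : ℂ → ℂ} {c : ℂ} (ha : ContDiffAt ℝ ∞ a c) :
    ContDiffAt ℝ ∞ (wirtinger a) c := by
  have h : ContDiffAt ℝ ∞ (fderiv ℝ a) c := ha.fderiv_right (by simp)
  unfold _root_.wirtinger
  fun_prop

theorem ContDiffAt.wirtingerBar {a : ℂ → ℂ} {c : ℂ} (ha : ContDiffAt ℝ ∞ a c) :
    ContDiffAt ℝ ∞ (wirtingerBar a) c := by
  have h : ContDiffAt ℝ ∞ (fderiv ℝ a) c := ha.fderiv_right (by simp)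
  unfold _root_.wirtingerBar
  fun_prop

/-- Smoothness of order `∞` at a point gives, for each finite order, a neighbourhood that may depend
on the order. Order one suffices for every use of the ball. -/
theorem ContDiffAt.exists_ball {E F : Type*} [NormedAddCommGroup E] [NormedSpace ℝ E]
    [NormedAddCommGroup F] [NormedSpace ℝ F] {f : E → F} {c : E} (hf : ContDiffAt ℝ ∞ f c) :
    ∃ δ > 0, ContDiffOn ℝ 1 f (Metric.ball c δ) := by
  have h1 : ContDiffAt ℝ 1 f c := hf.of_le (by simp)
  obtain ⟨δ, hδ, h⟩ := Metric.eventually_nhds_iff_ball.1 (h1.eventually (by simp))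
  exact ⟨δ, hδ, fun z hz => (h z hz).contDiffWithinAt⟩

/-! ### Decay of Fourier coefficients on small circles -/

/-- The `k`-th Fourier coefficient of `b` on the circle of radius `r`, up to normalization. -/
noncomputable def circleFourier (k : ℕ) (b : ℂ → ℂ) (r : ℝ) : ℂ :=
  ∫ θ in (0 : ℝ)..2 * Real.pi, b (circleMap 0 r θ) * exp (-(k * θ * I))

theorem integral_exp_neg_nat_mul (k : ℕ) (hk : k ≠ 0) :
    ∫ θ in (0 : ℝ)..2 * Real.pi, exp (-(k * θ * I)) = 0 := by
  have hc : (-(k * I) : ℂ) ≠ 0 := by simp [hk]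
  have h := integral_exp_mul_complex (a := 0) (b := 2 * Real.pi) hc
  have e : ∀ θ : ℝ, exp (-(k * θ * I)) = exp (-(k * I) * θ) := fun θ => by congr 1; ring
  simp_rw [e, h]
  have : exp (-(k * I) * ((2 * Real.pi : ℝ) : ℂ)) = 1 := by
    rw [Complex.exp_eq_one_iff]
    exact ⟨-k, by push_cast; ring⟩
  rw [this]
  simp

theorem hasDerivAt_circleMap_radius (r θ : ℝ) :
    HasDerivAt (fun x : ℝ => circleMap 0 x θ) (exp (θ * I)) r := by
  have : HasDerivAt (fun x : ℝ => (x : ℂ) * exp (θ * I)) (1 * exp (θ * I)) r :=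
    (Complex.ofRealCLM.hasDerivAt (x := r)).mul_const _
  simpa [circleMap] using this

/-- The radial derivative of `b` is `∂b e^(iθ) + ∂̄b e^(-iθ)`; the two exponentials shift the
frequency `k + 1` to `k` and to `k + 2`. -/
theorem hasDerivAt_circleFourier (k : ℕ) {b : ℂ → ℂ} {δ : ℝ}
    (hb : ContDiffOn ℝ 1 b (Metric.ball 0 δ)) {r : ℝ} (hr : |r| < δ) :
    HasDerivAt (circleFourier (k + 1) b)
      (circleFourier k (wirtinger b) r + circleFourier (k + 2) (wirtingerBar b) r) r := by
  have hmem : ∀ x ∈ Metric.ball (0 : ℝ) δ, ∀ θ, circleMap 0 x θ ∈ Metric.ball (0 : ℂ) δ := by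
    intro x hx θ
    simpa [norm_circleMap_zero] using hx
  have hcirc : Continuous fun p : ℝ × ℝ => circleMap 0 p.1 p.2 := by
    unfold circleMap; fun_prop
  have hfd : ContinuousOn (fderiv ℝ b) (Metric.ball 0 δ) :=
    hb.continuousOn_fderiv_of_isOpen Metric.isOpen_ball le_rfl
  have hcirc' : ∀ x : ℝ, Continuous (circleMap 0 x) := continuous_circleMap 0
  have hrb : r ∈ Metric.ball (0 : ℝ) δ := by simpa using hr
  have h := hasDerivAt_intervalIntegral_of_continuousOn (r₀ := r)
    (G := fun x θ => b (circleMap 0 x θ) * exp (-((k + 1 : ℕ) * θ * I)))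
    (G' := fun x θ => fderiv ℝ b (circleMap 0 x θ) (exp (θ * I)) * exp (-((k + 1 : ℕ) * θ * I)))
    Metric.isOpen_ball hrb 0 (2 * Real.pi) ?_ ?_ ?_
  · have hw : Continuous fun θ : ℝ => _root_.wirtinger b (circleMap 0 r θ) := by
      have : Continuous fun θ : ℝ => fderiv ℝ b (circleMap 0 r θ) :=
        hfd.comp_continuous (hcirc' r) (hmem r hrb)
      unfold wirtinger; fun_prop
    have hw' : Continuous fun θ : ℝ => _root_.wirtingerBar b (circleMap 0 r θ) := by
      have : Continuous fun θ : ℝ => fderiv ℝ b (circleMap 0 r θ) :=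
        hfd.comp_continuous (hcirc' r) (hmem r hrb)
      unfold wirtingerBar; fun_prop
    unfold circleFourier
    rw [← intervalIntegral.integral_add]
    · refine h.congr_deriv (intervalIntegral.integral_congr fun θ _ => ?_)
      simp only [fderiv_eq_wirtinger, ← Complex.exp_conj, add_mul, mul_assoc, ← Complex.exp_add,
        map_mul, conj_ofReal, conj_I]
      congr 3 <;> (push_cast; ring_nf)
    · exact Continuous.intervalIntegrable (by fun_prop) _ _
    · exact Continuous.intervalIntegrable (by fun_prop) _ _
  · intro x hx θ
    have h1 : HasFDerivAt b (fderiv ℝ b (circleMap 0 x θ)) (circleMap 0 x θ) :=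
      ((hb.differentiableOn one_ne_zero).differentiableAt
        (Metric.isOpen_ball.mem_nhds (hmem x hx θ))).hasFDerivAt
    exact (h1.comp_hasDerivAt x (hasDerivAt_circleMap_radius x θ)).mul_const _
  · intro x hx
    exact (hb.continuousOn.comp_continuous (hcirc' x) (hmem x hx)).mul (by fun_prop)
  · have h1 : ContinuousOn (fun p : ℝ × ℝ => fderiv ℝ b (circleMap 0 p.1 p.2))
        (Metric.ball 0 δ ×ˢ univ) :=
      hfd.comp hcirc.continuousOn fun p hp => hmem p.1 hp.1 p.2
    have h2 : Continuous fun p : ℝ × ℝ => exp (p.2 * I) := by fun_prop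
    exact (h1.clm_apply h2.continuousOn).mul (by fun_prop)

/-- The `k`-th Fourier coefficient on the circle of radius `r` of a smooth function is `O(r ^ k)`. -/
theorem circleFourier_isBigO (j m : ℕ) {b : ℂ → ℂ} (hb : ContDiffAt ℝ ∞ b 0) :
    ∃ C, ∃ δ > 0, ∀ r ∈ Ico (0 : ℝ) δ, ‖circleFourier (j + m) b r‖ ≤ C * r ^ j := by
  induction j generalizing m b with
  | zero =>
    obtain ⟨δ, hδ, hbd⟩ := hb.exists_ball
    have hc : ContinuousOn b (Metric.closedBall 0 (δ / 2)) :=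
      hbd.continuousOn.mono (Metric.closedBall_subset_ball (by linarith))
    obtain ⟨C, hC⟩ := (isCompact_closedBall (0 : ℂ) (δ / 2)).exists_bound_of_continuousOn hc
    refine ⟨C * |2 * Real.pi - 0|, δ / 2, by linarith, fun r hr => ?_⟩
    rw [pow_zero, mul_one]
    refine intervalIntegral.norm_integral_le_of_norm_le_const fun θ _ => ?_
    have h1 : ‖exp (-(((0 + m : ℕ) : ℂ) * θ * I))‖ = 1 := by
      rw [Complex.norm_exp]; simp
    rw [norm_mul, h1, mul_one]
    refine hC _ ?_
    simp [norm_circleMap_zero, abs_of_nonneg hr.1, hr.2.le]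
  | succ j ih =>
    -- The derivative involves the frequencies `j + m` for `∂b` and `j + (m + 2)` for `∂̄b`. The
    -- free surplus `m` in the induction absorbs the second shift, so both are `O(r^j)` and
    -- integrating gains one power.
    obtain ⟨C₁, δ₁, hδ₁, h₁⟩ := ih m hb.wirtinger
    obtain ⟨C₂, δ₂, hδ₂, h₂⟩ := ih (m + 2) hb.wirtingerBar
    obtain ⟨δ, hδ, hbd⟩ := hb.exists_ball
    refine ⟨|C₁| + |C₂|, min δ (min δ₁ δ₂), by positivity, fun r hr => ?_⟩
    obtain ⟨hr0, hr1⟩ := hr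
    simp only [lt_min_iff] at hr1
    have hd : ∀ x ∈ Icc 0 r, HasDerivAt (circleFourier (j + 1 + m) b)
        (circleFourier (j + m) (_root_.wirtinger b) x
          + circleFourier (j + (m + 2)) (_root_.wirtingerBar b) x) x := by
      intro x hx
      have := hasDerivAt_circleFourier (j + m) hbd (r := x)
        (by rw [abs_of_nonneg hx.1]; linarith [hx.2])
      rw [show j + (m + 2) = j + m + 2 by ring, show j + 1 + m = j + m + 1 by ring]
      exact this
    -- At radius zero `b` is constant along the circle and the character of nonzero frequency
    -- integrates to zero.
    have h0 : circleFourier (j + 1 + m) b 0 = 0 := by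
      have := integral_exp_neg_nat_mul (j + 1 + m) (by omega)
      simp [circleFourier, circleMap, -Nat.cast_add] at this ⊢
      right
      simpa using this
    have := norm_image_sub_le_of_norm_deriv_right_le_segment (C := (|C₁| + |C₂|) * r ^ j)
      (fun x hx => (hd x hx).continuousAt.continuousWithinAt)
      (fun x hx => (hd x ⟨hx.1, hx.2.le⟩).hasDerivWithinAt) (fun x hx => ?_) r ⟨hr0, le_rfl⟩
    · rw [h0, sub_zero] at this
      calc _ ≤ _ := this
        _ = _ := by ring
    · have hp : x ^ j ≤ r ^ j := pow_le_pow_left₀ hx.1 hx.2.le j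
      have hx' : 0 ≤ x ^ j := pow_nonneg hx.1 j
      calc _ ≤ _ := norm_add_le _ _
        _ ≤ C₁ * x ^ j + C₂ * x ^ j :=
          add_le_add (h₁ x ⟨hx.1, by linarith [hx.2]⟩) (h₂ x ⟨hx.1, by linarith [hx.2]⟩)
        _ ≤ |C₁| * r ^ j + |C₂| * r ^ j := by
          gcongr <;> exact le_abs_self _
        _ = _ := by ring

/-! ### Residues in the plane -/

theorem wirtinger_mul_of_hasDerivAt {g f : ℂ → ℂ} {g' z : ℂ} (hg : HasDerivAt g g' z)
    (hf : DifferentiableAt ℝ f z) :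
    wirtinger (fun w => g w * f w) z = g' * f z + g z * wirtinger f z := by
  have hgr : HasFDerivAt g ((ContinuousLinearMap.toSpanSingleton ℂ g').restrictScalars ℝ) z :=
    hg.hasFDerivAt.restrictScalars ℝ
  have := (hgr.mul hf.hasFDerivAt).fderiv
  have h2 : fderiv ℝ (fun w => g w * f w) z = g z • fderiv ℝ f z +
    f z • (ContinuousLinearMap.toSpanSingleton ℂ g').restrictScalars ℝ := this
  unfold wirtinger
  rw [h2]
  have hI : I * I = -1 := I_mul_I
  simp
  linear_combination (- (g' * f z) / 2) * hI

theorem wirtinger_add {f g : ℂ → ℂ} {z : ℂ} (hf : DifferentiableAt ℝ f z)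
    (hg : DifferentiableAt ℝ g z) :
    wirtinger (fun w => f w + g w) z = wirtinger f z + wirtinger g z := by
  unfold wirtinger
  rw [fderiv_fun_add hf hg]
  simp
  ring

theorem eventually_differentiableAt {f : ℂ → ℂ} {c : ℂ} (hf : ContDiffAt ℝ ∞ f c) :
    ∀ᶠ z in 𝓝 c, DifferentiableAt ℝ f z := by
  filter_upwards [(hf.of_le (m := 1) (by simp)).eventually (by simp)] with z hz
  exact hz.differentiableAt one_ne_zero

theorem hasDerivAt_inv_pow_sub (c : ℂ) (n : ℕ) {z : ℂ} (hz : z ≠ c) :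
    HasDerivAt (fun w => ((w - c) ^ n)⁻¹) (-(n : ℂ) * ((z - c) ^ (n + 1))⁻¹) z := by
  have h0 : z - c ≠ 0 := sub_ne_zero.2 hz
  have h := (((hasDerivAt_id z).sub_const c).pow n).inv (pow_ne_zero n h0)
  refine h.congr_deriv ?_
  rcases n with _ | n
  · simp
  · simp only [id]
    push_cast
    simp only [Pi.pow_apply]
    field_simp
    ring

/-- Up to `∂`-exact terms, a pole of a smooth coefficient of `dz` can be taken to be simple. -/
theorem exists_pole_reduction (c : ℂ) (n : ℕ) {a : ℂ → ℂ}
    (ha : ∀ᶠ z in 𝓝 c, ContDiffAt ℝ ∞ a z) :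
    ∃ f h : ℂ → ℂ, (∀ᶠ z in 𝓝 c, ContDiffAt ℝ ∞ f z) ∧ (∀ᶠ z in 𝓝 c, ContDiffAt ℝ ∞ h z) ∧
      ∀ᶠ z in 𝓝[≠] c,
      ((z - c) ^ n)⁻¹ * a z =
        wirtinger (fun w => ((w - c) ^ n)⁻¹ * f w) z + (z - c)⁻¹ * h z := by
  induction n generalizing a with
  | zero =>
    -- Without a pole, `a = (z - c)⁻¹ ((z - c) a)` already has the required form.
    refine ⟨0, fun z => (z - c) * a z, Eventually.of_forall fun _ => contDiffAt_const, ?_, ?_⟩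
    · filter_upwards [ha] with z hz
      fun_prop
    filter_upwards [self_mem_nhdsWithin] with z hz
    have h0 : z - c ≠ 0 := sub_ne_zero.2 hz
    simp [wirtinger, h0]
  | succ n ih =>
    rcases n with _ | k
    · refine ⟨0, a, Eventually.of_forall fun _ => contDiffAt_const, ha, Eventually.of_forall fun z => ?_⟩
      simp [wirtinger]
    -- Integration by parts trades `a / z^(k+2)` for `∂a / ((k+1) z^(k+1))` modulo `∂(-a / ((k+1)
    -- z^(k+1)))`.
    · obtain ⟨f, h, hf, hh, he⟩ := ih (a := fun z => wirtinger a z / (k + 1 : ℕ))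
        (ha.mono fun z hz => hz.wirtinger.div_const _)
      -- Both primitives have denominator `(z - c)^(k+1)`; the factor `z - c` brings them over `(z -
      -- c)^(k+2)`.
      refine ⟨fun z => (z - c) * (f z - a z / (k + 1 : ℕ)), h, ?_, hh, ?_⟩
      · filter_upwards [ha, hf] with z hz hz'
        fun_prop
      filter_upwards [he, self_mem_nhdsWithin,
        eventually_nhdsWithin_of_eventually_nhds (eventually_differentiableAt ha.self_of_nhds),
        eventually_nhdsWithin_of_eventually_nhds (eventually_differentiableAt hf.self_of_nhds)]
        with z hz hzc hza hzf
      have h0 : z - c ≠ 0 := sub_ne_zero.2 hzc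
      have hk : ((k + 1 : ℕ) : ℂ) ≠ 0 := Nat.cast_ne_zero.2 (Nat.succ_ne_zero k)
      have hda : DifferentiableAt ℝ (fun w => a w / ((k + 1 : ℕ) : ℂ)) z := by
        simp only [div_eq_mul_inv]
        exact hza.mul_const _
      have e1 : wirtinger (fun w => ((w - c) ^ (k + 1 + 1))⁻¹ *
          ((w - c) * (f w - a w / (k + 1 : ℕ)))) z =
          wirtinger (fun w => ((w - c) ^ (k + 1))⁻¹ * (f w + -1 * (a w / (k + 1 : ℕ)))) z := by
        unfold wirtinger
        rw [EventuallyEq.fderiv_eq]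
        filter_upwards [eventually_ne_nhds (show z ≠ c from hzc)] with w hw
        have : w - c ≠ 0 := sub_ne_zero.2 hw
        field_simp
        ring
      have e2 : wirtinger (fun w => -1 * (a w / (k + 1 : ℕ))) z
          = -(wirtinger a z / (k + 1 : ℕ)) := by
        rw [wirtinger_mul_of_hasDerivAt (hasDerivAt_const z (-1 : ℂ)) hda]
        have : wirtinger (fun w => a w / (k + 1 : ℕ)) z = wirtinger a z / (k + 1 : ℕ) := by
          simp_rw [div_eq_inv_mul]
          rw [wirtinger_mul_of_hasDerivAt (hasDerivAt_const z _) hza]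
          simp
        rw [this]; simp
      rw [wirtinger_mul_of_hasDerivAt (hasDerivAt_inv_pow_sub c (k + 1) hzc) hzf] at hz
      rw [e1, wirtinger_mul_of_hasDerivAt (hasDerivAt_inv_pow_sub c (k + 1) hzc)
        (hzf.fun_add (hda.const_mul (-1))), wirtinger_add hzf (hda.const_mul (-1)), e2]
      have : ((z - c) ^ (k + 1 + 1))⁻¹ * a z = ((k + 1 : ℕ) : ℂ) * ((z - c) ^ (k + 1 + 1))⁻¹ *
        (a z / (k + 1 : ℕ)) := by field_simp
      rw [this]
      linear_combination hz

theorem eventually_forall_circleMap {P : ℂ → Prop} (h : ∀ᶠ w in 𝓝[≠] (0 : ℂ), P w) :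
    ∀ᶠ r in 𝓝[>] (0 : ℝ), ∀ θ : ℝ, P (circleMap 0 r θ) := by
  rw [eventually_nhdsWithin_iff, Metric.eventually_nhds_iff_ball] at h
  obtain ⟨δ, hδ, h⟩ := h
  filter_upwards [Ioo_mem_nhdsGT hδ] with r hr θ
  refine h _ ?_ (circleMap_ne_center hr.1.ne')
  simpa [norm_circleMap_zero, abs_of_pos hr.1] using hr.2

theorem eventually_continuous_circleMap {G : ℂ → ℂ} (h : ∀ᶠ w in 𝓝[≠] (0 : ℂ), ContinuousAt G w) :
    ∀ᶠ r in 𝓝[>] (0 : ℝ), Continuous fun θ : ℝ => G (circleMap 0 r θ) := by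
  filter_upwards [eventually_forall_circleMap h] with r hr
  exact continuous_iff_continuousAt.2 fun θ =>
    ContinuousAt.comp (f := circleMap 0 r) (hr θ) (continuous_circleMap 0 r).continuousAt

theorem tendsto_integral_circleMap {H : ℂ → ℂ} (h : ∀ᶠ w in 𝓝 (0 : ℂ), ContinuousAt H w) :
    Tendsto (fun r => ∫ θ in (0 : ℝ)..2 * Real.pi, H (circleMap 0 r θ)) (𝓝[>] 0)
      (𝓝 (2 * Real.pi * H 0)) := by
  rw [Metric.tendsto_nhds]
  intro ε hε
  have h0 : ContinuousAt H 0 := h.self_of_nhds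
  have hπ := Real.pi_pos
  have hε' : 0 < ε / (2 * (2 * Real.pi)) := by positivity
  have h1 : ∀ᶠ w in 𝓝[≠] (0 : ℂ), dist (H w) (H 0) < ε / (2 * (2 * Real.pi)) :=
    eventually_nhdsWithin_of_eventually_nhds (Metric.tendsto_nhds.1 h0 _ hε')
  filter_upwards [eventually_forall_circleMap h1,
    eventually_continuous_circleMap (eventually_nhdsWithin_of_eventually_nhds h)] with r hr hc
  have e : (∫ θ in (0 : ℝ)..2 * Real.pi, H (circleMap 0 r θ)) - 2 * Real.pi * H 0
      = ∫ θ in (0 : ℝ)..2 * Real.pi, (H (circleMap 0 r θ) - H 0) := by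
    rw [intervalIntegral.integral_sub (hc.intervalIntegrable _ _) (by simp)]
    simp
  rw [dist_eq_norm, e]
  calc _ ≤ ε / (2 * (2 * Real.pi)) * |2 * Real.pi - 0| :=
        intervalIntegral.norm_integral_le_of_norm_le_const fun θ _ => by
          rw [← dist_eq_norm]; exact (hr θ).le
    _ = ε / 2 := by
        rw [sub_zero, abs_of_pos (by positivity)]; field_simp
    _ < ε := by linarith

theorem eventually_ne_of_deriv_ne_zero {ψ : ℂ → ℂ} (hψ : AnalyticAt ℂ ψ 0)
    (hψ' : deriv ψ 0 ≠ 0) : Tendsto ψ (𝓝[≠] 0) (𝓝[≠] (ψ 0)) := by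
  refine tendsto_nhdsWithin_iff.2 ⟨hψ.continuousAt.tendsto.mono_left nhdsWithin_le_nhds, ?_⟩
  exact hψ.differentiableAt.hasDerivAt.eventually_ne hψ'

theorem contDiffAt_real_of_analyticAt {ψ : ℂ → ℂ} {z : ℂ} (h : AnalyticAt ℂ ψ z) :
    ContDiffAt ℝ ∞ ψ z :=
  (h.contDiffAt (n := ∞)).restrict_scalars ℝ

/-- The quotient is `dslope`, analytic with value `ψ'(0)` at the origin. For a coordinate change `u`
is a unit near `0`, so powers of `ψ w - ψ 0` can be exchanged for powers of `w`. -/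
theorem exists_eq_add_mul {ψ : ℂ → ℂ} (hψ : AnalyticAt ℂ ψ 0) :
    ∃ u : ℂ → ℂ, AnalyticAt ℂ u 0 ∧ u 0 = deriv ψ 0 ∧ ∀ w, ψ w - ψ 0 = w * u w := by
  obtain ⟨p, hp⟩ := hψ
  refine ⟨dslope ψ 0, ⟨_, hp.has_fpower_series_dslope_fslope⟩, dslope_same _ _, fun w => ?_⟩
  simpa using (sub_smul_dslope ψ 0 w).symm

/-! ### The three terms of a polar expansion in an arbitrary holomorphic coordinate -/

section

variable {ψ f h b : ℂ → ℂ} (hψ : AnalyticAt ℂ ψ 0) (hψ' : deriv ψ 0 ≠ 0)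
include hψ hψ'

/-- The integrand is the `θ`-derivative of a `2π`-periodic function. The continuity statements here
and in the next two lemmas provide the integrability needed to split the integral of the sum. -/
theorem eventually_integral_exact_eq_zero (n : ℕ) (hf : ContDiffAt ℝ ∞ f (ψ 0)) :
    (∀ᶠ w in 𝓝[≠] (0 : ℂ), ContinuousAt (fun w => fderiv ℝ
      (fun z => ((z - ψ 0) ^ n)⁻¹ * f z) (ψ w) (deriv ψ w * (w * I))) w) ∧
    ∀ᶠ r in 𝓝[>] (0 : ℝ), ∫ θ in (0 : ℝ)..2 * Real.pi, fderiv ℝ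
      (fun z => ((z - ψ 0) ^ n)⁻¹ * f z) (ψ (circleMap 0 r θ))
        (deriv ψ (circleMap 0 r θ) * (circleMap 0 r θ * I)) = 0 := by
  set F : ℂ → ℂ := fun z => ((z - ψ 0) ^ n)⁻¹ * f z
  have hF : ∀ᶠ z in 𝓝[≠] (ψ 0), ContDiffAt ℝ 1 F z := by
    filter_upwards [eventually_nhdsWithin_of_eventually_nhds
      ((hf.of_le (m := 1) (by simp)).eventually (by simp)), self_mem_nhdsWithin] with z hz hzc
    refine ContDiffAt.mul (ContDiffAt.inv (by fun_prop) (pow_ne_zero n (sub_ne_zero.2 hzc))) hz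
  have hF' := (eventually_ne_of_deriv_ne_zero hψ hψ').eventually hF
  have hcont : ∀ᶠ w in 𝓝[≠] (0 : ℂ),
      ContinuousAt (fun w => fderiv ℝ F (ψ w) (deriv ψ w * (w * I))) w := by
    filter_upwards [hF', eventually_nhdsWithin_of_eventually_nhds hψ.eventually_analyticAt]
      with w hw hwa
    have h1 : ContinuousAt (fun w => fderiv ℝ F (ψ w)) w :=
      ContinuousAt.comp (f := ψ) (hw.fderiv_right (m := 0) (by simp)).continuousAt
        hwa.continuousAt
    have h2 : ContinuousAt (deriv ψ) w := hwa.deriv.continuousAt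
    exact h1.clm_apply (by fun_prop)
  refine ⟨hcont, ?_⟩
  filter_upwards [eventually_continuous_circleMap hcont, eventually_forall_circleMap hF',
    eventually_forall_circleMap
      (eventually_nhdsWithin_of_eventually_nhds hψ.eventually_analyticAt)] with r hc hFr hψr
  rw [intervalIntegral.integral_eq_sub_of_hasDerivAt (f := fun θ => F (ψ (circleMap 0 r θ)))
    (fun θ _ => ?_) (hc.intervalIntegrable _ _)]
  · have := periodic_circleMap 0 r 0
    rw [zero_add] at this
    simp only [this, sub_self]
  · have h1 : HasDerivAt (fun θ => ψ (circleMap 0 r θ))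
        (circleMap 0 r θ * I * deriv ψ (circleMap 0 r θ)) θ := by
      have := (hψr θ).differentiableAt.hasDerivAt.scomp θ (hasDerivAt_circleMap 0 r θ)
      rwa [smul_eq_mul] at this
    rw [mul_comm] at h1
    exact ((hFr θ).differentiableAt one_ne_zero).hasFDerivAt.comp_hasDerivAt θ h1

/-- With `ψ w - ψ 0 = w u(w)`, the factor `w` cancels against `dw = i w dθ`. The integrand extends
continuously to `w = 0`, where `u(0) = ψ'(0)` cancels the Jacobian and leaves `i h(ψ 0)`. -/
theorem tendsto_integral_log (hh : ContDiffAt ℝ ∞ h (ψ 0)) :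
    (∀ᶠ w in 𝓝[≠] (0 : ℂ),
      ContinuousAt (fun w => (ψ w - ψ 0)⁻¹ * h (ψ w) * (deriv ψ w * (w * I))) w) ∧
    Tendsto (fun r => ∫ θ in (0 : ℝ)..2 * Real.pi,
      (ψ (circleMap 0 r θ) - ψ 0)⁻¹ * h (ψ (circleMap 0 r θ)) *
        (deriv ψ (circleMap 0 r θ) * (circleMap 0 r θ * I))) (𝓝[>] 0)
      (𝓝 (2 * Real.pi * I * h (ψ 0))) := by
  obtain ⟨u, hu, hu0, hψu⟩ := exists_eq_add_mul hψ
  set H : ℂ → ℂ := fun w => (u w)⁻¹ * h (ψ w) * (deriv ψ w * I)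
  have hH : ∀ᶠ w in 𝓝 (0 : ℂ), ContinuousAt H w := by
    filter_upwards [hu.eventually_analyticAt, hψ.eventually_analyticAt,
      hu.continuousAt.eventually_ne (hu0.trans_ne hψ'),
      hψ.continuousAt.eventually ((hh.of_le (m := 1) (by simp)).eventually (by simp))]
      with w h1 h2 h3 h4
    have e1 := h1.continuousAt
    have e2 := h2.deriv.continuousAt
    have e3 : ContinuousAt (fun w => h (ψ w)) w :=
      ContinuousAt.comp (f := ψ) h4.continuousAt h2.continuousAt
    exact ((e1.inv₀ h3).mul e3).mul (e2.mul continuousAt_const)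
  have hHeq : ∀ w : ℂ, w ≠ 0 → (ψ w - ψ 0)⁻¹ * h (ψ w) * (deriv ψ w * (w * I)) = H w := by
    intro w hw
    rw [hψu w, mul_inv]
    simp only [H]
    field_simp
  have hHe : ∀ w : ℂ, w ≠ 0 → (fun w => (ψ w - ψ 0)⁻¹ * h (ψ w) * (deriv ψ w * (w * I)))
      =ᶠ[𝓝 w] H := fun w hw => by
    filter_upwards [eventually_ne_nhds hw] with w hw using hHeq w hw
  refine ⟨?_, ?_⟩
  · filter_upwards [eventually_nhdsWithin_of_eventually_nhds hH, self_mem_nhdsWithin] with w h1 h2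
    exact h1.congr (hHe w h2).symm
  · have h0 : 2 * Real.pi * I * h (ψ 0) = 2 * Real.pi * H 0 := by
      simp only [H, hu0]; field_simp
    rw [h0]
    refine (tendsto_integral_circleMap hH).congr' ?_
    filter_upwards [self_mem_nhdsWithin] with r hr
    exact intervalIntegral.integral_congr fun θ _ =>
      (hHeq _ (circleMap_ne_center (ne_of_gt hr))).symm

/-- The size of the integrand is no help when `m ≥ 1`; the limit is zero through cancellation in
`θ`. After factoring out `u^m`, what is left is `w^(-m) w̄ B(w)` with `B` smooth. -/
theorem tendsto_integral_antiholomorphic (m : ℕ) (hb : ContDiffAt ℝ ∞ b (ψ 0)) :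
    (∀ᶠ w in 𝓝[≠] (0 : ℂ), ContinuousAt (fun w => ((ψ w - ψ 0) ^ m)⁻¹ * b (ψ w) *
      (starRingEnd ℂ) (deriv ψ w * (w * I))) w) ∧
    Tendsto (fun r => ∫ θ in (0 : ℝ)..2 * Real.pi,
      ((ψ (circleMap 0 r θ) - ψ 0) ^ m)⁻¹ * b (ψ (circleMap 0 r θ)) *
        (starRingEnd ℂ) (deriv ψ (circleMap 0 r θ) * (circleMap 0 r θ * I))) (𝓝[>] 0)
      (𝓝 0) := by
  obtain ⟨u, hu, hu0, hψu⟩ := exists_eq_add_mul hψ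
  set B : ℂ → ℂ := fun w => (u w ^ m)⁻¹ * b (ψ w) * (starRingEnd ℂ) (deriv ψ w * I)
  have hB : ContDiffAt ℝ ∞ B 0 := by
    have h1 := contDiffAt_real_of_analyticAt hu
    have h2 := contDiffAt_real_of_analyticAt hψ.deriv
    have h3 : ContDiffAt ℝ ∞ (fun w => b (ψ w)) 0 :=
      ContDiffAt.comp (f := ψ) 0 hb (contDiffAt_real_of_analyticAt hψ)
    have h4 : ContDiffAt ℝ ∞ (fun w => (starRingEnd ℂ) (deriv ψ w * I)) 0 :=
      conjCLE.contDiff.contDiffAt.comp (f := fun w => deriv ψ w * I) 0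
        (h2.mul contDiffAt_const)
    exact (((h1.pow m).inv (pow_ne_zero m (hu0.trans_ne hψ'))).mul h3).mul h4
  have hBeq : ∀ w : ℂ, w ≠ 0 → ((ψ w - ψ 0) ^ m)⁻¹ * b (ψ w) *
      (starRingEnd ℂ) (deriv ψ w * (w * I)) = (w ^ m)⁻¹ * (starRingEnd ℂ) w * B w := by
    intro w hw
    rw [hψu w, mul_pow, mul_inv]
    simp only [B, map_mul]
    ring
  refine ⟨?_, ?_⟩
  · filter_upwards [eventually_nhdsWithin_of_eventually_nhds
      ((hB.of_le (m := 1) (by simp)).eventually (by simp)), self_mem_nhdsWithin] with w h1 h2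
    have h2' : w ≠ 0 := h2
    have h3 : ContinuousAt (fun w => (w ^ m)⁻¹ * (starRingEnd ℂ) w * B w) w :=
      (((continuousAt_id.pow m).inv₀ (pow_ne_zero m h2')).mul
        continuous_conj.continuousAt).mul h1.continuousAt
    refine h3.congr ?_
    filter_upwards [eventually_ne_nhds h2'] with w hw using (hBeq w hw).symm
  -- On `|w| = r` one has `w^(-m) w̄ = r^(1-m) e^(-i(m+1)θ)`, so the coefficient of index `m + 1`
  -- appears and the integral is `O(r^(1-m) r^(m+1)) = O(r^2)`.
  · obtain ⟨C, δ, hδ, hC⟩ := circleFourier_isBigO (m + 1) 0 hB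
    have h0 : Tendsto (fun r : ℝ => C * r ^ 2) (𝓝[>] 0) (𝓝 0) := by
      have : Tendsto (fun r : ℝ => C * r ^ 2) (𝓝 0) (𝓝 (C * 0 ^ 2)) :=
        Continuous.tendsto (by fun_prop) 0
      simpa using this.mono_left nhdsWithin_le_nhds
    refine squeeze_zero_norm' ?_ h0
    filter_upwards [Ioo_mem_nhdsGT hδ] with r hr
    have e : ∫ θ in (0 : ℝ)..2 * Real.pi,
      ((ψ (circleMap 0 r θ) - ψ 0) ^ m)⁻¹ * b (ψ (circleMap 0 r θ)) *
        (starRingEnd ℂ) (deriv ψ (circleMap 0 r θ) * (circleMap 0 r θ * I))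
        = ((r : ℂ) ^ m)⁻¹ * r * circleFourier (m + 1) B r := by
      unfold circleFourier
      rw [← intervalIntegral.integral_const_mul]
      refine intervalIntegral.integral_congr fun θ _ => ?_
      rw [hBeq _ (circleMap_ne_center hr.1.ne')]
      have e1 : ((circleMap 0 r θ) ^ m)⁻¹ * (starRingEnd ℂ) (circleMap 0 r θ) =
          ((r : ℂ) ^ m)⁻¹ * r * exp (-((m + 1 : ℕ) * θ * I)) := by
        simp only [circleMap, zero_add, mul_pow, mul_inv, map_mul, conj_ofReal, ← exp_conj, conj_I]
        rw [← exp_nat_mul, ← exp_neg]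
        have : exp (-((m + 1 : ℕ) * θ * I)) = exp (-(m * (θ * I))) * exp (θ * -I) := by
          rw [← exp_add]; congr 1; push_cast; ring
        rw [this]; ring
      rw [e1]; ring
    rw [e, norm_mul, norm_mul, norm_inv, norm_pow, norm_real, Real.norm_of_nonneg hr.1.le]
    calc _ ≤ (r ^ m)⁻¹ * r * (C * r ^ (m + 1)) := by
          have := hC r ⟨hr.1.le, hr.2⟩
          rw [add_zero] at this
          have hr' := hr.1.le
          gcongr
      _ = C * r ^ 2 := by
          have := hr.1.ne'
          field_simp
          ring

/-- A `1`-form `d(f / (z - c) ^ n) + h dz / (z - c) + b dz̄ / (z - c) ^ m` has residue `h c` at `c`,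
computed in an arbitrary holomorphic coordinate. -/
theorem tendsto_circle_integral_pullback {α : ℂ → ℂ → ℂ} (n m : ℕ)
    (hf : ContDiffAt ℝ ∞ f (ψ 0)) (hh : ContDiffAt ℝ ∞ h (ψ 0)) (hb : ContDiffAt ℝ ∞ b (ψ 0))
    (hα : ∀ᶠ z in 𝓝[≠] (ψ 0), ∀ v, α z v = fderiv ℝ (fun z => ((z - ψ 0) ^ n)⁻¹ * f z) z v +
      (z - ψ 0)⁻¹ * h z * v + ((z - ψ 0) ^ m)⁻¹ * b z * (starRingEnd ℂ) v) :
    Tendsto (fun r => ∫ θ in (0 : ℝ)..2 * Real.pi, α (ψ (circleMap 0 r θ))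
      (deriv ψ (circleMap 0 r θ) * deriv (circleMap 0 r) θ)) (𝓝[>] 0)
      (𝓝 (2 * Real.pi * I * h (ψ 0))) := by
  obtain ⟨c1, l1⟩ := eventually_integral_exact_eq_zero hψ hψ' n hf
  obtain ⟨c2, l2⟩ := tendsto_integral_log hψ hψ' hh
  obtain ⟨c3, l3⟩ := tendsto_integral_antiholomorphic hψ hψ' m hb
  have := l2.add l3
  rw [add_zero] at this
  refine this.congr' ?_
  filter_upwards [l1, eventually_continuous_circleMap c1, eventually_continuous_circleMap c2,
    eventually_continuous_circleMap c3, eventually_forall_circleMap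
      ((eventually_ne_of_deriv_ne_zero hψ hψ').eventually hα)] with r h1 d1 d2 d3 h4
  symm
  have e : ∀ θ : ℝ, α (ψ (circleMap 0 r θ)) (deriv ψ (circleMap 0 r θ) * deriv (circleMap 0 r) θ) =
      fderiv ℝ (fun z => ((z - ψ 0) ^ n)⁻¹ * f z) (ψ (circleMap 0 r θ))
        (deriv ψ (circleMap 0 r θ) * (circleMap 0 r θ * I)) +
      ((ψ (circleMap 0 r θ) - ψ 0)⁻¹ * h (ψ (circleMap 0 r θ)) *
        (deriv ψ (circleMap 0 r θ) * (circleMap 0 r θ * I)) +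
      ((ψ (circleMap 0 r θ) - ψ 0) ^ m)⁻¹ * b (ψ (circleMap 0 r θ)) *
        (starRingEnd ℂ) (deriv ψ (circleMap 0 r θ) * (circleMap 0 r θ * I))) := fun θ => by
    rw [h4 θ, deriv_circleMap, add_assoc]
  simp_rw [e]
  rw [intervalIntegral.integral_add (d1.intervalIntegrable _ _)
    ((d2.fun_add d3).intervalIntegrable _ _), intervalIntegral.integral_add
    (d2.intervalIntegrable _ _) (d3.intervalIntegrable _ _), h1, zero_add]

end

/-! ### Stokes' theorem in the half-plane and in the punctured plane -/

theorem ContinuousOn.integrableOn_of_eq_zero_off_compact {α E : Type*} [TopologicalSpace α]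
    [T2Space α] [MeasurableSpace α] [OpensMeasurableSpace α] {μ : Measure α}
    [IsFiniteMeasureOnCompacts μ] [NormedAddCommGroup E] [SecondCountableTopologyEither α E]
    {g : α → E} {U K : Set α} (hg : ContinuousOn g U) (hU : MeasurableSet U) (hK : IsCompact K)
    (hKU : K ⊆ U) (h0 : ∀ z ∈ U, z ∉ K → g z = 0) : IntegrableOn g U μ := by
  have h1 : IntegrableOn g K μ := (hg.mono hKU).integrableOn_compact hK
  exact h1.of_forall_sdiff_eq_zero hU fun z hz => h0 z hz.1 hz.2

/-- The closed upper half-plane as a subset of `ℂ`. -/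
abbrev closedUpperHalf : Set ℂ := {z : ℂ | 0 ≤ z.im}

theorem isClosed_closedUpperHalf : IsClosed closedUpperHalf :=
  isClosed_le continuous_const continuous_im

theorem closedUpperHalf_mem_nhds {z : ℂ} (hz : 0 < z.im) : closedUpperHalf ∈ 𝓝 z := by
  filter_upwards [(isOpen_lt continuous_const continuous_im).mem_nhds (show (0 : ℝ) < z.im from hz)]
    with w hw
  exact le_of_lt (show (0 : ℝ) < w.im from hw)

theorem interior_closedUpperHalf : interior closedUpperHalf = {z : ℂ | 0 < z.im} :=
  Complex.interior_setOfPred_le_im 0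

theorem uniqueDiffOn_closedUpperHalf : UniqueDiffOn ℝ closedUpperHalf := by
  refine uniqueDiffOn_convex (convex_halfSpace_im_ge 0) ⟨I, ?_⟩
  rw [interior_closedUpperHalf]
  simp

theorem setIntegral_closedUpperHalf {g : ℂ → ℂ} (hg : IntegrableOn g closedUpperHalf) :
    ∫ z in closedUpperHalf, g z = ∫ x : ℝ, ∫ y in Ioi (0 : ℝ), g (x + y * I) := by
  have hpre : measurableEquivRealProd.symm ⁻¹' closedUpperHalf = univ ×ˢ Ici (0 : ℝ) := by
    ext p; simp [measurableEquivRealProd]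
  have hval : ∀ p : ℝ × ℝ, measurableEquivRealProd.symm p = p.1 + p.2 * I := fun p => by
    apply Complex.ext <;> simp [measurableEquivRealProd]
  have hmp := volume_preserving_equiv_real_prod.symm
  have hme := measurableEquivRealProd.symm.measurableEmbedding
  rw [← hmp.setIntegral_preimage_emb hme, hpre, Measure.volume_eq_prod, setIntegral_prod]
  · simp only [setIntegral_univ, integral_Ici_eq_integral_Ioi, hval]
  · rw [← Measure.volume_eq_prod, ← hpre]
    exact (hmp.integrableOn_comp_preimage hme).2 hg

theorem setIntegral_closedUpperHalf_symm {g : ℂ → ℂ} (hg : IntegrableOn g closedUpperHalf) :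
    ∫ z in closedUpperHalf, g z = ∫ y in Ioi (0 : ℝ), ∫ x : ℝ, g (x + y * I) := by
  have hpre : measurableEquivRealProd.symm ⁻¹' closedUpperHalf = univ ×ˢ Ici (0 : ℝ) := by
    ext p; simp [measurableEquivRealProd]
  have hval : ∀ p : ℝ × ℝ, measurableEquivRealProd.symm p = p.1 + p.2 * I := fun p => by
    apply Complex.ext <;> simp [measurableEquivRealProd]
  have hmp := volume_preserving_equiv_real_prod.symm
  have hme := measurableEquivRealProd.symm.measurableEmbedding
  rw [← hmp.setIntegral_preimage_emb hme, hpre, Measure.volume_eq_prod,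
    ← Measure.prod_restrict, integral_prod_symm]
  · simp only [Measure.restrict_univ, integral_Ici_eq_integral_Ioi, hval]
  · rw [Measure.prod_restrict, ← Measure.volume_eq_prod, ← hpre]
    exact (hmp.integrableOn_comp_preimage hme).2 hg

/-- The coefficient of `dx ∧ dy` in the exterior derivative of a `1`-form. -/
noncomputable def curlWithin (A : ℂ → ℂ →L[ℝ] ℂ) (s : Set ℂ) (z : ℂ) : ℂ :=
  fderivWithin ℝ A s z 1 I - fderivWithin ℝ A s z I 1

/-! ### Compactly supported forms on the closed half-plane -/

section HalfPlaneStokes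

variable {A : ℂ → ℂ →L[ℝ] ℂ} (hA : ContDiffOn ℝ 1 A closedUpperHalf) {K : Set ℂ}
  (hK : IsCompact K) (h0 : ∀ z, z ∉ K → A z = 0)
include hA hK h0

omit hA in
theorem fderivWithin_closedUpperHalf_eq_zero {z : ℂ} (hz : z ∉ K) :
    fderivWithin ℝ A closedUpperHalf z = 0 := by
  have h1 : A =ᶠ[𝓝[closedUpperHalf] z] fun _ => 0 := by
    filter_upwards [mem_nhdsWithin_of_mem_nhds (hK.isClosed.isOpen_compl.mem_nhds hz)] with w hw
    exact h0 w hw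
  rw [h1.fderivWithin_eq (h0 z hz)]
  simp

theorem integrableOn_fderivWithin_closedUpperHalf (u v : ℂ) :
    IntegrableOn (fun z => fderivWithin ℝ A closedUpperHalf z u v) closedUpperHalf := by
  have hc : ContinuousOn (fderivWithin ℝ A closedUpperHalf) closedUpperHalf :=
    hA.continuousOn_fderivWithin uniqueDiffOn_closedUpperHalf le_rfl
  have hc' : ContinuousOn (fun z => fderivWithin ℝ A closedUpperHalf z u v) closedUpperHalf :=
    (hc.clm_apply continuousOn_const).clm_apply continuousOn_const
  refine hc'.integrableOn_of_eq_zero_off_compact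
    isClosed_closedUpperHalf.measurableSet (hK.inter_right isClosed_closedUpperHalf)
    inter_subset_right fun z hz hzK => ?_
  rw [fderivWithin_closedUpperHalf_eq_zero hK h0 fun h => hzK ⟨h, hz⟩]
  simp

/-- The `x`-integral is taken first: on a full horizontal line the coefficient has compact support,
so no boundary term arises. -/
theorem integral_fderivWithin_closedUpperHalf_one :
    ∫ z in closedUpperHalf, fderivWithin ℝ A closedUpperHalf z 1 I = 0 := by
  rw [setIntegral_closedUpperHalf_symm (integrableOn_fderivWithin_closedUpperHalf hA hK h0 1 I)]
  refine (setIntegral_congr_fun measurableSet_Ioi fun y hy => ?_).trans (integral_zero _ _)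
  have hy' : (0 : ℝ) < y := hy
  have hmem : ∀ x : ℝ, (x + y * I : ℂ) ∈ closedUpperHalf := fun x => by simp [hy'.le]
  have hline : ∀ x : ℝ, HasDerivAt (fun x : ℝ => (x + y * I : ℂ)) 1 x := fun x =>
    (Complex.ofRealCLM.hasDerivAt (x := x)).add_const _
  have hcl : Continuous fun x : ℝ => (x + y * I : ℂ) := by fun_prop
  have hsupp : ∀ x : ℝ, x ∉ re '' K → (x + y * I : ℂ) ∉ K := fun x hx hK' =>
    hx ⟨_, hK', by simp⟩
  have hKre : IsCompact (re '' K) := hK.image continuous_re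
  have hcf : Continuous fun x : ℝ => fderivWithin ℝ A closedUpperHalf (x + y * I) :=
    (hA.continuousOn_fderivWithin uniqueDiffOn_closedUpperHalf le_rfl).comp_continuous hcl hmem
  have hcA : Continuous fun x : ℝ => A (x + y * I) := hA.continuousOn.comp_continuous hcl hmem
  refine integral_eq_zero_of_hasDerivAt_of_integrable (f := fun x : ℝ => A (x + y * I) I)
    (fun x => ?_) ?_ ?_
  · have h1 := ((hA.differentiableOn one_ne_zero) _ (hmem x)).hasFDerivWithinAt
    have h2 := h1.comp_hasDerivAt x (hline x) (Eventually.of_forall hmem)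
    exact (ContinuousLinearMap.apply ℝ ℂ I).hasFDerivAt.comp_hasDerivAt x h2
  · refine Continuous.integrable_of_hasCompactSupport
      ((hcf.clm_apply continuous_const).clm_apply continuous_const)
      (HasCompactSupport.intro hKre fun x hx => ?_)
    rw [fderivWithin_closedUpperHalf_eq_zero hK h0 (hsupp x hx)]
    simp
  · refine Continuous.integrable_of_hasCompactSupport (hcA.clm_apply continuous_const)
      (HasCompactSupport.intro hKre fun x hx => ?_)
    rw [h0 _ (hsupp x hx)]
    simp

/-- The `y`-integral is taken first: on a vertical ray the fundamental theorem leaves minus the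
value at the endpoint on the real axis. -/
theorem integral_fderivWithin_closedUpperHalf_I :
    ∫ z in closedUpperHalf, fderivWithin ℝ A closedUpperHalf z I 1 = - ∫ x : ℝ, A x 1 := by
  rw [setIntegral_closedUpperHalf (integrableOn_fderivWithin_closedUpperHalf hA hK h0 I 1),
    ← integral_neg]
  refine integral_congr_ae (Eventually.of_forall fun x => ?_)
  have hmem : ∀ y ∈ Ici (0 : ℝ), (x + y * I : ℂ) ∈ closedUpperHalf := fun y hy => by simpa using hy
  have hline : ∀ y : ℝ, HasDerivAt (fun y : ℝ => (x + y * I : ℂ)) I y := fun y => by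
    simpa using ((Complex.ofRealCLM.hasDerivAt (x := y)).mul_const I).const_add (x : ℂ)
  have hcl : Continuous fun y : ℝ => (x + y * I : ℂ) := by fun_prop
  have hsupp : ∀ y : ℝ, y ∉ im '' K → (x + y * I : ℂ) ∉ K := fun y hy hK' =>
    hy ⟨_, hK', by simp⟩
  have hKim : IsCompact (im '' K) := hK.image continuous_im
  have hcf : ContinuousOn (fun y : ℝ => fderivWithin ℝ A closedUpperHalf (x + y * I)) (Ici 0) :=
    (hA.continuousOn_fderivWithin uniqueDiffOn_closedUpperHalf le_rfl).comp hcl.continuousOn hmem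
  have hcA : ContinuousOn (fun y : ℝ => A (x + y * I)) (Ici 0) :=
    hA.continuousOn.comp hcl.continuousOn hmem
  have := integral_Ioi_of_hasDerivAt_of_tendsto (a := (0 : ℝ)) (m := (0 : ℂ))
    (f := fun y : ℝ => A (x + y * I) 1)
    (f' := fun y : ℝ => fderivWithin ℝ A closedUpperHalf (x + y * I) I 1) ?_ (fun y hy => ?_) ?_ ?_
  · simpa using this
  · exact (hcA.clm_apply continuousOn_const) 0 self_mem_Ici
  · have hy' : (0 : ℝ) < y := hy
    have hnhds : closedUpperHalf ∈ 𝓝 (x + y * I : ℂ) := closedUpperHalf_mem_nhds (by simpa using hy')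
    have h1 := (((hA.differentiableOn one_ne_zero) _
      (hmem y hy'.le)).hasFDerivWithinAt).hasFDerivAt hnhds
    exact (ContinuousLinearMap.apply ℝ ℂ (1 : ℂ)).hasFDerivAt.comp_hasDerivAt y
      (h1.comp_hasDerivAt y (hline y))
  · refine IntegrableOn.mono_set ?_ Ioi_subset_Ici_self
    refine ((hcf.clm_apply continuousOn_const).clm_apply
      continuousOn_const).integrableOn_of_eq_zero_off_compact
      measurableSet_Ici (hKim.inter_right isClosed_Ici) inter_subset_right fun y hy hyK => ?_
    rw [fderivWithin_closedUpperHalf_eq_zero hK h0 (hsupp y fun h => hyK ⟨h, hy⟩)]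
    simp
  · refine tendsto_const_nhds.congr' ?_
    obtain ⟨M, hM⟩ := hKim.bddAbove
    filter_upwards [eventually_gt_atTop M] with y hy
    rw [h0 _ (hsupp y fun h => absurd (hM h) (not_le.2 hy))]
    simp

/-- Stokes' theorem in the upper half-plane for compactly supported `1`-forms. -/
theorem integral_curlWithin_closedUpperHalf :
    IntegrableOn (curlWithin A closedUpperHalf) closedUpperHalf ∧
      ∫ z in closedUpperHalf, curlWithin A closedUpperHalf z = ∫ x : ℝ, A x 1 := by
  have h1 := integrableOn_fderivWithin_closedUpperHalf hA hK h0 1 I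
  have h2 := integrableOn_fderivWithin_closedUpperHalf hA hK h0 I 1
  refine ⟨h1.sub h2, ?_⟩
  unfold curlWithin
  rw [integral_sub h1 h2, integral_fderivWithin_closedUpperHalf_one hA hK h0,
    integral_fderivWithin_closedUpperHalf_I hA hK h0]
  ring

end HalfPlaneStokes

/-! #### Polar coordinates -/

theorem Complex.polarCoord_symm_eq_circleMap (p : ℝ × ℝ) :
    Complex.polarCoord.symm p = circleMap 0 p.1 p.2 := by
  rw [Complex.polarCoord_symm_apply, circleMap, zero_add, exp_mul_I]
  push_cast
  rfl

theorem integrableOn_polar {g : ℂ → ℂ} {c : ℂ} (hg : Integrable g)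
    (hgc : ContinuousOn g {c}ᶜ) :
    IntegrableOn (fun p : ℝ × ℝ => p.1 • g (circleMap c p.1 p.2)) polarCoord.target := by
  have hcm : Continuous fun p : ℝ × ℝ => circleMap c p.1 p.2 := by unfold circleMap; fun_prop
  have hmeas : AEStronglyMeasurable (fun p : ℝ × ℝ => p.1 • g (circleMap c p.1 p.2))
      (volume.restrict polarCoord.target) := by
    refine ContinuousOn.aestronglyMeasurable ?_ polarCoord.open_target.measurableSet
    refine continuousOn_fst.smul (hgc.comp hcm.continuousOn fun p hp => ?_)
    exact circleMap_ne_center (ne_of_gt hp.1)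
  refine ⟨hmeas, ?_⟩
  have h1 : Integrable fun z => g (c + z) := hg.comp_add_left c
  have h2 := h1.2
  rw [hasFiniteIntegral_iff_enorm] at h2 ⊢
  rw [← Complex.lintegral_comp_polarCoord_symm] at h2
  refine lt_of_eq_of_lt ?_ h2
  refine setLIntegral_congr_fun polarCoord.open_target.measurableSet fun p hp => ?_
  have hp1 : 0 < p.1 := hp.1
  simp only [smul_eq_mul]
  rw [enorm_smul, Real.enorm_eq_ofReal hp1.le, Complex.polarCoord_symm_eq_circleMap,
    ← circleMap_sub_center c, add_sub_cancel]

/-- Integrability of the radial function is part of the conclusion because the fundamental theorem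
on `(0, ∞)` is later applied to it. -/
theorem integral_eq_polar {g : ℂ → ℂ} {c : ℂ} (hg : Integrable g)
    (hgc : ContinuousOn g {c}ᶜ) :
    IntegrableOn (fun r : ℝ => ∫ θ in (0 : ℝ)..2 * Real.pi, r * g (circleMap c r θ)) (Ioi 0) ∧
    ∫ z, g z = ∫ r in Ioi (0 : ℝ), ∫ θ in (0 : ℝ)..2 * Real.pi, r * g (circleMap c r θ) := by
  have hint := integrableOn_polar hg hgc
  have hang : ∀ r : ℝ, ∫ θ in Ioo (-Real.pi) Real.pi, r • g (circleMap c r θ) =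
      ∫ θ in (0 : ℝ)..2 * Real.pi, r * g (circleMap c r θ) := by
    -- Polar coordinates use angles in `(-π, π)`; periodicity moves the interval to `(0, 2π)`.
    intro r
    have hp : Function.Periodic (fun θ => (r : ℂ) * g (circleMap c r θ)) (2 * Real.pi) :=
      fun θ => by simp only [periodic_circleMap c r θ]
    have := hp.intervalIntegral_add_eq (-Real.pi) 0
    rw [zero_add, show -Real.pi + 2 * Real.pi = Real.pi by ring] at this
    rw [← this, intervalIntegral.integral_of_le (by linarith [Real.pi_pos]),
      integral_Ioc_eq_integral_Ioo]
    simp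
  have hint' : Integrable (fun p : ℝ × ℝ => p.1 • g (circleMap c p.1 p.2))
      ((volume.restrict (Ioi 0)).prod (volume.restrict (Ioo (-Real.pi) Real.pi))) := by
    rw [Measure.prod_restrict, ← Measure.volume_eq_prod]
    exact hint
  constructor
  · have := hint'.integral_prod_left
    simp only [hang] at this
    exact this
  · rw [← integral_add_left_eq_self g c, ← Complex.integral_comp_polarCoord_symm]
    have e : ∀ p : ℝ × ℝ, c + Complex.polarCoord.symm p = circleMap c p.1 p.2 := fun p => by
      rw [Complex.polarCoord_symm_eq_circleMap, ← circleMap_sub_center c]; ring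
    simp_rw [e]
    have h2 : polarCoord.target = Ioi (0 : ℝ) ×ˢ Ioo (-Real.pi) Real.pi := rfl
    rw [h2, Measure.volume_eq_prod, ← Measure.prod_restrict, integral_prod _ hint']
    simp only [hang]

/-- The antisymmetric part of `B` is a multiple of the determinant, and `u, u * I` span the oriented
area `|u|²`. For `u = e^(iθ)` this compares the curl in the polar frame with that in the standard
frame. -/
theorem bilinear_antisymm_rotate (B : ℂ →L[ℝ] ℂ →L[ℝ] ℂ) (u : ℂ) :
    B u (u * I) - B (u * I) u = normSq u * (B 1 I - B I 1) := by
  have e1 : ∀ f : ℂ →L[ℝ] ℂ, ∀ v : ℂ, f v = v.re * f 1 + v.im * f I := fun f v => by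
    conv_lhs => rw [← Complex.re_add_im v]
    have e1 : (v.re : ℂ) = v.re • (1 : ℂ) := by simp
    have e2 : (v.im : ℂ) * I = v.im • I := by simp
    rw [map_add, e1, e2, map_smul, map_smul]
    simp
  have e2 : ∀ v w : ℂ, B v w = v.re * B 1 w + v.im * B I w := fun v w => e1 (B.flip w) v
  rw [e2 u, e2 (u * I), e1 (B 1) (u * I), e1 (B I) (u * I), e1 (B 1) u, e1 (B I) u]
  simp [normSq_apply]
  ring

/-- Stokes' theorem in the punctured plane for `1`-forms whose differential is integrable and which
vanish near infinity. -/
theorem integral_curl_of_tendsto {A : ℂ → ℂ →L[ℝ] ℂ} {c L : ℂ} {R : ℝ}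
    (hA : ContDiffOn ℝ 1 A {c}ᶜ) (h0 : ∀ z, R ≤ ‖z - c‖ → A z = 0)
    (hint : Integrable (curlWithin A univ))
    (hL : Tendsto (fun r => ∫ θ in (0 : ℝ)..2 * Real.pi, A (circleMap c r θ)
      (deriv (circleMap c r) θ)) (𝓝[>] 0) (𝓝 L)) :
    ∫ z, curlWithin A univ z = -L := by
  have hfd : ContinuousOn (fderiv ℝ A) {c}ᶜ :=
    hA.continuousOn_fderiv_of_isOpen isOpen_compl_singleton le_rfl
  have hcurl : ContinuousOn (curlWithin A univ) {c}ᶜ := by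
    unfold curlWithin
    simp only [fderivWithin_univ]
    exact ((hfd.clm_apply continuousOn_const).clm_apply continuousOn_const).sub
      ((hfd.clm_apply continuousOn_const).clm_apply continuousOn_const)
  obtain ⟨hCint, hCeq⟩ := integral_eq_polar hint hcurl
  rw [hCeq]
  set C : ℝ → ℂ := fun r => ∫ θ in (0 : ℝ)..2 * Real.pi, A (circleMap c r θ)
      (deriv (circleMap c r) θ) with hC
  have hne : ∀ r ∈ Ioi (0 : ℝ), ∀ θ, circleMap c r θ ∈ ({c}ᶜ : Set ℂ) := fun r hr θ =>
    circleMap_ne_center (ne_of_gt hr)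
  have hdA : ∀ r ∈ Ioi (0 : ℝ), ∀ θ, HasFDerivAt A (fderiv ℝ A (circleMap c r θ)) (circleMap c r θ) :=
    fun r hr θ => ((hA.differentiableOn one_ne_zero).differentiableAt
      (isOpen_compl_singleton.mem_nhds (hne r hr θ))).hasFDerivAt
  have hrad : ∀ r θ : ℝ, HasDerivAt (fun x : ℝ => circleMap c x θ) (exp (θ * I)) r := fun r θ => by
    simpa [circleMap] using (hasDerivAt_circleMap_radius r θ).const_add c
  have hcm : Continuous fun p : ℝ × ℝ => circleMap c p.1 p.2 := by unfold circleMap; fun_prop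
  have hcm0 : Continuous fun p : ℝ × ℝ => circleMap 0 p.1 p.2 := by unfold circleMap; fun_prop
  -- This is `dA(∂_r, ∂_θ) = ∂_r (A ∂_θ) - ∂_θ (A ∂_r)` integrated over `θ`: the last term vanishes
  -- by periodicity.
  have hderiv : ∀ r ∈ Ioi (0 : ℝ), HasDerivAt C
      (∫ θ in (0 : ℝ)..2 * Real.pi, r * curlWithin A univ (circleMap c r θ)) r := by
    intro r hr
    have hcA : Continuous fun θ => A (circleMap c r θ) :=
      hA.continuousOn.comp_continuous (continuous_circleMap c r) (hne r hr)
    have hcfA : Continuous fun θ => fderiv ℝ A (circleMap c r θ) :=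
      hfd.comp_continuous (continuous_circleMap c r) (hne r hr)
    have h := hasDerivAt_intervalIntegral_of_continuousOn (r₀ := r)
      (G := fun x θ => A (circleMap c x θ) (deriv (circleMap c x) θ))
      (G' := fun x θ => fderiv ℝ A (circleMap c x θ) (exp (θ * I)) (circleMap 0 x θ * I)
        + A (circleMap c x θ) (exp (θ * I) * I)) isOpen_Ioi hr 0 (2 * Real.pi) ?_ ?_ ?_
    · refine h.congr_deriv ?_
      -- Subtracting the `θ`-derivative of `A(∂_r)` costs nothing after integration and removes the
      -- undifferentiated term `A (e^(iθ) I)`.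
      have hN : ∀ θ : ℝ, HasDerivAt (fun θ : ℝ => A (circleMap c r θ) (exp (θ * I)))
          (fderiv ℝ A (circleMap c r θ) (circleMap 0 r θ * I) (exp (θ * I))
            + A (circleMap c r θ) (exp (θ * I) * I)) θ := by
        intro θ
        have h1 := (hdA r hr θ).comp_hasDerivAt θ (hasDerivAt_circleMap c r θ)
        have h2 : HasDerivAt (fun θ : ℝ => exp (θ * I)) (exp (θ * I) * I) θ := by
          have := ((Complex.ofRealCLM.hasDerivAt (x := θ)).mul_const I).cexp
          simpa using this
        exact h1.clm_apply h2
      have hexp : Continuous fun θ : ℝ => exp (θ * I) := by fun_prop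
      have hN1 : Continuous fun θ : ℝ => fderiv ℝ A (circleMap c r θ) (circleMap 0 r θ * I)
          (exp (θ * I)) + A (circleMap c r θ) (exp (θ * I) * I) :=
        ((hcfA.clm_apply (by fun_prop)).clm_apply hexp).add (hcA.clm_apply (by fun_prop))
      have hG1 : Continuous fun θ : ℝ => fderiv ℝ A (circleMap c r θ) (exp (θ * I))
          (circleMap 0 r θ * I) + A (circleMap c r θ) (exp (θ * I) * I) :=
        ((hcfA.clm_apply hexp).clm_apply (by fun_prop)).add (hcA.clm_apply (by fun_prop))
      have hNint := intervalIntegral.integral_eq_sub_of_hasDerivAt (a := 0) (b := 2 * Real.pi)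
        (fun θ _ => hN θ) (hN1.intervalIntegrable _ _)
      have hper : A (circleMap c r (2 * Real.pi)) (exp ((2 * Real.pi : ℝ) * I)) -
          A (circleMap c r 0) (exp ((0 : ℝ) * I)) = 0 := by
        have := periodic_circleMap c r 0
        rw [zero_add] at this
        rw [this]
        push_cast
        rw [exp_two_pi_mul_I]
        simp
      rw [hper] at hNint
      have hsub := intervalIntegral.integral_sub (μ := volume) (hG1.intervalIntegrable 0 (2 * Real.pi))
        (hN1.intervalIntegrable 0 (2 * Real.pi))
      rw [hNint, sub_zero] at hsub
      rw [← hsub]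
      refine intervalIntegral.integral_congr fun θ _ => ?_
      have hb := bilinear_antisymm_rotate (fderiv ℝ A (circleMap c r θ)) (exp (θ * I))
      have hn : normSq (exp (θ * I)) = 1 := by
        rw [normSq_eq_norm_sq, norm_exp_ofReal_mul_I]; norm_num
      have e3 : circleMap 0 r θ * I = r • (exp (θ * I) * I) := by
        simp [circleMap, mul_assoc]
      rw [hn] at hb
      simp only [curlWithin, fderivWithin_univ, e3, map_smul, smul_apply]
      simp only [real_smul]
      push_cast at hb
      linear_combination (r : ℂ) * hb
    · intro x hx θ
      have h1 := (hdA x hx θ).comp_hasDerivAt x (hrad x θ)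
      have h2 : HasDerivAt (fun x : ℝ => circleMap 0 x θ * I) (exp (θ * I) * I) x :=
        (hasDerivAt_circleMap_radius x θ).mul_const I
      simp only [deriv_circleMap]
      exact h1.clm_apply h2
    · intro x hx
      simp only [deriv_circleMap]
      exact (hA.continuousOn.comp_continuous (continuous_circleMap c x) (hne x hx)).clm_apply
        (by fun_prop)
    · have h1 : ContinuousOn (fun p : ℝ × ℝ => fderiv ℝ A (circleMap c p.1 p.2)) (Ioi 0 ×ˢ univ) :=
        hfd.comp hcm.continuousOn fun p hp => hne p.1 hp.1 p.2
      have h2 : ContinuousOn (fun p : ℝ × ℝ => A (circleMap c p.1 p.2)) (Ioi 0 ×ˢ univ) :=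
        hA.continuousOn.comp hcm.continuousOn fun p hp => hne p.1 hp.1 p.2
      have h3 : Continuous fun p : ℝ × ℝ => exp (p.2 * I) := by fun_prop
      exact ((h1.clm_apply h3.continuousOn).clm_apply (by fun_prop)).add
        (h2.clm_apply (by fun_prop))
  -- The circle integral is redefined at `r = 0` as its limit `L`, which makes it continuous there;
  -- it vanishes for large `r`, so the integral of its derivative is `0 - L`.
  have := integral_Ioi_of_hasDerivAt_of_tendsto (a := (0 : ℝ)) (m := (0 : ℂ))
    (f := Function.update C 0 L) ?_ (fun r hr => ?_) hCint ?_
  · simpa using this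
  · rw [continuousWithinAt_update_same]
    exact hL.mono_left (nhdsWithin_mono _ fun x hx => lt_of_le_of_ne hx.1 (Ne.symm hx.2))
  · refine (hderiv r hr).congr_of_eventuallyEq ?_
    filter_upwards [Ioi_mem_nhds hr] with x hx
    rw [Function.update_of_ne (ne_of_gt hx)]
  · refine tendsto_const_nhds.congr' ?_
    filter_upwards [eventually_gt_atTop (max R 0)] with r hr
    have hr0 : 0 < r := (le_max_right _ _).trans_lt hr
    rw [Function.update_of_ne hr0.ne', hC]
    symm
    refine (intervalIntegral.integral_congr fun θ _ => ?_).trans intervalIntegral.integral_zero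
    rw [h0 _ ?_]
    · simp
    · rw [circleMap_sub_center, norm_circleMap_zero, abs_of_pos hr0]
      exact (le_max_left _ _).trans hr.le

/-! ### Alternating forms on the plane -/

/-- Alternating `1`-forms as linear forms. -/
noncomputable def oneFormEquiv : (ℂ [⋀^Fin 1]→L[ℝ] ℂ) ≃ₗᵢ[ℝ] (ℂ →L[ℝ] ℂ) :=
  (ContinuousAlternatingMap.ofSubsingletonLIE (𝕜 := ℝ) (E := ℂ) (F := ℂ) (0 : Fin 1)).symm

theorem oneFormEquiv_apply (W : ℂ [⋀^Fin 1]→L[ℝ] ℂ) (v : ℂ) : oneFormEquiv W v = W ![v] := by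
  have : ![v] = fun _ : Fin 1 => v := by ext i; fin_cases i; rfl
  rw [this]
  rfl

theorem oneForm_ext {W W' : ℂ [⋀^Fin 1]→L[ℝ] ℂ} (h : ∀ v, W ![v] = W' ![v]) : W = W' := by
  apply oneFormEquiv.injective
  ext v
  simp [oneFormEquiv_apply, h]

theorem extDerivWithin_oneForm_apply (W : ℂ → ℂ [⋀^Fin 1]→L[ℝ] ℂ) (s : Set ℂ) (z u v : ℂ) :
    extDerivWithin W s z ![u, v] =
      fderivWithin ℝ W s z u ![v] - fderivWithin ℝ W s z v ![u] := by
  rw [extDerivWithin, ContinuousAlternatingMap.alternatizeUncurryFin_apply]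
  have e0 : Fin.removeNth (0 : Fin 2) ![u, v] = ![v] := by ext i; fin_cases i; rfl
  have e1 : Fin.removeNth (1 : Fin 2) ![u, v] = ![u] := by ext i; fin_cases i; rfl
  simp [Fin.sum_univ_two, e0, e1, sub_eq_add_neg]

theorem curlWithin_oneFormEquiv (W : ℂ → ℂ [⋀^Fin 1]→L[ℝ] ℂ) {s : Set ℂ} {z : ℂ}
    (hs : UniqueDiffWithinAt ℝ s z) :
    curlWithin (fun z => oneFormEquiv (W z)) s z = extDerivWithin W s z ![1, I] := by
  have h : fderivWithin ℝ (fun z => oneFormEquiv (W z)) s z =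
      (oneFormEquiv.toContinuousLinearEquiv : _ →L[ℝ] _).comp (fderivWithin ℝ W s z) :=
    oneFormEquiv.toContinuousLinearEquiv.comp_fderivWithin hs
  rw [curlWithin, extDerivWithin_oneForm_apply, h]
  simp [oneFormEquiv_apply]

theorem twoForm_apply (W : ℂ [⋀^Fin 2]→L[ℝ] ℂ) (u v : ℂ) :
    W ![u, v] = (u.re * v.im - u.im * v.re) * W ![1, I] := by
  have u0 : ∀ a w : ℂ, Function.update ![0, w] 0 a = ![a, w] := fun a w => by
    ext i; fin_cases i <;> simp
  have u1 : ∀ a w : ℂ, Function.update ![w, 0] 1 a = ![w, a] := fun a w => by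
    ext i; fin_cases i <;> simp
  have hadd1 : ∀ a b w : ℂ, W ![a + b, w] = W ![a, w] + W ![b, w] := fun a b w => by
    simpa only [u0] using W.map_update_add ![0, w] 0 a b
  have hadd2 : ∀ w a b : ℂ, W ![w, a + b] = W ![w, a] + W ![w, b] := fun w a b => by
    simpa only [u1] using W.map_update_add ![w, 0] 1 a b
  have hs1 : ∀ (c : ℝ) (a w : ℂ), W ![c • a, w] = c • W ![a, w] := fun c a w => by
    simpa only [u0] using W.map_update_smul ![0, w] 0 c a
  have hs2 : ∀ (c : ℝ) (w a : ℂ), W ![w, c • a] = c • W ![w, a] := fun c w a => by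
    simpa only [u1] using W.map_update_smul ![w, 0] 1 c a
  have hd : ∀ a : ℂ, W ![a, a] = 0 := fun a =>
    W.map_eq_zero_of_eq _ (i := 0) (j := 1) rfl (by decide)
  have hsw : W ![I, 1] = - W ![1, I] := by
    have h := hd (1 + I)
    rw [hadd1, hadd2, hadd2, hd, hd] at h
    linear_combination h
  have hu : ∀ u : ℂ, u = u.re • (1 : ℂ) + u.im • I := fun u => by
    apply Complex.ext <;> simp
  rw [hu u, hu v, hadd1, hadd2, hadd2]
  simp only [hs1, hs2, hd, hsw]
  simp
  ring

theorem twoForm_ext {W W' : ℂ [⋀^Fin 2]→L[ℝ] ℂ} (h : W ![1, I] = W' ![1, I]) : W = W' := by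
  ext v
  have : v = ![v 0, v 1] := by ext i; fin_cases i <;> rfl
  rw [this, twoForm_apply W, twoForm_apply W', h]

theorem twoForm_comp_apply (W : ℂ [⋀^Fin 2]→L[ℝ] ℂ) {L : ℂ →L[ℝ] ℂ} {m : ℂ}
    (hL : ∀ v, L v = m * v) :
    W.compContinuousLinearMap L ![1, I] = normSq m * W ![1, I] := by
  have : W.compContinuousLinearMap L ![1, I] = W ![m, m * I] := by
    rw [ContinuousAlternatingMap.compContinuousLinearMap_apply]
    congr 1
    ext i; fin_cases i <;> simp [hL]
  rw [this, twoForm_apply]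
  simp [normSq_apply]

/-- Pulling a 2-form back by multiplication by `I` multiplies it by `|I|² = 1`, so in complex
dimension one nothing is projected away. Consequently `del` coincides with `extD`. -/
theorem typeOneOne_eq (W : ℂ [⋀^Fin 2]→L[ℝ] ℂ) : RiemannSurface.typeOneOne W = W := by
  apply twoForm_ext
  rw [RiemannSurface.typeOneOne]
  have := twoForm_comp_apply W (L := (I • ContinuousLinearMap.id ℂ ℂ : ℂ →L[ℂ] ℂ).restrictScalars ℝ)
    (m := I) (fun v => by simp)
  rw [ContinuousAlternatingMap.smul_apply, ContinuousAlternatingMap.add_apply, this]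
  simp
  ring

/-- The determinant is nonnegative and equals the factor by which 2-forms transform under `L`.
Holomorphic transitions therefore preserve orientation and match the change-of-variables formula. -/
theorem det_of_complex_linear {L : ℂ →L[ℝ] ℂ} {m : ℂ} (hL : ∀ v, L v = m * v) :
    L.det = normSq m := by
  have : (L : ℂ →ₗ[ℝ] ℂ) = Algebra.lmul ℝ ℂ m := by ext; simp [hL]
  rw [ContinuousLinearMap.det, this, ← Algebra.norm_apply, Algebra.norm_complex_apply]

/-! ### Chart transitions -/

namespace RiemannSurface

theorem range_realHalfModel : range realHalfModel = closedUpperHalf := HalfPlane.range_inclusion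

section Transition

variable {X : Type*} [TopologicalSpace X] [ChartedSpace HalfPlane X]

/-- The transition map from the chart at `p` to the chart at `q`. -/
noncomputable abbrev transition (p q : X) : ℂ → ℂ := chart q ∘ (chart p).symm

theorem mapsTo_transition (p q : X) (s : Set ℂ) :
    MapsTo (transition p q) s (range realHalfModel) := fun z _ => by
  simp [transition, chart, extChartAt]

/-- The domain of the transition map from the chart at `p` to the chart at `q`. -/
abbrev overlap (p q : X) : Set ℂ := {z ∈ (chart p).target | (chart p).symm z ∈ (chart q).source}

theorem target_subset_range (p : X) : (chart p).target ⊆ range realHalfModel :=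
  extChartAt_target_subset_range p

theorem target_mem_nhdsWithin {p : X} {z : ℂ} (hz : z ∈ (chart p).target) :
    (chart p).target ∈ 𝓝[range realHalfModel] z :=
  extChartAt_target_mem_nhdsWithin_of_mem hz

theorem uniqueDiffWithinAt_range {z : ℂ} (hz : z ∈ range realHalfModel) :
    UniqueDiffWithinAt ℝ (range realHalfModel) z := realHalfModel.uniqueDiffOn z hz

theorem preimage_symm_mem_nhdsWithin {p : X} {z : ℂ} (hz : z ∈ (chart p).target) {u : Set X}
    (hu : u ∈ 𝓝 ((chart p).symm z)) :
    (chart p).symm ⁻¹' u ∈ 𝓝[range realHalfModel] z := by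
  rw [← nhdsWithin_extChartAt_target_eq_of_mem hz]
  exact (continuousOn_extChartAt_symm p z hz).preimage_mem_nhdsWithin hu

theorem overlap_mem_nhdsWithin {p q : X} {z : ℂ} (hz : z ∈ overlap p q) :
    overlap p q ∈ 𝓝[range realHalfModel] z :=
  inter_mem (target_mem_nhdsWithin hz.1)
    (preimage_symm_mem_nhdsWithin hz.1 ((isOpen_extChartAt_source q).mem_nhds hz.2))

theorem symm_transition {p q : X} {z : ℂ} (hz : z ∈ overlap p q) :
    (chart q).symm (transition p q z) = (chart p).symm z := (chart q).left_inv hz.2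

theorem transition_mem_overlap {p q : X} {z : ℂ} (hz : z ∈ overlap p q) :
    transition p q z ∈ overlap q p := by
  refine ⟨(chart q).map_source hz.2, ?_⟩
  rw [symm_transition hz]
  exact (chart p).map_target hz.1

theorem transition_transition {p q : X} {z : ℂ} (hz : z ∈ overlap p q) :
    transition q p (transition p q z) = z := by
  simp only [transition, Function.comp_apply]
  rw [(chart q).left_inv hz.2, (chart p).right_inv hz.1]

theorem mem_overlap_self {p : X} {z : ℂ} (hz : z ∈ (chart p).target) :
    z ∈ overlap p ((chart p).symm z) := ⟨hz, mem_extChartAt_source _⟩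

section

variable [IsRiemannSurface X]

instance isManifold_realHalfModel_one : IsManifold realHalfModel 1 X :=
  IsManifold.of_le (n := ∞) (by simp)

theorem contDiffWithinAt_transition_complex {p q : X} {z : ℂ} (hz : z ∈ overlap p q) :
    ContDiffWithinAt ℂ ∞ (transition p q) (range realHalfModel) z := by
  have h : z ∈ ((extChartAt complexHalfModel p).symm ≫ extChartAt complexHalfModel q).source := by
    rw [PartialEquiv.trans_source, PartialEquiv.symm_source]
    exact ⟨hz.1, hz.2⟩
  exact contDiffWithinAt_ext_coord_change (I := complexHalfModel) (n := ∞) q p h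

theorem contDiffWithinAt_transition {p q : X} {z : ℂ} (hz : z ∈ overlap p q) :
    ContDiffWithinAt ℝ ∞ (transition p q) (range realHalfModel) z :=
  (contDiffWithinAt_transition_complex hz).restrict_scalars ℝ

/-- The transition is complex differentiable within the half-plane, so its real derivative is
multiplication by a complex number, also at boundary points. -/
theorem fderivWithin_transition_apply {p q : X} {z : ℂ} (hz : z ∈ overlap p q) (v : ℂ) :
    fderivWithin ℝ (transition p q) (range realHalfModel) z v =
      fderivWithin ℝ (transition p q) (range realHalfModel) z 1 * v := by
  have h1 : DifferentiableWithinAt ℂ (transition p q) (range realHalfModel) z :=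
    (contDiffWithinAt_transition_complex hz).differentiableWithinAt (by simp)
  rw [← h1.restrictScalars_fderivWithin (𝕜 := ℝ)
    (uniqueDiffWithinAt_range (target_subset_range p hz.1))]
  set L := fderivWithin ℂ (transition p q) (range realHalfModel) z
  have : L v = v * L 1 := by
    rw [← smul_eq_mul, ← map_smul]; simp
  simpa [mul_comm] using this

omit [IsRiemannSurface X] in
-- The base points are only propositionally equal, so the two tangent spaces are different types;
-- the maps into them are compared as maps into the common model `ℂ`.
theorem compContinuousLinearMap_congr {k : ℕ} (w : DForm X k) {x y : X} (h : x = y)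
    (L : ℂ →L[ℝ] TangentSpace realHalfModel x) (L' : ℂ →L[ℝ] TangentSpace realHalfModel y)
    (hL : ∀ v, (show ℂ from L v) = L' v) :
    (w x).compContinuousLinearMap L = (w y).compContinuousLinearMap L' := by
  subst h
  have : L = L' := ContinuousLinearMap.ext hL
  rw [this]

/-- The expressions of a form in two charts are related by pullback along the transition map. -/
theorem inChart_eq_pullback {k : ℕ} (w : DForm X k) {p q : X} {z : ℂ} (hz : z ∈ overlap p q) :
    inChart p w z = (inChart q w (transition p q z)).compContinuousLinearMap
      (fderivWithin ℝ (transition p q) (range realHalfModel) z) := by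
  have hzr := target_subset_range p hz.1
  have hT : MDifferentiableWithinAt 𝓘(ℝ, ℂ) 𝓘(ℝ, ℂ) (transition p q) (range realHalfModel) z :=
    ((contDiffWithinAt_transition hz).differentiableWithinAt
      (by simp)).mdifferentiableWithinAt
  have hq := mdifferentiableWithinAt_extChartAt_symm (transition_mem_overlap hz).1
  have hu : UniqueMDiffWithinAt 𝓘(ℝ, ℂ) (range realHalfModel) z :=
    (uniqueDiffWithinAt_range hzr).uniqueMDiffWithinAt
  have hcomp := mfderivWithin_comp (I := 𝓘(ℝ, ℂ)) (I' := 𝓘(ℝ, ℂ)) (I'' := realHalfModel) z hq hT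
    (mapsTo_transition p q _) hu
  rw [mfderivWithin_eq_fderivWithin] at hcomp
  have heq : (chart q).symm ∘ transition p q =ᶠ[𝓝[range realHalfModel] z] (chart p).symm := by
    filter_upwards [overlap_mem_nhdsWithin hz] with y hy using symm_transition hy
  have hd := heq.mfderivWithin_eq (I := 𝓘(ℝ, ℂ)) (I' := realHalfModel) (symm_transition hz)
  unfold inChart
  refine compContinuousLinearMap_congr w (symm_transition hz).symm _
    ((mfderivWithin 𝓘(ℝ, ℂ) realHalfModel (chart q).symm (range realHalfModel)
      (transition p q z)).comp (fderivWithin ℝ (transition p q) (range realHalfModel) z))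
    fun v => ?_
  exact (DFunLike.congr_fun hd v).symm.trans (DFunLike.congr_fun hcomp v)

end

end Transition

end RiemannSurface

/-! ### Types of `1`-forms on the plane -/

/-- Multiplication by `I` as a real-linear map. -/
noncomputable abbrev mulI : ℂ →L[ℝ] ℂ :=
  (I • ContinuousLinearMap.id ℂ ℂ : ℂ →L[ℂ] ℂ).restrictScalars ℝ

/-- The `(0,1)`-component of an alternating `1`-form on `ℂ`. -/
noncomputable def typeZeroOne : (ℂ [⋀^Fin 1]→L[ℝ] ℂ) →L[ℝ] (ℂ [⋀^Fin 1]→L[ℝ] ℂ) :=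
  (1 / 2 : ℂ) • (ContinuousLinearMap.id ℝ _ +
    I • ContinuousAlternatingMap.compContinuousLinearMapCLM mulI)

theorem typeZeroOne_apply (W : ℂ [⋀^Fin 1]→L[ℝ] ℂ) (v : ℂ) :
    typeZeroOne W ![v] = (1 / 2 : ℂ) * (W ![v] + I * W ![I * v]) := by
  have : (mulI : ℂ → ℂ) ∘ ![v] = ![I * v] := by ext i; fin_cases i; simp
  have h2 : (ContinuousAlternatingMap.compContinuousLinearMapCLM (F := ℂ) (ι := Fin 1) mulI W)
      ![v] = W ![I * v] := by
    rw [← this]; rfl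
  rw [← h2]
  rfl

theorem oneForm_apply (W : ℂ [⋀^Fin 1]→L[ℝ] ℂ) (v : ℂ) :
    W ![v] = (W ![1] - I * W ![I]) / 2 * v + typeZeroOne W ![1] * (starRingEnd ℂ) v := by
  have := real_linear_apply (oneFormEquiv W) v
  simp only [oneFormEquiv_apply] at this
  rw [this, typeZeroOne_apply, mul_one]
  ring

theorem typeZeroOne_conj (W : ℂ [⋀^Fin 1]→L[ℝ] ℂ) (v : ℂ) :
    typeZeroOne W ![v] = typeZeroOne W ![1] * (starRingEnd ℂ) v := by
  rw [typeZeroOne_apply, oneForm_apply W v, oneForm_apply W (I * v)]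
  simp only [map_mul, conj_I]
  linear_combination ((W ![1] - I * W ![I]) / 2 * v / 2 -
    typeZeroOne W ![1] * (starRingEnd ℂ) v / 2) * I_mul_I

/-- A complex-linear map commutes with multiplication by `I`. This is why the (0,1)-part is
independent of the holomorphic chart. -/
theorem typeZeroOne_comp (W : ℂ [⋀^Fin 1]→L[ℝ] ℂ) {L : ℂ →L[ℝ] ℂ} (hL : ∀ v, L v = L 1 * v) :
    typeZeroOne (W.compContinuousLinearMap L) = (typeZeroOne W).compContinuousLinearMap L := by
  have hc : ∀ (V : ℂ [⋀^Fin 1]→L[ℝ] ℂ) (v : ℂ), V.compContinuousLinearMap L ![v] = V ![L v] := by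
    intro V v
    rw [ContinuousAlternatingMap.compContinuousLinearMap_apply]
    congr 1
    ext i; fin_cases i; rfl
  refine oneForm_ext fun v => ?_
  rw [hc, typeZeroOne_apply, typeZeroOne_apply, hc, hc, hL (I * v), hL v]
  ring_nf

namespace RiemannSurface

/-! ### Smooth forms in charts -/

section SmoothForms

variable {X : Type*} [TopologicalSpace X] [ChartedSpace HalfPlane X] {k : ℕ}

theorem chart_mem_target (p : X) : chart p p ∈ (chart p).target :=
  (chart p).map_source (mem_extChartAt_source p)

theorem smoothOff_of_contDiffWithinAt {D : Finset X} {w : DForm X k}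
    (h : ∀ p, ∀ z ∈ (chart p).target, (chart p).symm z ∉ D →
      ContDiffWithinAt ℝ ∞ (inChart p w) (range realHalfModel) z) : SmoothOff D w :=
  fun p z hz => (h p z hz.1 hz.2).mono fun _ hy => target_subset_range p hy.1

theorem eventually_notMem [T2Space X] (D : Finset X) {p : X} {z : ℂ} (hz : z ∈ (chart p).target)
    (hzD : (chart p).symm z ∉ D) :
    ∀ᶠ y in 𝓝[range realHalfModel] z, y ∈ (chart p).target ∧ (chart p).symm y ∉ D := by
  have h : ((D : Set X)ᶜ) ∈ 𝓝 ((chart p).symm z) := D.finite_toSet.isClosed.isOpen_compl.mem_nhds hzD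
  exact Filter.inter_mem (target_mem_nhdsWithin hz) (preimage_symm_mem_nhdsWithin hz h)

theorem SmoothOff.contDiffWithinAt [T2Space X] {D : Finset X} {w : DForm X k} (hw : SmoothOff D w)
    {p : X} {z : ℂ} (hz : z ∈ (chart p).target) (hzD : (chart p).symm z ∉ D) :
    ContDiffWithinAt ℝ ∞ (inChart p w) (range realHalfModel) z :=
  (hw p z ⟨hz, hzD⟩).mono_of_mem_nhdsWithin (eventually_notMem D hz hzD)

theorem inChart_add (p : X) (w w' : DForm X k) (z : ℂ) :
    inChart p (w + w') z = inChart p w z + inChart p w' z := rfl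

theorem inChart_smul (p : X) (f : X → ℂ) (w : DForm X k) (z : ℂ) :
    inChart p (fun x => f x • w x) z = f ((chart p).symm z) • inChart p w z := rfl

theorem inChart_congr {p : X} {w w' : DForm X k} {z : ℂ}
    (h : w ((chart p).symm z) = w' ((chart p).symm z)) : inChart p w z = inChart p w' z := by
  rw [inChart, inChart, h]

theorem inChart_eq_zero {p : X} {w : DForm X k} {z : ℂ} (h : w ((chart p).symm z) = 0) :
    inChart p w z = 0 := by
  rw [inChart, h]
  rfl

/-- A complex function is smooth away from `D`. -/
def FunSmoothOff (D : Finset X) (f : X → ℂ) : Prop :=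
  ∀ p : X, ∀ z ∈ (chart p).target, (chart p).symm z ∉ D →
    ContDiffWithinAt ℝ ∞ (f ∘ (chart p).symm) (range realHalfModel) z

theorem SmoothOff.add [T2Space X] {D : Finset X} {w w' : DForm X k} (hw : SmoothOff D w)
    (hw' : SmoothOff D w') : SmoothOff D (w + w') :=
  smoothOff_of_contDiffWithinAt fun _ _ hz hzD =>
    (hw.contDiffWithinAt hz hzD).add (hw'.contDiffWithinAt hz hzD)

theorem SmoothOff.sub [T2Space X] {D : Finset X} {w w' : DForm X k} (hw : SmoothOff D w)
    (hw' : SmoothOff D w') : SmoothOff D (w - w') :=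
  smoothOff_of_contDiffWithinAt fun _ _ hz hzD =>
    (hw.contDiffWithinAt hz hzD).sub (hw'.contDiffWithinAt hz hzD)

theorem FunSmoothOff.mono {D D' : Finset X} (h : D ⊆ D') {f : X → ℂ} (hf : FunSmoothOff D f) :
    FunSmoothOff D' f := fun p z hz hzD => hf p z hz fun h' => hzD (h h')

/-- Multiplication by a smooth function vanishing near points of `D` removes the singularities
at these points. -/
theorem SmoothOff.smul_of_eventually_eq_zero [T2Space X] {D D' : Finset X} {f : X → ℂ}
    {w : DForm X k} (hf : FunSmoothOff D' f) (hw : SmoothOff D w)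
    (h0 : ∀ p ∈ D, p ∉ D' → ∀ᶠ x in 𝓝 p, f x = 0) : SmoothOff D' (fun x => f x • w x) := by
  refine smoothOff_of_contDiffWithinAt fun p z hz hzD' => ?_
  by_cases hzD : (chart p).symm z ∈ D
  · have h1 : inChart p (fun x => f x • w x) =ᶠ[𝓝[range realHalfModel] z] fun _ => 0 := by
      filter_upwards [preimage_symm_mem_nhdsWithin hz (h0 _ hzD hzD')] with y hy
      have hy' : f ((chart p).symm y) = 0 := hy
      rw [inChart_smul, hy']
      exact zero_smul ℂ (inChart p w y)
    exact contDiffWithinAt_const.congr_of_eventuallyEq h1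
      (h1.self_of_nhdsWithin (target_subset_range p hz))
  · exact (hf p z hz hzD').smul (hw.contDiffWithinAt hz hzD)

theorem SmoothOff.mono {D D' : Finset X} (h : D ⊆ D') {w : DForm X k} (hw : SmoothOff D w) :
    SmoothOff D' w := fun p => (hw p).mono fun _ hz => ⟨hz.1, fun h' => hz.2 (h h')⟩

variable [IsRiemannSurface X]

theorem FunSmoothOff.of_contMDiffAt {D : Finset X} {f : X → ℂ}
    (hf : ∀ x ∉ D, ContMDiffAt realHalfModel 𝓘(ℝ, ℂ) ∞ f x) : FunSmoothOff D f := by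
  intro p z hz hzD
  have h1 : ContMDiffWithinAt 𝓘(ℝ, ℂ) realHalfModel ∞ (chart p).symm (range realHalfModel) z :=
    contMDiffWithinAt_extChartAt_symm_range p hz
  exact contMDiffWithinAt_iff_contDiffWithinAt.1 ((hf _ hzD).comp_contMDiffWithinAt z h1)

theorem FunSmoothOff.ofReal {f : X → ℝ} (hf : ContMDiff realHalfModel 𝓘(ℝ, ℝ) ∞ f) :
    FunSmoothOff ∅ (fun x => (f x : ℂ)) :=
  FunSmoothOff.of_contMDiffAt fun x _ =>
    (Complex.ofRealCLM.contDiff.contMDiff (n := ∞)).contMDiffAt.comp x (hf x)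

/-- A form built with `ofChart` uses at each point that point's own chart. Read in one fixed chart,
it acquires the derivative of the transition to the moving chart. -/
theorem inChart_ofChart (V : ∀ _ : X, ℂ [⋀^Fin k]→L[ℝ] ℂ) {p : X} {z : ℂ}
    (hz : z ∈ (chart p).target) :
    inChart p (fun q => ofChart q (V q)) z =
      (V ((chart p).symm z)).compContinuousLinearMap
        (fderivWithin ℝ (transition p ((chart p).symm z)) (range realHalfModel) z) := by
  set x := (chart p).symm z with hx
  have hu : UniqueMDiffWithinAt 𝓘(ℝ, ℂ) (range realHalfModel) z :=
    (uniqueDiffWithinAt_range (target_subset_range p hz)).uniqueMDiffWithinAt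
  have h1 : MDifferentiableAt realHalfModel 𝓘(ℝ, ℂ) (chart x) ((chart p).symm z) :=
    mdifferentiableAt_extChartAt (mem_chart_source _ x)
  have h2 := mfderiv_comp_mfderivWithin z h1 (mdifferentiableWithinAt_extChartAt_symm hz) hu
  rw [mfderivWithin_eq_fderivWithin] at h2
  have h3 : fderivWithin ℝ (transition p x) (range realHalfModel) z =
    (mfderiv realHalfModel 𝓘(ℝ, ℂ) (chart x) x).comp
      (mfderivWithin 𝓘(ℝ, ℂ) realHalfModel (chart p).symm (range realHalfModel) z) := h2
  rw [h3]
  rfl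

/-- The pullback formula for `extDerivWithin` rests on the symmetry of second derivatives, which
boundary points inherit from the interior by continuity. -/
theorem mem_closure_interior_range {z : ℂ} (hz : z ∈ range realHalfModel) :
    z ∈ closure (interior (range realHalfModel)) := by
  rw [realHalfModel.convex_range.closure_interior_eq_closure_of_nonempty_interior
    realHalfModel.nonempty_interior]
  exact subset_closure hz

/-- The exterior derivative can be computed in any chart. -/
theorem inChart_extD [T2Space X] {D : Finset X} {w : DForm X k} (hw : SmoothOff D w) {p : X} {z : ℂ}
    (hz : z ∈ (chart p).target) (hzD : (chart p).symm z ∉ D) :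
    inChart p (extD w) z = extDerivWithin (inChart p w) (range realHalfModel) z := by
  unfold extD
  rw [inChart_ofChart _ hz]
  set x := (chart p).symm z with hx
  have hov : z ∈ overlap p x := mem_overlap_self hz
  have hzr := target_subset_range p hz
  have heq : inChart p w =ᶠ[𝓝[range realHalfModel] z] fun y =>
      (inChart x w (transition p x y)).compContinuousLinearMap
        (fderivWithin ℝ (transition p x) (range realHalfModel) y) := by
    filter_upwards [overlap_mem_nhdsWithin hov] with y hy using inChart_eq_pullback w hy
  have hsm : ContDiffWithinAt ℝ ∞ (inChart x w) (range realHalfModel) (transition p x z) := by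
    refine hw.contDiffWithinAt (transition_mem_overlap hov).1 ?_
    rwa [symm_transition hov]
  rw [heq.extDerivWithin_eq_of_mem hzr, extDerivWithin_pullback
    (hsm.differentiableWithinAt (by simp)) (contDiffWithinAt_transition hov)
    (by rw [minSmoothness_of_isRCLikeNormedField]; exact WithTop.coe_le_coe.2 (le_top : (2 : ℕ∞) ≤ ⊤))
    realHalfModel.uniqueDiffOn (mem_closure_interior_range hzr) hzr (mapsTo_transition p x _)]
  rfl

theorem SmoothOff.extD [T2Space X] {D : Finset X} {w : DForm X k} (hw : SmoothOff D w) :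
    SmoothOff D (extD w) := by
  refine smoothOff_of_contDiffWithinAt fun p z hz hzD => ?_
  have hzr := target_subset_range p hz
  have h1 : inChart p (RiemannSurface.extD w) =ᶠ[𝓝[range realHalfModel] z]
      extDerivWithin (inChart p w) (range realHalfModel) := by
    filter_upwards [eventually_notMem D hz hzD] with y hy using inChart_extD hw hy.1 hy.2
  refine ContDiffWithinAt.congr_of_eventuallyEq ?_ h1 (h1.self_of_nhdsWithin hzr)
  have h2 := (hw.contDiffWithinAt hz hzD).fderivWithin_right (m := ∞) realHalfModel.uniqueDiffOn
    (by simp) hzr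
  exact (ContinuousAlternatingMap.alternatizeUncurryFinCLM ℝ ℂ ℂ).contDiff.comp_contDiffWithinAt
    h2

omit [IsRiemannSurface X] in
theorem del_eq_extD (β : DForm X 1) : del β = extD β := by
  funext p
  rw [del, typeOneOne_eq, extD]

omit [IsRiemannSurface X] in
/-- Exterior derivatives only depend on the form near the point. -/
theorem extD_congr {w w' : DForm X k} {x : X} (h : ∀ᶠ y in 𝓝 x, w y = w' y) :
    extD w x = extD w' x := by
  unfold extD
  have hx : (chart x).symm (chart x x) = x := extChartAt_to_inv x
  have h1 : inChart x w =ᶠ[𝓝[range realHalfModel] (chart x x)] inChart x w' := by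
    have := preimage_symm_mem_nhdsWithin (chart_mem_target x) (u := {y | w y = w' y})
      (by rw [hx]; exact h)
    filter_upwards [this] with y hy using inChart_congr hy
  rw [h1.extDerivWithin_eq_of_mem (target_subset_range x (chart_mem_target x))]

omit [IsRiemannSurface X] in
theorem extD_add [T2Space X] {D : Finset X} {w w' : DForm X k} (hw : SmoothOff D w)
    (hw' : SmoothOff D w') {x : X} (hx : x ∉ D) : extD (w + w') x = extD w x + extD w' x := by
  have hx' : (chart x).symm (chart x x) ∉ D := by rwa [extChartAt_to_inv x]
  have hz := chart_mem_target x
  unfold extD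
  have e : inChart x (w + w') = inChart x w + inChart x w' := rfl
  rw [e, extDerivWithin_add (uniqueDiffWithinAt_range (target_subset_range x hz))
    ((hw.contDiffWithinAt hz hx').differentiableWithinAt (by simp))
    ((hw'.contDiffWithinAt hz hx').differentiableWithinAt (by simp))]
  rfl

/-! ### The `(0,1)`-part of a form -/

/-- The `(0,1)`-part of a `1`-form. -/
noncomputable def partZeroOne (w : DForm X 1) : DForm X 1 := fun p =>
  ofChart p (typeZeroOne (inChart p w (chart p p)))

theorem inChart_partZeroOne (w : DForm X 1) {p : X} {z : ℂ} (hz : z ∈ (chart p).target) :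
    inChart p (partZeroOne w) z = typeZeroOne (inChart p w z) := by
  unfold partZeroOne
  rw [inChart_ofChart _ hz, inChart_eq_pullback w (mem_overlap_self hz),
    typeZeroOne_comp _ (fderivWithin_transition_apply (mem_overlap_self hz))]
  rfl

theorem SmoothOff.partZeroOne [T2Space X] {D : Finset X} {w : DForm X 1} (hw : SmoothOff D w) :
    SmoothOff D (partZeroOne w) := by
  refine smoothOff_of_contDiffWithinAt fun p z hz hzD => ?_
  have h1 : inChart p (RiemannSurface.partZeroOne w) =ᶠ[𝓝[range realHalfModel] z]
      fun y => typeZeroOne (inChart p w y) := by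
    filter_upwards [target_mem_nhdsWithin hz] with y hy using inChart_partZeroOne w hy
  refine ContDiffWithinAt.congr_of_eventuallyEq ?_ h1
    (h1.self_of_nhdsWithin (target_subset_range p hz))
  exact typeZeroOne.contDiff.comp_contDiffWithinAt (hw.contDiffWithinAt hz hzD)

theorem isTypeZeroOne_partZeroOne (D : Finset X) (w : DForm X 1) :
    IsTypeZeroOne D (partZeroOne w) := by
  intro p z hz _ v
  rw [inChart_partZeroOne w hz]
  exact typeZeroOne_conj _ v

/-! ### The differential of a function -/

/-- A function as a `0`-form. -/
noncomputable def zeroForm (f : X → ℂ) : DForm X 0 := fun p =>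
  ContinuousAlternatingMap.constOfIsEmpty ℝ (TangentSpace realHalfModel p) (Fin 0) (f p)

omit [IsRiemannSurface X] in
theorem FunSmoothOff.zeroForm {D : Finset X} {f : X → ℂ} (hf : FunSmoothOff D f) :
    SmoothOff D (zeroForm f) :=
  smoothOff_of_contDiffWithinAt fun p z hz hzD =>
    (ContinuousAlternatingMap.constOfIsEmptyLIE (𝕜 := ℝ) (E := ℂ) (F := ℂ)
      (ι := Fin 0)).contDiff.comp_contDiffWithinAt (hf p z hz hzD)

theorem inChart_extD_zeroForm [T2Space X] {D : Finset X} {f : X → ℂ} (hf : FunSmoothOff D f) {p : X}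
    {z : ℂ} (hz : z ∈ (chart p).target) (hzD : (chart p).symm z ∉ D) (v : ℂ) :
    inChart p (extD (RiemannSurface.zeroForm f)) z ![v] =
      fderivWithin ℝ (f ∘ (chart p).symm) (range realHalfModel) z v := by
  rw [inChart_extD hf.zeroForm hz hzD]
  have := extDerivWithin_constOfIsEmpty (f ∘ (chart p).symm) (𝕜 := ℝ)
    (uniqueDiffWithinAt_range (target_subset_range p hz))
  have e : inChart p (RiemannSurface.zeroForm f) = fun z =>
    ContinuousAlternatingMap.constOfIsEmpty ℝ ℂ (Fin 0) ((f ∘ (chart p).symm) z) := rfl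
  rw [e, this]
  rfl

end SmoothForms

end RiemannSurface

namespace RiemannSurface

/-! ### Integration of `2`-forms -/

section Measurability

variable {X : Type*} [TopologicalSpace X] [ChartedSpace HalfPlane X]

theorem isClosed_range_realHalfModel : IsClosed (range realHalfModel) :=
  realHalfModel.isClosed_range

/-- Such a set is relatively open in a closed set, hence the intersection of an open and a closed
set. -/
theorem measurableSet_of_mem_nhdsWithin_range {s : Set ℂ} (hs : s ⊆ range realHalfModel)
    (h : ∀ z ∈ s, s ∈ 𝓝[range realHalfModel] z) : MeasurableSet s := by
  have : s = interior (s ∪ (range realHalfModel)ᶜ) ∩ range realHalfModel := by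
    refine Subset.antisymm (fun z hz => ⟨?_, hs hz⟩) fun z hz => ?_
    · rw [mem_interior_iff_mem_nhds]
      have := mem_nhdsWithin_iff_eventually.1 (h z hz)
      filter_upwards [this] with y hy
      by_cases hyr : y ∈ range realHalfModel
      · exact Or.inl (hy hyr)
      · exact Or.inr hyr
    · rcases interior_subset hz.1 with h1 | h1
      · exact h1
      · exact absurd hz.2 h1
  rw [this]
  exact isOpen_interior.measurableSet.inter isClosed_range_realHalfModel.measurableSet

theorem measurableSet_target (p : X) : MeasurableSet (chart p).target :=
  measurableSet_of_mem_nhdsWithin_range (target_subset_range p) fun _ hz =>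
    target_mem_nhdsWithin hz

theorem overlap_subset_target (p q : X) : overlap p q ⊆ (chart p).target := fun _ hz => hz.1

theorem measurableSet_overlap (p q : X) : MeasurableSet (overlap p q) :=
  measurableSet_of_mem_nhdsWithin_range
    ((overlap_subset_target p q).trans (target_subset_range p)) fun _ hz =>
    overlap_mem_nhdsWithin hz

theorem finite_symm_mem (p : X) (D : Finset X) :
    {z ∈ (chart p).target | (chart p).symm z ∈ D}.Finite := by
  refine Finite.of_finite_image (f := (chart p).symm)
    (D.finite_toSet.subset (image_subset_iff.2 fun z hz => hz.2)) ?_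
  exact (chart p).symm.injOn.mono fun z hz => hz.1

theorem ae_notMem (p : X) (D : Finset X) :
    ∀ᵐ z ∂(volume.restrict (chart p).target), (chart p).symm z ∉ D := by
  rw [ae_restrict_iff' (measurableSet_target p)]
  have h0 := (finite_symm_mem p D).measure_zero volume
  filter_upwards [compl_mem_ae_iff.2 h0] with z hz hzt hzD using hz ⟨hzt, hzD⟩

theorem image_transition (p q : X) : transition p q '' overlap p q = overlap q p := by
  refine Subset.antisymm (image_subset_iff.2 fun z hz => transition_mem_overlap hz) fun z hz => ?_
  exact ⟨transition q p z, transition_mem_overlap hz, transition_transition hz⟩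

theorem injOn_transition (p q : X) : InjOn (transition p q) (overlap p q) := fun z hz y hy h => by
  rw [← transition_transition hz, h, transition_transition hy]

variable [IsRiemannSurface X]

/-- The holomorphic Jacobian enters as `|m|²`, which is already the absolute value of the real
determinant; no sign is lost. -/
theorem inChart_twoForm_transition (w : DForm X 2) {p q : X} {z : ℂ} (hz : z ∈ overlap p q) :
    inChart p w z ![1, I] =
      |(fderivWithin ℝ (transition p q) (range realHalfModel) z).det| •
        inChart q w (transition p q z) ![1, I] := by
  rw [inChart_eq_pullback w hz, twoForm_comp_apply _ (fderivWithin_transition_apply hz),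
    det_of_complex_linear (fderivWithin_transition_apply hz), abs_of_nonneg (normSq_nonneg _)]
  rw [real_smul]

theorem hasFDerivWithinAt_transition {p q : X} {z : ℂ} (hz : z ∈ overlap p q) :
    HasFDerivWithinAt (transition p q) (fderivWithin ℝ (transition p q) (range realHalfModel) z)
      (overlap p q) z :=
  ((contDiffWithinAt_transition hz).differentiableWithinAt (by simp)).hasFDerivWithinAt.mono
    ((overlap_subset_target p q).trans (target_subset_range p))

theorem integrableOn_overlap_iff (p q : X) (f : X → ℂ) (w : DForm X 2) :
    IntegrableOn (fun z => f ((chart q).symm z) * inChart q w z ![1, I]) (overlap q p) ↔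
      IntegrableOn (fun z => f ((chart p).symm z) * inChart p w z ![1, I]) (overlap p q) := by
  rw [← image_transition p q, integrableOn_image_iff_integrableOn_abs_det_fderiv_smul volume
    (measurableSet_overlap p q) (fun z hz => hasFDerivWithinAt_transition hz)
    (injOn_transition p q)]
  refine integrableOn_congr_fun (fun z hz => ?_) (measurableSet_overlap p q)
  rw [inChart_twoForm_transition w hz, symm_transition hz, mul_smul_comm]

theorem integral_overlap (p q : X) (f : X → ℂ) (w : DForm X 2) :
    ∫ z in overlap q p, f ((chart q).symm z) * inChart q w z ![1, I] =
      ∫ z in overlap p q, f ((chart p).symm z) * inChart p w z ![1, I] := by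
  rw [← image_transition p q, integral_image_eq_integral_abs_det_fderiv_smul volume
    (measurableSet_overlap p q) (fun z hz => hasFDerivWithinAt_transition hz)
    (injOn_transition p q)]
  refine setIntegral_congr_fun (measurableSet_overlap p q) fun z hz => ?_
  rw [inChart_twoForm_transition w hz, symm_transition hz, mul_smul_comm]

end Measurability

/-! ### The integral defined by the partition of unity, and its value for forms supported in one
chart -/

section Integral

variable {X : Type*} [TopologicalSpace X] [ChartedSpace HalfPlane X] [IsRiemannSurface X]
  [T2Space X] [CompactSpace X]

theorem partition_isSubordinate :
    (partition X).IsSubordinate fun x => (chartAt HalfPlane x).source :=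
  (SmoothPartitionOfUnity.exists_isSubordinate_chartAt_source realHalfModel X).choose_spec

theorem tsupport_partition_subset (p : X) : tsupport (partition X p) ⊆ (chart p).source := by
  rw [extChartAt_source]
  exact partition_isSubordinate p

theorem partition_eq_zero {p x : X} (hx : x ∉ (chart p).source) : partition X p x = 0 :=
  image_eq_zero_of_notMem_tsupport fun h => hx (tsupport_partition_subset p h)

theorem finite_partition_ne_zero : {p : X | ∃ x, partition X p x ≠ 0}.Finite := by
  have := (partition X).locallyFinite.finite_nonempty_of_compact
  exact this

/-- The finite set of indices of nonzero functions in the partition of unity. -/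
noncomputable def partitionIndex (X : Type*) [TopologicalSpace X] [ChartedSpace HalfPlane X]
    [IsRiemannSurface X] [T2Space X] [CompactSpace X] : Finset X :=
  (finite_partition_ne_zero (X := X)).toFinset

theorem partition_eq_zero_of_notMem {p : X} (hp : p ∉ partitionIndex X) (x : X) :
    partition X p x = 0 := by
  by_contra h
  exact hp ((finite_partition_ne_zero (X := X)).mem_toFinset.2 ⟨x, h⟩)

theorem sum_partition (x : X) : ∑ p ∈ partitionIndex X, (partition X p x : ℂ) = 1 := by
  have h := (partition X).sum_eq_one (mem_univ x)
  rw [finsum_eq_sum_of_support_subset (s := partitionIndex X)] at h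
  · exact_mod_cast h
  · intro p hp
    by_contra h'
    exact hp (partition_eq_zero_of_notMem h' x)

theorem surfaceIntegral_eq_sum (w : DForm X 2) : surfaceIntegral w =
    ∑ p ∈ partitionIndex X, ∫ z in (chart p).target, surfaceDensity w p z := by
  refine finsum_eq_sum_of_support_subset _ fun p hp => ?_
  by_contra h
  refine hp ?_
  simp [surfaceDensity, partition_eq_zero_of_notMem h]

theorem boundaryIntegral_eq_sum (β : DForm X 1) : boundaryIntegral β =
    ∑ p ∈ partitionIndex X, ∫ x : ℝ in {x : ℝ | (x : ℂ) ∈ (chart p).target},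
      (partition X p ((chart p).symm x) : ℂ) * inChart p β x ![1] := by
  refine finsum_eq_sum_of_support_subset _ fun p hp => ?_
  by_contra h
  refine hp ?_
  simp [partition_eq_zero_of_notMem h]

theorem AbsIntegrable.congr {D : Finset X} {w w' : DForm X 2} (h : ∀ x ∉ D, w x = w' x)
    (hw : AbsIntegrable w) : AbsIntegrable w' := fun p => by
  refine (hw p).congr ?_
  filter_upwards [ae_notMem p D] with z hz
  rw [surfaceDensity, surfaceDensity, inChart_congr (h _ hz)]

theorem surfaceIntegral_congr {D : Finset X} {w w' : DForm X 2} (h : ∀ x ∉ D, w x = w' x) :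
    surfaceIntegral w = surfaceIntegral w' := by
  unfold surfaceIntegral
  refine finsum_congr fun p => integral_congr_ae ?_
  filter_upwards [ae_notMem p D] with z hz
  rw [surfaceDensity, surfaceDensity, inChart_congr (h _ hz)]

theorem surfaceDensity_add (w w' : DForm X 2) (p : X) (z : ℂ) :
    surfaceDensity (w + w') p z = surfaceDensity w p z + surfaceDensity w' p z := by
  simp only [surfaceDensity, inChart_add, ContinuousAlternatingMap.add_apply]
  ring

theorem AbsIntegrable.add {w w' : DForm X 2} (hw : AbsIntegrable w) (hw' : AbsIntegrable w') :
    AbsIntegrable (w + w') := fun p =>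
  ((hw p).add (hw' p)).congr (Eventually.of_forall fun z => (surfaceDensity_add w w' p z).symm)

theorem surfaceIntegral_add {w w' : DForm X 2} (hw : AbsIntegrable w) (hw' : AbsIntegrable w') :
    surfaceIntegral (w + w') = surfaceIntegral w + surfaceIntegral w' := by
  simp only [surfaceIntegral_eq_sum, ← Finset.sum_add_distrib]
  refine Finset.sum_congr rfl fun p _ => ?_
  simp only [surfaceDensity_add]
  exact integral_add (hw p) (hw' p)

theorem absIntegrable_zero : AbsIntegrable (0 : DForm X 2) := fun p => by
  have : surfaceDensity (0 : DForm X 2) p = 0 := by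
    funext z
    rw [surfaceDensity, inChart_eq_zero rfl]
    simp
  rw [this]
  exact integrableOn_zero

theorem surfaceIntegral_zero : surfaceIntegral (0 : DForm X 2) = 0 := by
  have : ∀ p z, surfaceDensity (0 : DForm X 2) p z = 0 := fun p z => by
    rw [surfaceDensity, inChart_eq_zero rfl]
    simp
  simp [surfaceIntegral, this]

theorem absIntegrable_sum {ι : Type*} (s : Finset ι) {w : ι → DForm X 2}
    (h : ∀ i ∈ s, AbsIntegrable (w i)) : AbsIntegrable (∑ i ∈ s, w i) := by
  classical
  induction s using Finset.induction_on with
  | empty => simpa using absIntegrable_zero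
  | insert i s hi ih =>
    rw [Finset.sum_insert hi]
    exact (h i (by simp)).add (ih fun j hj => h j (by simp [hj]))

theorem surfaceIntegral_sum {ι : Type*} (s : Finset ι) {w : ι → DForm X 2}
    (h : ∀ i ∈ s, AbsIntegrable (w i)) :
    surfaceIntegral (∑ i ∈ s, w i) = ∑ i ∈ s, surfaceIntegral (w i) := by
  classical
  induction s using Finset.induction_on with
  | empty => simpa using surfaceIntegral_zero
  | insert i s hi ih =>
    rw [Finset.sum_insert hi, Finset.sum_insert hi, surfaceIntegral_add (h i (by simp))
      (absIntegrable_sum s fun j hj => h j (by simp [hj])), ih fun j hj => h j (by simp [hj])]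

omit [IsRiemannSurface X] [T2Space X] [CompactSpace X] in
theorem continuousOn_comp_symm {f : X → ℝ} (hf : Continuous f) (p : X) :
    ContinuousOn (fun z => (f ((chart p).symm z) : ℂ)) (chart p).target :=
  continuous_ofReal.comp_continuousOn
    (hf.comp_continuousOn (continuousOn_extChartAt_symm p))

theorem integrableOn_partition_mul (q : X) {p : X} {g : ℂ → ℂ}
    (hg : IntegrableOn g (chart p).target) :
    IntegrableOn (fun z => (partition X q ((chart p).symm z) : ℂ) * g z) (chart p).target := by
  refine Integrable.bdd_mul (c := 1) hg
    ((continuousOn_comp_symm (partition X q).contMDiff.continuous p).aestronglyMeasurable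
      (measurableSet_target p)) (Eventually.of_forall fun z => ?_)
  rw [norm_real, Real.norm_of_nonneg ((partition X).nonneg q _)]
  exact (partition X).le_one q _

section ChartSupport

variable {w : DForm X 2} {p : X} (h0 : ∀ x ∉ (chart p).source, w x = 0)
  (hw : IntegrableOn (fun z => inChart p w z ![1, I]) (chart p).target)
include h0 hw

theorem absIntegrable_of_chart : AbsIntegrable w := fun q => by
  have h1 : IntegrableOn (fun z => (partition X q ((chart p).symm z) : ℂ) * inChart p w z ![1, I])
      (overlap p q) := (integrableOn_partition_mul q hw).mono_set (overlap_subset_target p q)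
  have h2 := (integrableOn_overlap_iff p q (fun x => (partition X q x : ℂ)) w).2 h1
  refine h2.of_forall_sdiff_eq_zero (measurableSet_target q) fun z hz => ?_
  have : (chart q).symm z ∉ (chart p).source := fun h => hz.2 ⟨hz.1, h⟩
  rw [inChart_eq_zero (h0 _ this)]
  simp

/-- Each term of the partition-of-unity integral is moved to the chart at `p` by change of variables
on the overlap, outside which it vanishes; there the weights sum to one. -/
theorem surfaceIntegral_of_chart :
    surfaceIntegral w = ∫ z in (chart p).target, inChart p w z ![1, I] := by
  have key : ∀ q : X, ∫ z in (chart q).target, surfaceDensity w q z =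
      ∫ z in (chart p).target, (partition X q ((chart p).symm z) : ℂ) * inChart p w z ![1, I] := by
    intro q
    have e1 : ∫ z in (chart q).target, surfaceDensity w q z =
        ∫ z in overlap q p, (partition X q ((chart q).symm z) : ℂ) * inChart q w z ![1, I] := by
      refine setIntegral_eq_of_subset_of_forall_sdiff_eq_zero (measurableSet_target q)
        (overlap_subset_target q p) fun z hz => ?_
      have : (chart q).symm z ∉ (chart p).source := fun h => hz.2 ⟨hz.1, h⟩
      rw [surfaceDensity, inChart_eq_zero (h0 _ this)]
      simp
    rw [e1, integral_overlap p q (fun x => (partition X q x : ℂ)) w]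
    symm
    refine setIntegral_eq_of_subset_of_forall_sdiff_eq_zero (measurableSet_target p)
      (overlap_subset_target p q) fun z hz => ?_
    have : (chart p).symm z ∉ (chart q).source := fun h => hz.2 ⟨hz.1, h⟩
    rw [partition_eq_zero this]
    simp
  rw [surfaceIntegral_eq_sum]
  simp only [key]
  rw [← integral_finsetSum _ fun q _ => integrableOn_partition_mul q hw]
  refine integral_congr_ae (Eventually.of_forall fun z => ?_)
  simp only
  rw [← Finset.sum_mul, sum_partition, one_mul]

end ChartSupport

end Integral

end RiemannSurface

namespace RiemannSurface

/-! ### Interior points and bump functions -/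

section Interior

variable {X : Type*} [TopologicalSpace X] [ChartedSpace HalfPlane X] [IsRiemannSurface X]

theorem im_pos_of_isInteriorPoint {p x : X} (hx : x ∈ (chart p).source)
    (hi : realHalfModel.IsInteriorPoint x) : 0 < (chart p x).im := by
  have h := (realHalfModel.isInteriorPoint_iff_of_mem_atlas (n := ∞) (by simp)
    (chart_mem_atlas HalfPlane p) (by rwa [extChartAt_source] at hx)).1 hi
  have h2 := interior_mono (target_subset_range p) h
  rw [range_realHalfModel, interior_closedUpperHalf] at h2
  exact h2

theorem range_mem_nhds {z : ℂ} (hz : 0 < z.im) : range realHalfModel ∈ 𝓝 z := by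
  rw [range_realHalfModel]
  exact closedUpperHalf_mem_nhds hz

theorem target_mem_nhds {p : X} (hp : realHalfModel.IsInteriorPoint p) :
    (chart p).target ∈ 𝓝 (chart p p) := by
  have h := target_mem_nhdsWithin (chart_mem_target p)
  rwa [nhdsWithin_eq_nhds.2
    (range_mem_nhds (im_pos_of_isInteriorPoint (mem_extChartAt_source p) hp))] at h

/-- Near an interior point, properties on the surface can be tested in the chart. -/
theorem eventually_symm {p : X} (hp : realHalfModel.IsInteriorPoint p) {P : X → Prop}
    (h : ∀ᶠ x in 𝓝 p, P x) : ∀ᶠ z in 𝓝 (chart p p), P ((chart p).symm z) := by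
  have h1 := preimage_symm_mem_nhdsWithin (chart_mem_target p) (u := {x | P x})
    (by rwa [extChartAt_to_inv p])
  rwa [nhdsWithin_eq_nhds.2
    (range_mem_nhds (im_pos_of_isInteriorPoint (mem_extChartAt_source p) hp))] at h1

omit [IsRiemannSurface X] in
theorem symm_ne_of_ne {p : X} {z : ℂ} (hz : z ∈ (chart p).target) (h : z ≠ chart p p) :
    (chart p).symm z ≠ p := fun h' => by
  have := (chart p).right_inv hz
  rw [h'] at this
  exact h this.symm

/-- A support in the interior avoids boundary terms, and a support missing the rest of `D` isolates
one singularity. The set `U` prescribes where a local function must be defined. -/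
theorem exists_bump [T2Space X] (D : Finset X) {p : X} (hp : realHalfModel.IsInteriorPoint p)
    {U : Set X} (hU : U ∈ 𝓝 p) :
    ∃ ψ : X → ℝ, ContMDiff realHalfModel 𝓘(ℝ, ℝ) ∞ ψ ∧ (∀ᶠ x in 𝓝 p, ψ x = 1) ∧
      tsupport ψ ⊆ (chart p).source ∧ (∀ x ∈ tsupport ψ, realHalfModel.IsInteriorPoint x) ∧
      (∀ q ∈ D, q ≠ p → q ∉ tsupport ψ) ∧ tsupport ψ ⊆ U := by
  classical
  have h1 : {x | realHalfModel.IsInteriorPoint x} ∈ 𝓝 p :=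
    (realHalfModel.isOpen_interior (M := X) (n := ∞) (by simp)).mem_nhds hp
  have h2 : ((D.erase p : Finset X) : Set X)ᶜ ∈ 𝓝 p :=
    (D.erase p).finite_toSet.isClosed.isOpen_compl.mem_nhds (by simp)
  obtain ⟨ψ, -, hψ⟩ := (SmoothBumpFunction.nhds_basis_tsupport (I := realHalfModel) p).mem_iff.1
    (inter_mem (inter_mem h1 h2) hU)
  refine ⟨ψ, ψ.contMDiff, ψ.eventuallyEq_one, ψ.tsupport_subset_extChartAt_source,
    fun x hx => (hψ hx).1.1, fun q hq hqp hqs => (hψ hqs).1.2 ?_, fun x hx => (hψ hx).2⟩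
  simp [hq, hqp]

end Interior

theorem eventually_forall_circleMap_of_center {P : ℂ → Prop} {c : ℂ} (h : ∀ᶠ z in 𝓝[≠] c, P z) :
    ∀ᶠ r in 𝓝[>] (0 : ℝ), ∀ θ : ℝ, P (circleMap c r θ) := by
  have hc : Tendsto (fun w : ℂ => c + w) (𝓝[≠] 0) (𝓝[≠] c) := by
    refine tendsto_nhdsWithin_of_tendsto_nhds_of_eventually_within _ ?_ ?_
    · exact ((continuous_const_add c).tendsto' 0 c (by simp)).mono_left nhdsWithin_le_nhds
    · filter_upwards [self_mem_nhdsWithin] with w hw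
      simpa using hw
  filter_upwards [eventually_forall_circleMap (hc.eventually h)] with r hr θ
  have : circleMap c r θ = c + circleMap 0 r θ := by simp [circleMap]
  rw [this]
  exact hr θ

/-! ### Stokes' theorem for forms supported in a chart -/

section ChartStokes

variable {X : Type*} [TopologicalSpace X] [ChartedSpace HalfPlane X] {p : X} {γ : DForm X 1}

/-- The coefficients of a `1`-form in a chart, extended by zero. -/
noncomputable def chartExtend (p : X) (γ : DForm X 1) : ℂ → ℂ →L[ℝ] ℂ :=
  (chart p).target.indicator fun z => oneFormEquiv (inChart p γ z)

theorem chartExtend_of_mem {z : ℂ} (hz : z ∈ (chart p).target) :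
    chartExtend p γ z = oneFormEquiv (inChart p γ z) := indicator_of_mem hz _

theorem isCompact_chart_image {T : Set X} (hT : IsCompact T) (hTs : T ⊆ (chart p).source) :
    IsCompact (chart p '' T) := hT.image_of_continuousOn ((continuousOn_extChartAt p).mono hTs)

theorem chart_image_subset_target {T : Set X} (hTs : T ⊆ (chart p).source) :
    chart p '' T ⊆ (chart p).target := image_subset_iff.2 fun _ hx => (chart p).map_source (hTs hx)

theorem symm_notMem_of_notMem_image {T : Set X} {z : ℂ} (hz : z ∈ (chart p).target)
    (hzT : z ∉ chart p '' T) : (chart p).symm z ∉ T := fun h =>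
  hzT ⟨_, h, (chart p).right_inv hz⟩

theorem extD_eq_zero_of_notMem {k : ℕ} {γ : DForm X k} {T : Set X} (hT : IsClosed T)
    (h0 : ∀ x ∉ T, γ x = 0) {x : X} (hx : x ∉ T) : extD γ x = 0 := by
  have h1 : extD γ x = extD (0 : DForm X k) x := by
    refine extD_congr ?_
    filter_upwards [hT.isOpen_compl.mem_nhds hx] with y hy using h0 y hy
  rw [h1, extD]
  have e : inChart x (0 : DForm X k) = 0 := by
    funext z
    exact inChart_eq_zero rfl
  have e2 : extDerivWithin (0 : ℂ → ℂ [⋀^Fin k]→L[ℝ] ℂ) (range realHalfModel) (chart x x) = 0 := by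
    rw [extDerivWithin]
    simp only [fderivWithin_zero, Pi.zero_apply]
    exact map_zero (ContinuousAlternatingMap.alternatizeUncurryFinCLM ℝ ℂ ℂ)
  rw [e, e2]
  rfl

variable {T : Set X} (hT : IsCompact T) (hTs : T ⊆ (chart p).source) (h0 : ∀ x ∉ T, γ x = 0)
include h0

theorem chartExtend_eq_zero {z : ℂ} (hz : z ∉ chart p '' T) : chartExtend p γ z = 0 := by
  by_cases hzt : z ∈ (chart p).target
  · rw [chartExtend_of_mem hzt, inChart_eq_zero (h0 _ (symm_notMem_of_notMem_image hzt hz)), map_zero]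
  · exact indicator_of_notMem hzt _

include hT hTs

theorem chartExtend_eventually_eq_zero {z : ℂ} (hz : z ∉ chart p '' T) :
    chartExtend p γ =ᶠ[𝓝 z] fun _ => 0 := by
  filter_upwards [(isCompact_chart_image hT hTs).isClosed.isOpen_compl.mem_nhds hz] with y hy
  exact chartExtend_eq_zero h0 hy

theorem curlWithin_chartExtend_eq_zero {s : Set ℂ} {z : ℂ} (hz : z ∉ chart p '' T) :
    curlWithin (chartExtend p γ) s z = 0 := by
  have h := (chartExtend_eventually_eq_zero hT hTs h0 hz)
  rw [curlWithin, (h.filter_mono nhdsWithin_le_nhds).fderivWithin_eq h.self_of_nhds]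
  simp

variable [IsRiemannSurface X] [T2Space X] {D : Finset X}

omit hT hTs h0 [IsRiemannSurface X] in
theorem contDiffWithinAt_chartExtend (hγ : SmoothOff D γ) {z : ℂ} (hz : z ∈ (chart p).target)
    (hzD : (chart p).symm z ∉ D) :
    ContDiffWithinAt ℝ ∞ (chartExtend p γ) (range realHalfModel) z := by
  have h : chartExtend p γ =ᶠ[𝓝[range realHalfModel] z] fun z => oneFormEquiv (inChart p γ z) := by
    filter_upwards [target_mem_nhdsWithin hz] with y hy using chartExtend_of_mem hy
  exact (oneFormEquiv.contDiff.comp_contDiffWithinAt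
    (hγ.contDiffWithinAt hz hzD)).congr_of_eventuallyEq h (chartExtend_of_mem hz)

omit hT hTs h0 in
theorem curlWithin_chartExtend (hγ : SmoothOff D γ) {z : ℂ} (hz : z ∈ (chart p).target)
    (hzD : (chart p).symm z ∉ D) :
    curlWithin (chartExtend p γ) (range realHalfModel) z = inChart p (extD γ) z ![1, I] := by
  have h : chartExtend p γ =ᶠ[𝓝[range realHalfModel] z] fun z => oneFormEquiv (inChart p γ z) := by
    filter_upwards [target_mem_nhdsWithin hz] with y hy using chartExtend_of_mem hy
  rw [inChart_extD hγ hz hzD, ← curlWithin_oneFormEquiv _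
    (uniqueDiffWithinAt_range (target_subset_range p hz)), curlWithin, curlWithin,
    h.fderivWithin_eq (chartExtend_of_mem hz)]

variable [CompactSpace X]

/-- Since the support lies in a compact subset of the chart domain, extending the coefficients by
zero gives a `C^1` form on the whole closed half-plane. -/
theorem surfaceIntegral_extD_of_smooth (hγ : SmoothOff ∅ γ) :
    AbsIntegrable (extD γ) ∧ surfaceIntegral (extD γ) =
      ∫ x : ℝ in {x : ℝ | (x : ℂ) ∈ (chart p).target}, inChart p γ x ![1] := by
  have hK := isCompact_chart_image hT hTs
  have hsub := target_subset_range p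
  have hA : ContDiffOn ℝ 1 (chartExtend p γ) closedUpperHalf := by
    intro z hz
    by_cases hzK : z ∈ chart p '' T
    · rw [← range_realHalfModel]
      exact (contDiffWithinAt_chartExtend hγ (chart_image_subset_target hTs hzK) (by simp)).of_le
        (by simp)
    · exact (contDiffAt_const.congr_of_eventuallyEq
        (chartExtend_eventually_eq_zero hT hTs h0 hzK)).contDiffWithinAt
  obtain ⟨hi, hI⟩ := integral_curlWithin_closedUpperHalf hA hK fun z hz => chartExtend_eq_zero h0 hz
  have hcongr : EqOn (curlWithin (chartExtend p γ) closedUpperHalf)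
      (fun z => inChart p (extD γ) z ![1, I]) (chart p).target := fun z hz => by
    rw [← range_realHalfModel]
    exact curlWithin_chartExtend hγ hz (by simp)
  have hint : IntegrableOn (fun z => inChart p (extD γ) z ![1, I]) (chart p).target :=
    (integrableOn_congr_fun hcongr (measurableSet_target p)).1
      (hi.mono_set (range_realHalfModel ▸ hsub))
  have hz0 : ∀ x ∉ (chart p).source, extD γ x = 0 := fun x hx =>
    extD_eq_zero_of_notMem hT.isClosed h0 fun h => hx (hTs h)
  refine ⟨absIntegrable_of_chart hz0 hint, ?_⟩
  rw [surfaceIntegral_of_chart hz0 hint, ← setIntegral_congr_fun (measurableSet_target p) hcongr]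
  have e1 : ∫ z in (chart p).target, curlWithin (chartExtend p γ) closedUpperHalf z =
      ∫ z in closedUpperHalf, curlWithin (chartExtend p γ) closedUpperHalf z := by
    symm
    refine setIntegral_eq_of_subset_of_forall_sdiff_eq_zero isClosed_closedUpperHalf.measurableSet
      (range_realHalfModel ▸ hsub) fun z hz => ?_
    exact curlWithin_chartExtend_eq_zero hT hTs h0 fun h => hz.2 (chart_image_subset_target hTs h)
  rw [e1, hI]
  have hmeas : MeasurableSet {x : ℝ | (x : ℂ) ∈ (chart p).target} :=
    continuous_ofReal.measurable (measurableSet_target p)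
  rw [← integral_indicator hmeas]
  congr 1
  funext x
  by_cases hx : (x : ℂ) ∈ (chart p).target
  · rw [chartExtend_of_mem hx, indicator_of_mem (show x ∈ {x : ℝ | (x : ℂ) ∈ (chart p).target} from hx),
      oneFormEquiv_apply]
  · rw [indicator_of_notMem (show x ∉ {x : ℝ | (x : ℂ) ∈ (chart p).target} from hx), chartExtend,
      indicator_of_notMem hx]
    rfl

/-- The support consists of interior points, so the extension by zero is smooth on the plane minus
one point and the real axis plays no role. -/
theorem surfaceIntegral_extD_of_polar (hp : realHalfModel.IsInteriorPoint p)
    (hTi : ∀ x ∈ T, realHalfModel.IsInteriorPoint x) (hγ : SmoothOff {p} γ)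
    (hint : IntegrableAtFilter (fun z => inChart p (extD γ) z ![1, I]) (𝓝 (chart p p))) {L : ℂ}
    (hL : Tendsto (fun r => ∫ θ in (0 : ℝ)..2 * Real.pi,
      inChart p γ (circleMap (chart p p) r θ) ![deriv (circleMap (chart p p) r) θ]) (𝓝[>] 0) (𝓝 L)) :
    AbsIntegrable (extD γ) ∧ surfaceIntegral (extD γ) = -L := by
  have hK := isCompact_chart_image hT hTs
  have hKt := chart_image_subset_target hTs
  have hKi : ∀ z ∈ chart p '' T, range realHalfModel ∈ 𝓝 z := by
    rintro _ ⟨x, hx, rfl⟩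
    exact range_mem_nhds (im_pos_of_isInteriorPoint (hTs hx) (hTi x hx))
  have hKD : ∀ z ∈ (chart p).target, z ≠ chart p p → (chart p).symm z ∉ ({p} : Finset X) :=
    fun z hz hne => by simpa using symm_ne_of_ne hz hne
  have hA : ContDiffOn ℝ ∞ (chartExtend p γ) {chart p p}ᶜ := by
    intro z hz
    by_cases hzK : z ∈ chart p '' T
    · exact ((contDiffWithinAt_chartExtend hγ (hKt hzK) (hKD z (hKt hzK) hz)).contDiffAt
        (hKi z hzK)).contDiffWithinAt
    · exact (contDiffAt_const.congr_of_eventuallyEq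
        (chartExtend_eventually_eq_zero hT hTs h0 hzK)).contDiffWithinAt
  have hcurl : ∀ z ∈ (chart p).target, z ≠ chart p p →
      inChart p (extD γ) z ![1, I] = curlWithin (chartExtend p γ) univ z := by
    intro z hz hne
    rw [← curlWithin_chartExtend hγ hz (hKD z hz hne)]
    by_cases hzK : z ∈ chart p '' T
    · rw [curlWithin, curlWithin, fderivWithin_univ, fderivWithin_of_mem_nhds (hKi z hzK)]
    · rw [curlWithin_chartExtend_eq_zero hT hTs h0 hzK,
        curlWithin_chartExtend_eq_zero hT hTs h0 hzK]
  have hcont : ContinuousOn (curlWithin (chartExtend p γ) univ) {chart p p}ᶜ := by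
    have hfd : ContinuousOn (fderiv ℝ (chartExtend p γ)) {chart p p}ᶜ :=
      hA.continuousOn_fderiv_of_isOpen isOpen_compl_singleton (by simp)
    unfold curlWithin
    simp only [fderivWithin_univ]
    exact ((hfd.clm_apply continuousOn_const).clm_apply continuousOn_const).sub
      ((hfd.clm_apply continuousOn_const).clm_apply continuousOn_const)
  have hne : ∀ᵐ z : ℂ, z ≠ chart p p :=
    compl_mem_ae_iff.2 (measure_singleton (μ := (volume : Measure ℂ)) (chart p p))
  -- On the compact support local integrability is enough: it is the hypothesis `hint` at the centre
  -- and continuity elsewhere.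
  have hcK : IntegrableOn (curlWithin (chartExtend p γ) univ) (chart p '' T) := by
    refine LocallyIntegrableOn.integrableOn_isCompact (fun z hz => ?_) hK
    refine IntegrableAtFilter.filter_mono nhdsWithin_le_nhds ?_
    by_cases hzc : z = chart p p
    · subst hzc
      obtain ⟨s, hs, hs'⟩ := hint
      refine ⟨s ∩ (chart p).target, inter_mem hs (target_mem_nhds hp),
        (hs'.mono_set inter_subset_left).congr ?_⟩
      have : ∀ᵐ z ∂(volume.restrict (s ∩ (chart p).target)), z ∈ (chart p).target :=
        ae_mono (Measure.restrict_mono inter_subset_right le_rfl)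
          (ae_restrict_mem (measurableSet_target p))
      filter_upwards [this, ae_restrict_of_ae hne] with y hy hyc using hcurl y hy hyc
    · have := hcont.integrableAt_nhdsWithin (μ := volume) isOpen_compl_singleton.measurableSet
        (show z ∈ {chart p p}ᶜ from hzc)
      rwa [nhdsWithin_eq_nhds.2 (isOpen_compl_singleton.mem_nhds hzc)] at this
  have hcI : Integrable (curlWithin (chartExtend p γ) univ) := by
    rw [← integrableOn_univ]
    exact hcK.of_forall_sdiff_eq_zero MeasurableSet.univ fun z hz =>
      curlWithin_chartExtend_eq_zero hT hTs h0 hz.2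
  have hae : ∀ᵐ z ∂(volume.restrict (chart p).target),
      curlWithin (chartExtend p γ) univ z = inChart p (extD γ) z ![1, I] := by
    filter_upwards [ae_restrict_mem (measurableSet_target p), ae_restrict_of_ae hne] with y hy hyc
    exact (hcurl y hy hyc).symm
  have hint' : IntegrableOn (fun z => inChart p (extD γ) z ![1, I]) (chart p).target :=
    hcI.integrableOn.congr hae
  have hz0 : ∀ x ∉ (chart p).source, extD γ x = 0 := fun x hx =>
    extD_eq_zero_of_notMem hT.isClosed h0 fun h => hx (hTs h)
  refine ⟨absIntegrable_of_chart hz0 hint', ?_⟩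
  rw [surfaceIntegral_of_chart hz0 hint', ← integral_congr_ae hae]
  obtain ⟨R, hR⟩ := hK.isBounded.subset_ball (chart p p)
  have e1 : ∫ z in (chart p).target, curlWithin (chartExtend p γ) univ z =
      ∫ z, curlWithin (chartExtend p γ) univ z :=
    setIntegral_eq_integral_of_forall_compl_eq_zero fun z hz =>
      curlWithin_chartExtend_eq_zero hT hTs h0 fun h => hz (hKt h)
  rw [e1]
  refine integral_curl_of_tendsto (R := R) (hA.of_le (by simp)) (fun z hz => ?_) hcI ?_
  · refine chartExtend_eq_zero h0 fun h => ?_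
    have := hR h
    rw [Metric.mem_ball, dist_eq_norm] at this
    exact absurd hz (not_le.2 this)
  · refine hL.congr' ?_
    filter_upwards [eventually_forall_circleMap_of_center (mem_nhdsWithin_of_mem_nhds
      (target_mem_nhds hp))] with r hr
    refine intervalIntegral.integral_congr fun θ _ => ?_
    rw [chartExtend_of_mem (hr θ), oneFormEquiv_apply]

end ChartStokes

end RiemannSurface

theorem MeasureTheory.IntegrableAtFilter.congr_of_eventually_nhdsNE {f g : ℂ → ℂ} {c : ℂ}
    (hf : IntegrableAtFilter f (𝓝 c)) (h : ∀ᶠ z in 𝓝[≠] c, f z = g z) :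
    IntegrableAtFilter g (𝓝 c) := by
  obtain ⟨s, hs, hi⟩ := hf
  obtain ⟨t, ht, hto, hct⟩ := mem_nhds_iff.1 (eventually_nhdsWithin_iff.1 h)
  refine ⟨s ∩ t, inter_mem hs (hto.mem_nhds hct), (hi.mono_set inter_subset_left).congr ?_⟩
  have h1 : ∀ᵐ z ∂(volume.restrict (s ∩ t)), z ∈ t :=
    ae_mono (Measure.restrict_mono inter_subset_right le_rfl) (ae_restrict_mem hto.measurableSet)
  have hne : ∀ᵐ z : ℂ, z ≠ c := compl_mem_ae_iff.2 (measure_singleton (μ := (volume : Measure ℂ)) c)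
  filter_upwards [h1, ae_restrict_of_ae hne] with z hz hzc using ht hz hzc

namespace RiemannSurface

/-! ### Stokes' theorem on the surface -/

section GlobalStokes

variable {X : Type*} [TopologicalSpace X] [ChartedSpace HalfPlane X] [T2Space X] {D : Finset X}

omit [T2Space X] in
theorem smoothOff_zero {k : ℕ} (D : Finset X) : SmoothOff D (0 : DForm X k) :=
  fun _ => contDiffOn_const (c := (0 : ℂ [⋀^Fin k]→L[ℝ] ℂ))

theorem SmoothOff.sum {ι : Type*} {k : ℕ} (s : Finset ι) {w : ι → DForm X k}
    (hw : ∀ i ∈ s, SmoothOff D (w i)) : SmoothOff D (∑ i ∈ s, w i) := by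
  classical
  induction s using Finset.induction_on with
  | empty => simpa using smoothOff_zero D
  | insert i s hi ih =>
    rw [Finset.sum_insert hi]
    exact (hw i (by simp)).add (ih fun j hj => hw j (by simp [hj]))

theorem extD_sum {ι : Type*} {k : ℕ} (s : Finset ι) {w : ι → DForm X k}
    (hw : ∀ i ∈ s, SmoothOff D (w i)) {x : X} (hx : x ∉ D) :
    extD (∑ i ∈ s, w i) x = (∑ i ∈ s, extD (w i)) x := by
  classical
  induction s using Finset.induction_on with
  | empty =>
    simp only [Finset.sum_empty]
    exact extD_eq_zero_of_notMem isClosed_empty (fun _ _ => rfl) (notMem_empty x)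
  | insert i s hi ih =>
    rw [Finset.sum_insert hi, Finset.sum_insert hi, extD_add (hw i (by simp))
      (SmoothOff.sum s fun j hj => hw j (by simp [hj])) hx, ih fun j hj => hw j (by simp [hj])]
    rfl

variable [IsRiemannSurface X] [CompactSpace X]

/-- Stokes' theorem for a `1`-form with isolated interior singularities. -/
theorem surfaceIntegral_extD (hD : ∀ p ∈ D, realHalfModel.IsInteriorPoint p) {γ : DForm X 1}
    (hγ : SmoothOff D γ) (hint : ∀ p ∈ D,
      IntegrableAtFilter (fun z => inChart p (extD γ) z ![1, I]) (𝓝 (chart p p))) {L : X → ℂ}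
    (hL : ∀ p ∈ D, Tendsto (fun r => ∫ θ in (0 : ℝ)..2 * Real.pi,
      inChart p γ (circleMap (chart p p) r θ) ![deriv (circleMap (chart p p) r) θ])
      (𝓝[>] 0) (𝓝 (L p))) :
    AbsIntegrable (extD γ) ∧
      surfaceIntegral (extD γ) = boundaryIntegral γ - ∑ p ∈ D, L p := by
  classical
  choose! ψ hsm hone hsrc hinter hD' _ using fun p (hp : p ∈ D) =>
    exists_bump D (hD p hp) univ_mem
  have hψ0 : ∀ p ∈ D, ∀ q ∈ D, q ≠ p → ∀ᶠ x in 𝓝 q, ψ p x = 0 := fun p hp q hq hqp => by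
    filter_upwards [(isClosed_tsupport (ψ p)).isOpen_compl.mem_nhds (hD' p hp q hq hqp)] with x hx
    exact image_eq_zero_of_notMem_tsupport hx
  -- The complementary cut-off vanishes near `D` and equals one at the boundary, as the bumps are
  -- supported in the interior.
  set κ : X → ℝ := fun x => 1 - ∑ p ∈ D, ψ p x with hκ
  have hκsm : ContMDiff realHalfModel 𝓘(ℝ, ℝ) ∞ κ :=
    contMDiff_const.sub (contMDiff_finsetSum hsm)
  have hκ0 : ∀ p ∈ D, ∀ᶠ x in 𝓝 p, κ x = 0 := by
    intro p hp
    have h1 : ∀ᶠ x in 𝓝 p, ∀ q ∈ D, q ≠ p → ψ q x = 0 :=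
      (Finset.eventually_all D).2 fun q hq => by
        by_cases hqp : q = p
        · exact Eventually.of_forall fun x h => absurd hqp h
        · filter_upwards [hψ0 q hq p hp (Ne.symm hqp)] with x hx _ using hx
    filter_upwards [h1, hone p hp] with x hx hx1
    rw [hκ]
    simp only
    rw [Finset.sum_eq_single_of_mem p hp fun q hq hqp => hx q hq hqp, hx1, sub_self]
  have hκ1 : ∀ x, ¬ realHalfModel.IsInteriorPoint x → κ x = 1 := fun x hx => by
    rw [hκ]
    simp only
    rw [Finset.sum_eq_zero fun p hp => image_eq_zero_of_notMem_tsupport fun h =>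
      hx (hinter p hp x h), sub_zero]
  -- The `ψ p • γ` carry one singularity each and no boundary; the `partition X q * κ • γ` are
  -- smooth and carry the whole boundary integral.
  set γ₁ : X → DForm X 1 := fun p x => (ψ p x : ℂ) • γ x with hγ₁
  set γ₂ : X → DForm X 1 := fun q x => ((partition X q x * κ x : ℝ) : ℂ) • γ x with hγ₂
  have hs₁ : ∀ p ∈ D, SmoothOff {p} (γ₁ p) := fun p hp =>
    SmoothOff.smul_of_eventually_eq_zero ((FunSmoothOff.ofReal (hsm p hp)).mono (by simp)) hγ
      fun q hq hqp => by
        filter_upwards [hψ0 p hp q hq (by simpa using hqp)] with x hx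
        rw [hx, ofReal_zero]
  have hs₂ : ∀ q, SmoothOff ∅ (γ₂ q) := fun q =>
    SmoothOff.smul_of_eventually_eq_zero
      (FunSmoothOff.ofReal ((partition X q).contMDiff.mul hκsm)) hγ fun p hp _ => by
        filter_upwards [hκ0 p hp] with x hx
        rw [hx, mul_zero, ofReal_zero]
  have hsum : γ = ∑ p ∈ D, γ₁ p + ∑ q ∈ partitionIndex X, γ₂ q := by
    funext x
    rw [Pi.add_apply, Finset.sum_apply, Finset.sum_apply]
    simp only [hγ₁, hγ₂]
    rw [← Finset.sum_smul, ← Finset.sum_smul, ← add_smul]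
    have : ∑ p ∈ D, (ψ p x : ℂ) + ∑ q ∈ partitionIndex X, ((partition X q x * κ x : ℝ) : ℂ) = 1 := by
      push_cast
      rw [← Finset.sum_mul, sum_partition, hκ]
      push_cast
      ring
    rw [this]
    exact (one_smul ℂ (γ x)).symm
  have hs₁' : ∀ p ∈ D, SmoothOff D (γ₁ p) := fun p hp => (hs₁ p hp).mono (by simpa using hp)
  have hs₂' : ∀ q ∈ partitionIndex X, SmoothOff D (γ₂ q) := fun q _ => (hs₂ q).mono (by simp)
  have hext : ∀ x ∉ D, (∑ p ∈ D, extD (γ₁ p) + ∑ q ∈ partitionIndex X, extD (γ₂ q)) x =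
      extD γ x := fun x hx => by
    conv_rhs => rw [hsum]
    rw [extD_add (SmoothOff.sum _ hs₁') (SmoothOff.sum _ hs₂') hx, extD_sum _ hs₁' hx,
      extD_sum _ hs₂' hx]
    rfl
  have hI₁ : ∀ p ∈ D, AbsIntegrable (extD (γ₁ p)) ∧ surfaceIntegral (extD (γ₁ p)) = -L p := by
    intro p hp
    refine surfaceIntegral_extD_of_polar (T := tsupport (ψ p)) (isClosed_tsupport _).isCompact
      (hsrc p hp) (fun x hx => ?_) (hD p hp) (hinter p hp) (hs₁ p hp) ?_ ?_
    · simp only [hγ₁]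
      rw [image_eq_zero_of_notMem_tsupport hx, ofReal_zero]
      exact zero_smul ℂ (γ x)
    · refine (hint p hp).congr_of_eventually_nhdsNE (Eventually.filter_mono nhdsWithin_le_nhds ?_)
      have h2 : ∀ᶠ x in 𝓝 p, extD γ x = extD (γ₁ p) x := by
        filter_upwards [(hone p hp).eventually_nhds] with x hx
        refine extD_congr ?_
        filter_upwards [hx] with y hy
        simp only [hγ₁]
        rw [hy, ofReal_one]
        exact (one_smul ℂ (γ y)).symm
      filter_upwards [eventually_symm (hD p hp) h2] with z hz
      rw [inChart_congr hz]
    · refine (hL p hp).congr' ?_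
      filter_upwards [eventually_forall_circleMap_of_center
        ((eventually_symm (hD p hp) (hone p hp)).filter_mono nhdsWithin_le_nhds)] with r hr
      refine intervalIntegral.integral_congr fun θ _ => ?_
      have h1 := hr θ
      simp only [hγ₁]
      rw [inChart_smul p (fun x => (ψ p x : ℂ)), h1, ofReal_one]
      exact congrArg (fun W : ℂ [⋀^Fin 1]→L[ℝ] ℂ => W ![deriv (circleMap (chart p p) r) θ])
        (one_smul ℂ (inChart p γ (circleMap (chart p p) r θ))).symm
  have hI₂ : ∀ q ∈ partitionIndex X, AbsIntegrable (extD (γ₂ q)) ∧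
      surfaceIntegral (extD (γ₂ q)) = ∫ x : ℝ in {x : ℝ | (x : ℂ) ∈ (chart q).target},
        (partition X q ((chart q).symm x) : ℂ) * inChart q γ x ![1] := by
    intro q _
    have h0 : ∀ x ∉ tsupport (partition X q), γ₂ q x = 0 := fun x hx => by
      simp only [hγ₂]
      rw [image_eq_zero_of_notMem_tsupport hx, zero_mul, ofReal_zero]
      exact zero_smul ℂ (γ x)
    obtain ⟨h1, h2⟩ := surfaceIntegral_extD_of_smooth (isClosed_tsupport _).isCompact
      (tsupport_partition_subset q) h0 (hs₂ q)
    refine ⟨h1, h2.trans ?_⟩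
    refine setIntegral_congr_fun (continuous_ofReal.measurable (measurableSet_target q))
      fun x hx => ?_
    -- Real points of a chart image are boundary points, where `κ = 1`.
    have hb : ¬ realHalfModel.IsInteriorPoint ((chart q).symm x) := fun h => by
      have := im_pos_of_isInteriorPoint ((chart q).map_target hx) h
      rw [(chart q).right_inv hx, ofReal_im] at this
      exact lt_irrefl _ this
    simp only [hγ₂]
    rw [inChart_smul q (fun x => ((partition X q x * κ x : ℝ) : ℂ)), hκ1 _ hb, mul_one]
    rfl
  have ha₁ := absIntegrable_sum D fun p hp => (hI₁ p hp).1
  have ha₂ := absIntegrable_sum _ fun q hq => (hI₂ q hq).1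
  refine ⟨(ha₁.add ha₂).congr hext, ?_⟩
  rw [← surfaceIntegral_congr hext, surfaceIntegral_add ha₁ ha₂,
    surfaceIntegral_sum _ fun p hp => (hI₁ p hp).1, surfaceIntegral_sum _ fun q hq => (hI₂ q hq).1,
    boundaryIntegral_eq_sum, Finset.sum_congr rfl fun p hp => (hI₁ p hp).2,
    Finset.sum_congr rfl fun q hq => (hI₂ q hq).2, Finset.sum_neg_distrib]
  ring

theorem integrableOn_boundary (hD : ∀ p ∈ D, realHalfModel.IsInteriorPoint p) {β : DForm X 1}
    (hβ : SmoothOff D β) (q : X) :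
    IntegrableOn (fun x : ℝ => (partition X q ((chart q).symm x) : ℂ) * inChart q β x ![1])
      {x : ℝ | (x : ℂ) ∈ (chart q).target} := by
  have hK := isCompact_chart_image (isClosed_tsupport (partition X q)).isCompact
    (tsupport_partition_subset q)
  have hsub := chart_image_subset_target (tsupport_partition_subset q)
  refine ContinuousOn.integrableOn_of_eq_zero_off_compact
    (K := ofReal ⁻¹' (chart q '' tsupport (partition X q))) ?_
    (continuous_ofReal.measurable (measurableSet_target q))
    (isometry_ofReal.isClosedEmbedding.isCompact_preimage hK) (fun x hx => hsub hx)
    fun x hx hxK => ?_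
  · have h1 : ContinuousOn (fun x : ℝ => (partition X q ((chart q).symm x) : ℂ))
        {x : ℝ | (x : ℂ) ∈ (chart q).target} :=
      (continuousOn_comp_symm (partition X q).contMDiff.continuous q).comp
        continuous_ofReal.continuousOn fun x hx => hx
    have h2 : ContinuousOn (fun x : ℝ => inChart q β x) {x : ℝ | (x : ℂ) ∈ (chart q).target} := by
      refine (hβ q).continuousOn.comp continuous_ofReal.continuousOn fun x hx => ⟨hx, fun h => ?_⟩
      have := im_pos_of_isInteriorPoint ((chart q).map_target hx) (hD _ h)
      rw [(chart q).right_inv hx, ofReal_im] at this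
      exact lt_irrefl _ this
    have h3 : ContinuousOn (fun x : ℝ => inChart q β x ![1]) {x : ℝ | (x : ℂ) ∈ (chart q).target} := by
      have := (oneFormEquiv.continuous.comp_continuousOn h2).clm_apply
        (continuousOn_const (c := (1 : ℂ)))
      exact this.congr fun x _ => (oneFormEquiv_apply _ _).symm
    exact h1.mul h3
  · rw [image_eq_zero_of_notMem_tsupport (symm_notMem_of_notMem_image hx hxK), ofReal_zero, zero_mul]

theorem boundaryIntegral_add (hD : ∀ p ∈ D, realHalfModel.IsInteriorPoint p) {β β' : DForm X 1}
    (hβ : SmoothOff D β) (hβ' : SmoothOff D β') :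
    boundaryIntegral (β + β') = boundaryIntegral β + boundaryIntegral β' := by
  simp only [boundaryIntegral_eq_sum, ← Finset.sum_add_distrib]
  refine Finset.sum_congr rfl fun q _ => ?_
  rw [← integral_add (integrableOn_boundary hD hβ q) (integrableOn_boundary hD hβ' q)]
  refine integral_congr_ae (Eventually.of_forall fun x => ?_)
  simp only [inChart_add, ContinuousAlternatingMap.add_apply]
  ring

end GlobalStokes

end RiemannSurface

/-! ### Derivatives of singular coefficients -/

section Plane

theorem fderiv_mul_of_hasDerivAt {g f : ℂ → ℂ} {g' z : ℂ} (hg : HasDerivAt g g' z)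
    (hf : DifferentiableAt ℝ f z) (v : ℂ) :
    fderiv ℝ (fun w => g w * f w) z v = g' * v * f z + g z * fderiv ℝ f z v := by
  have hgr : HasFDerivAt g ((ContinuousLinearMap.toSpanSingleton ℂ g').restrictScalars ℝ) z :=
    hg.hasFDerivAt.restrictScalars ℝ
  have h2 : fderiv ℝ (fun w => g w * f w) z = g z • fderiv ℝ f z +
    f z • (ContinuousLinearMap.toSpanSingleton ℂ g').restrictScalars ℝ :=
    (hgr.mul hf.hasFDerivAt).fderiv
  rw [h2]
  simp
  ring

/-- A holomorphic factor is a constant for `∂̄`; this keeps pole orders from growing under `∂̄`. -/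
theorem wirtingerBar_mul_of_hasDerivAt {g f : ℂ → ℂ} {g' z : ℂ} (hg : HasDerivAt g g' z)
    (hf : DifferentiableAt ℝ f z) :
    wirtingerBar (fun w => g w * f w) z = g z * wirtingerBar f z := by
  unfold wirtingerBar
  rw [fderiv_mul_of_hasDerivAt hg hf, fderiv_mul_of_hasDerivAt hg hf]
  linear_combination (g' * f z / 2) * I_mul_I

theorem ContDiffAt.alternating_apply {k : ℕ} {n : WithTop ℕ∞} {W : ℂ → ℂ [⋀^Fin k]→L[ℝ] ℂ} {c : ℂ}
    (hW : ContDiffAt ℝ n W c) (v : Fin k → ℂ) : ContDiffAt ℝ n (fun z => W z v) c :=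
  (ContinuousAlternatingMap.apply ℝ ℂ ℂ v).contDiff.contDiffAt.comp c hW

theorem extDeriv_oneForm_apply {W : ℂ → ℂ [⋀^Fin 1]→L[ℝ] ℂ} {z : ℂ}
    (hW : DifferentiableAt ℝ W z) : extDeriv W z ![1, I] =
      fderiv ℝ (fun y => W y ![I]) z 1 - fderiv ℝ (fun y => W y ![1]) z I := by
  have h : ∀ v u, fderiv ℝ (fun y => W y ![v]) z u = fderiv ℝ W z u ![v] := fun v u => by
    have := (ContinuousAlternatingMap.apply ℝ ℂ ℂ ![v]).hasFDerivAt.comp z hW.hasFDerivAt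
    exact DFunLike.congr_fun this.fderiv u
  rw [← extDerivWithin_univ, extDerivWithin_oneForm_apply, fderivWithin_univ, h, h]

/-- The exterior derivative of `dF + k dz` is `∂̄k ∧ dz`. -/
theorem extDeriv_exact_add {W : ℂ → ℂ [⋀^Fin 1]→L[ℝ] ℂ} {F k : ℂ → ℂ} {z : ℂ}
    (hW : DifferentiableAt ℝ W z) (hF : ContDiffAt ℝ 2 F z) (hk : DifferentiableAt ℝ k z)
    (h : ∀ᶠ y in 𝓝 z, ∀ v, W y ![v] = fderiv ℝ F y v + k y * v) :
    extDeriv W z ![1, I] = 2 * I * wirtingerBar k z := by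
  have hF' : DifferentiableAt ℝ (fderiv ℝ F) z :=
    (hF.fderiv_right (m := 1) (by norm_num)).differentiableAt one_ne_zero
  have key : ∀ v u, fderiv ℝ (fun y => W y ![v]) z u =
      fderiv ℝ (fderiv ℝ F) z u v + fderiv ℝ k z u * v := by
    intro v u
    have e1 : (fun y => W y ![v]) =ᶠ[𝓝 z] fun y => fderiv ℝ F y v + v * k y := by
      filter_upwards [h] with y hy
      rw [hy v, mul_comm v]
    have e2 := ((ContinuousLinearMap.apply ℝ ℂ v).hasFDerivAt.comp z hF'.hasFDerivAt)
    have e3 : HasFDerivAt (fun y => fderiv ℝ F y v) _ z := e2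
    rw [e1.fderiv_eq, (e3.fun_add (hk.hasFDerivAt.const_mul v)).fderiv]
    simp [mul_comm]
  have hsymm := hF.isSymmSndFDerivAt (by rw [minSmoothness_of_isRCLikeNormedField]) 1 I
  rw [extDeriv_oneForm_apply hW, key, key, hsymm, wirtingerBar]
  linear_combination -(fderiv ℝ k z I) * I_mul_I

/-- The exterior derivative of a smooth form divided by a power of the coordinate. -/
theorem extDeriv_inv_pow_smul {W η : ℂ → ℂ [⋀^Fin 1]→L[ℝ] ℂ} {c z : ℂ} {n : ℕ} (hz : z ≠ c)
    (hW : DifferentiableAt ℝ W z) (hη : DifferentiableAt ℝ η z)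
    (h : ∀ᶠ y in 𝓝 z, W y = ((y - c) ^ n)⁻¹ • η y) :
    extDeriv W z ![1, I] = ((z - c) ^ (n + 1))⁻¹ *
      ((z - c) * extDeriv η z ![1, I] - n * (η z ![I] - I * η z ![1])) := by
  have hz' : z - c ≠ 0 := sub_ne_zero.2 hz
  have key : ∀ v u, fderiv ℝ (fun y => W y ![v]) z u =
      -(n : ℂ) * ((z - c) ^ (n + 1))⁻¹ * u * η z ![v] +
        ((z - c) ^ n)⁻¹ * fderiv ℝ (fun y => η y ![v]) z u := by
    intro v u
    have e1 : (fun y => W y ![v]) =ᶠ[𝓝 z] fun y => ((y - c) ^ n)⁻¹ * η y ![v] := by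
      filter_upwards [h] with y hy
      rw [hy]
      rfl
    have e2 : DifferentiableAt ℝ (fun y => η y ![v]) z :=
      (ContinuousAlternatingMap.apply ℝ ℂ ℂ ![v]).differentiableAt.comp z hη
    rw [e1.fderiv_eq, fderiv_mul_of_hasDerivAt (hasDerivAt_inv_pow_sub c n hz) e2]
  rw [extDeriv_oneForm_apply hW, extDeriv_oneForm_apply hη, key, key]
  field_simp
  ring

/-- The area form `dx ∧ dy`. -/
noncomputable def areaForm : ℂ [⋀^Fin 2]→L[ℝ] ℂ :=
  extDeriv (fun z : ℂ => (z.re : ℂ) • oneFormEquiv.symm (ofRealCLM.comp imCLM)) 0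

theorem areaForm_apply : areaForm ![1, I] = 1 := by
  have hd : DifferentiableAt ℝ
      (fun z : ℂ => (z.re : ℂ) • oneFormEquiv.symm (ofRealCLM.comp imCLM)) 0 :=
    (ofRealCLM.comp reCLM).differentiableAt.smul_const _
  have h : ∀ v u : ℂ, fderiv ℝ (fun z : ℂ => ((z.re : ℂ) •
      oneFormEquiv.symm (ofRealCLM.comp imCLM)) ![v]) 0 u = u.re * v.im := by
    intro v u
    have e : (fun z : ℂ => ((z.re : ℂ) • oneFormEquiv.symm (ofRealCLM.comp imCLM)) ![v]) =
        fun z => (v.im : ℂ) * (ofRealCLM.comp reCLM) z := by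
      funext z
      rw [mul_comm]
      rfl
    rw [e, ((ofRealCLM.comp reCLM).hasFDerivAt.const_mul (v.im : ℂ)).fderiv]
    simp [mul_comm]
  rw [areaForm, extDeriv_oneForm_apply hd, h, h]
  simp

theorem twoForm_eq_smul_areaForm (W : ℂ [⋀^Fin 2]→L[ℝ] ℂ) : W = W ![1, I] • areaForm := by
  apply twoForm_ext
  rw [ContinuousAlternatingMap.smul_apply, areaForm_apply, smul_eq_mul, mul_one]

/-- The function `1/|z|` is locally integrable in real dimension two. This gives the absolute
convergence of integrals of logarithmic forms. -/
theorem integrableAtFilter_inv_mul {c : ℂ} {g : ℂ → ℂ} (hg : ∀ᶠ z in 𝓝 c, ContinuousAt g z) :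
    IntegrableAtFilter (fun z => (z - c)⁻¹ * g z) (𝓝 c) := by
  obtain ⟨δ, hδ, hδg⟩ := Metric.eventually_nhds_iff_ball.1 hg
  have hcont : ContinuousOn g (Metric.closedBall c (δ / 2)) := fun z hz =>
    (hδg z (Metric.closedBall_subset_ball (half_lt_self hδ) hz)).continuousWithinAt
  obtain ⟨C, hC⟩ := (isCompact_closedBall c (δ / 2)).exists_bound_of_continuousOn hcont
  have h1 : IntegrableOn (fun z : ℂ => z⁻¹) (Metric.ball 0 (δ / 2)) := by
    refine integrableOn_ball_of_norm_le_rpow (C := 1) (α := 1) (by simp) (by simp) ?_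
      measurable_inv.aestronglyMeasurable
    refine Eventually.of_forall fun z => ?_
    rw [norm_inv, one_mul, Real.rpow_neg_one]
  have h2 : IntegrableOn (fun z : ℂ => (z - c)⁻¹) (Metric.ball c (δ / 2)) := by
    have hmp := measurePreserving_sub_right (volume : Measure ℂ) c
    have := (hmp.integrableOn_comp_preimage (measurableEmbedding_subRight c)).2 h1
    have e : (fun z => z - c) ⁻¹' Metric.ball 0 (δ / 2) = Metric.ball c (δ / 2) := by
      ext z
      simp [dist_eq_norm]
    rwa [e] at this
  refine ⟨Metric.ball c (δ / 2), Metric.ball_mem_nhds c (half_pos hδ), ?_⟩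
  have h3 := h2.bdd_mul (c := C) (f := g)
    ((hcont.mono Metric.ball_subset_closedBall).aestronglyMeasurable measurableSet_ball) ?_
  · exact h3.congr (Eventually.of_forall fun z => mul_comm _ _)
  · filter_upwards [ae_restrict_mem measurableSet_ball] with z hz
    exact hC z (Metric.ball_subset_closedBall hz)

end Plane

namespace RiemannSurface

/-! ### Expansions at poles -/

section Polar

variable {X : Type*} [TopologicalSpace X] [ChartedSpace HalfPlane X]

/-- Near `p`, the form `α` is `dF + h dz / z + b dz̄ / z ^ m`, where `F = f / z ^ n` and `f`, `h`, `b`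
are smooth. -/
def HasPolarExpansion (α : DForm X 1) (p : X) (n : ℕ) (f h : ℂ → ℂ) (m : ℕ) (b : ℂ → ℂ) : Prop :=
  (∀ᶠ z in 𝓝 (chart p p), ContDiffAt ℝ ∞ f z) ∧ ContDiffAt ℝ ∞ h (chart p p) ∧
    ContDiffAt ℝ ∞ b (chart p p) ∧ ∀ᶠ z in 𝓝[≠] (chart p p), ∀ v, inChart p α z ![v] =
      fderiv ℝ (fun z => ((z - chart p p) ^ n)⁻¹ * f z) z v + (z - chart p p)⁻¹ * h z * v +
        ((z - chart p p) ^ m)⁻¹ * b z * (starRingEnd ℂ) v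

theorem poleOrderLE_two_of_coeff {w : DForm X 2} {p : X} {n : ℕ} {g : ℂ → ℂ}
    (hg : ContDiffAt ℝ ∞ g (chart p p))
    (h : ∀ᶠ z in 𝓝[≠] (chart p p), inChart p w z ![1, I] = ((z - chart p p) ^ n)⁻¹ * g z) :
    PoleOrderLE w p n := by
  refine ⟨fun z => g z • areaForm, hg.smul contDiffAt_const, ?_⟩
  filter_upwards [h] with z hz
  rw [twoForm_eq_smul_areaForm (inChart p w z), hz, mul_smul]

theorem PoleOrderLE.integrableAtFilter {w : DForm X 2} {p : X} (h : PoleOrderLE w p 1) :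
    IntegrableAtFilter (fun z => inChart p w z ![1, I]) (𝓝 (chart p p)) := by
  obtain ⟨η, hη, he⟩ := h
  have hc : ∀ᶠ z in 𝓝 (chart p p), ContinuousAt (fun z => η z ![1, I]) z := by
    filter_upwards [((hη.alternating_apply ![1, I]).of_le (m := 1) (by simp)).eventually (by simp)]
      with z hz using hz.continuousAt
  refine (integrableAtFilter_inv_mul hc).congr_of_eventually_nhdsNE ?_
  filter_upwards [he] with z hz
  rw [hz, pow_one]
  rfl

variable {D : Finset X} {p : X} (hp : realHalfModel.IsInteriorPoint p)

/-- Only the `dz̄`-coefficient changes, over the common denominator `z^(m+k)`; `h`, and with it the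
residue, is untouched. -/
theorem HasPolarExpansion.sub {α β : DForm X 1} {n m k : ℕ} {f h b b' : ℂ → ℂ}
    (hα : HasPolarExpansion α p n f h m b) (hβ : HasPolarExpansion β p 0 0 0 k b') :
    HasPolarExpansion (α - β) p n f h (m + k)
      (fun z => (z - chart p p) ^ k * b z - (z - chart p p) ^ m * b' z) := by
  obtain ⟨h1, h2, h3, h4⟩ := hα
  obtain ⟨-, -, h3', h4'⟩ := hβ
  refine ⟨h1, h2, by fun_prop, ?_⟩
  filter_upwards [h4, h4', self_mem_nhdsWithin] with z hz hz' hne v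
  have h0 : z - chart p p ≠ 0 := sub_ne_zero.2 hne
  have e : inChart p (α - β) z ![v] = inChart p α z ![v] - inChart p β z ![v] := rfl
  rw [e, hz, hz']
  simp only [Pi.zero_apply, mul_zero, zero_mul, fderiv_fun_const, zero_add,
    _root_.zero_apply]
  rw [pow_add]
  field_simp
  ring

variable [T2Space X] [IsRiemannSurface X]

include hp in
theorem eventually_mem_target_notMem (D : Finset X) :
    ∀ᶠ z in 𝓝[≠] (chart p p), z ∈ (chart p).target ∧ 0 < z.im ∧ (chart p).symm z ∉ D := by
  classical
  have h1 : ∀ᶠ x in 𝓝 p, x ∉ D.erase p :=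
    (D.erase p).finite_toSet.isClosed.isOpen_compl.mem_nhds (by simp)
  have h2 : ∀ᶠ z : ℂ in 𝓝 (chart p p), 0 < z.im :=
    (isOpen_lt continuous_const continuous_im).mem_nhds
      (im_pos_of_isInteriorPoint (mem_extChartAt_source p) hp)
  filter_upwards [nhdsWithin_le_nhds (target_mem_nhds hp), nhdsWithin_le_nhds h2,
    nhdsWithin_le_nhds (eventually_symm hp h1), self_mem_nhdsWithin] with z hz hzi hzD hne
  exact ⟨hz, hzi, fun h => hzD (Finset.mem_erase.2 ⟨symm_ne_of_ne hz hne, h⟩)⟩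

include hp in
theorem SmoothOff.eventually_contDiffAt {k : ℕ} {w : DForm X k} (hw : SmoothOff D w) :
    ∀ᶠ z in 𝓝[≠] (chart p p), ContDiffAt ℝ ∞ (inChart p w) z := by
  filter_upwards [eventually_mem_target_notMem hp D] with z hz
  exact (hw.contDiffWithinAt hz.1 hz.2.2).contDiffAt (range_mem_nhds hz.2.1)

include hp in
theorem eventually_inChart_extD {k : ℕ} {w : DForm X k} (hw : SmoothOff D w) :
    ∀ᶠ z in 𝓝[≠] (chart p p), inChart p (extD w) z = extDeriv (inChart p w) z := by
  filter_upwards [eventually_mem_target_notMem hp D] with z hz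
  rw [inChart_extD hw hz.1 hz.2.2, ← extDerivWithin_univ, extDerivWithin, extDerivWithin,
    fderivWithin_of_mem_nhds (range_mem_nhds hz.2.1), fderivWithin_univ]

include hp in
theorem PoleOrderLE.exists_expansion {α : DForm X 1} (hα : SmoothOff D α) {n : ℕ}
    (h : PoleOrderLE α p n) : ∃ f h b, HasPolarExpansion α p n f h n b := by
  obtain ⟨η, hη, he⟩ := h
  set c := chart p p with hc
  -- Order `∞` at `c` does not by itself spread to a neighbourhood, but off `c` the form `η` is `(z
  -- - c)^n α`, which is smooth. The pole reduction differentiates repeatedly and needs this.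
  have hη' : ∀ᶠ z in 𝓝 c, ContDiffAt ℝ ∞ η z := by
    have h1 : ∀ᶠ z in 𝓝[≠] c, ContDiffAt ℝ ∞ η z := by
      filter_upwards [hα.eventually_contDiffAt hp, eventually_nhdsNE_eventually_nhds_iff.2 he,
        self_mem_nhdsWithin] with z hz hez hne
      have h2 : η =ᶠ[𝓝 z] fun y => (y - c) ^ n • inChart p α y := by
        filter_upwards [hez, eventually_ne_nhds (show z ≠ c from hne)] with y hy hyc
        rw [hy, smul_smul, mul_inv_cancel₀ (pow_ne_zero n (sub_ne_zero.2 hyc)), one_smul]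
      exact (((contDiffAt_id.sub contDiffAt_const).pow n).smul hz).congr_of_eventuallyEq h2
    rw [eventually_nhdsWithin_iff] at h1
    filter_upwards [h1] with z hz
    by_cases hzc : z = c
    · rwa [hzc]
    · exact hz hzc
  obtain ⟨f, h, hf, hh, hfh⟩ := exists_pole_reduction c n
    (a := fun z => (η z ![1] - I * η z ![I]) / 2) (hη'.mono fun z hz =>
      ((hz.alternating_apply _).sub (contDiffAt_const.mul (hz.alternating_apply _))).div_const _)
  -- Replacing the singular `dz`-part by `dF` introduces `∂̄F = ∂̄f / (z - c)^n`, which is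
  -- subtracted from the `dz̄`-coefficient.
  refine ⟨f, h, fun z => typeZeroOne (η z) ![1] - wirtingerBar f z, hf, hh.self_of_nhds,
    ((typeZeroOne.contDiff.contDiffAt.comp c hη).alternating_apply ![1]).sub
      hf.self_of_nhds.wirtingerBar, ?_⟩
  filter_upwards [he, hfh, self_mem_nhdsWithin, nhdsWithin_le_nhds
    (eventually_differentiableAt hf.self_of_nhds)] with z hz hfz hne hfd v
  rw [hz, ContinuousAlternatingMap.smul_apply, oneForm_apply, fderiv_eq_wirtinger,
    wirtingerBar_mul_of_hasDerivAt (hasDerivAt_inv_pow_sub c n hne) hfd, smul_eq_mul]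
  linear_combination v * hfz

include hp in
theorem PoleOrderLE.expansion_of_typeZeroOne {β : DForm X 1} (hβ : IsTypeZeroOne D β) {n : ℕ}
    (h : PoleOrderLE β p n) : ∃ b, HasPolarExpansion β p 0 0 0 n b := by
  obtain ⟨η, hη, he⟩ := h
  refine ⟨fun z => η z ![1], Eventually.of_forall fun _ => contDiffAt_const, contDiffAt_const,
    hη.alternating_apply _, ?_⟩
  filter_upwards [he, eventually_mem_target_notMem hp D] with z hz hzD v
  rw [hβ p z hzD.1 hzD.2.2 v, hz]
  simp [fderiv_fun_const]

include hp in
theorem PoleOrderLE.extD {α : DForm X 1} (hα : SmoothOff D α) {n : ℕ} (h : PoleOrderLE α p n) :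
    PoleOrderLE (extD α) p (n + 1) := by
  obtain ⟨η, hη, he⟩ := h
  set c := chart p p with hc
  have hd : ContDiffAt ℝ ∞ (extDeriv η) c := by
    have hd' : ContDiffAt ℝ ∞ (fderiv ℝ η) c := hη.fderiv_right (m := ∞) (by simp)
    exact (ContinuousAlternatingMap.alternatizeUncurryFinCLM ℝ ℂ ℂ).contDiff.comp_contDiffAt c hd'
  refine poleOrderLE_two_of_coeff (g := fun z => (z - c) * extDeriv η z ![1, I] -
    n * (η z ![I] - I * η z ![1])) ?_ ?_
  · exact ((contDiffAt_id.sub contDiffAt_const).mul (hd.alternating_apply _)).sub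
      (contDiffAt_const.mul ((hη.alternating_apply _).sub
        (contDiffAt_const.mul (hη.alternating_apply _))))
  · filter_upwards [eventually_inChart_extD hp hα, hα.eventually_contDiffAt hp,
      eventually_nhdsNE_eventually_nhds_iff.2 he, self_mem_nhdsWithin, nhdsWithin_le_nhds
      ((hη.of_le (m := 1) (by simp)).eventually (by simp))] with z hz hw hez hne hηz
    rw [hz]
    exact extDeriv_inv_pow_smul hne (hw.differentiableAt (by simp))
      (hηz.differentiableAt one_ne_zero) hez

include hp in
/-- If the `(0,1)`-part of the expansion vanishes, the exterior derivative is logarithmic. -/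
theorem HasPolarExpansion.extD {γ : DForm X 1} (hγ : SmoothOff D γ) {n : ℕ} {f h : ℂ → ℂ}
    (he : HasPolarExpansion γ p n f h 0 0) : PoleOrderLE (extD γ) p 1 := by
  obtain ⟨hf, hh, -, he⟩ := he
  set c := chart p p with hc
  refine poleOrderLE_two_of_coeff (g := fun z => 2 * I * wirtingerBar h z)
    (contDiffAt_const.mul hh.wirtingerBar) ?_
  filter_upwards [eventually_inChart_extD hp hγ, hγ.eventually_contDiffAt hp,
    eventually_nhdsNE_eventually_nhds_iff.2 he, self_mem_nhdsWithin, nhdsWithin_le_nhds hf,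
    nhdsWithin_le_nhds (eventually_differentiableAt hh)] with z hz hw hez hne hfz hhz
  have h1 : HasDerivAt (fun z => (z - c)⁻¹) (-(1 : ℕ) * ((z - c) ^ (1 + 1))⁻¹) z := by
    simpa only [pow_one] using hasDerivAt_inv_pow_sub c 1 hne
  rw [hz, extDeriv_exact_add (F := fun z => ((z - c) ^ n)⁻¹ * f z) (k := fun z => (z - c)⁻¹ * h z)
    (hw.differentiableAt (by simp)) ?_ ?_ ?_, wirtingerBar_mul_of_hasDerivAt h1 hhz]
  · rw [pow_one]
    ring
  · refine (ContDiffAt.mul ?_ hfz).of_le (WithTop.coe_le_coe.2 (le_top : (2 : ℕ∞) ≤ ⊤))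
    exact ((contDiffAt_id.sub contDiffAt_const).pow n).inv (pow_ne_zero n (sub_ne_zero.2 hne))
  · exact (h1.differentiableAt.restrictScalars ℝ).mul hhz
  · filter_upwards [hez] with y hy v
    rw [hy v]
    simp

end Polar

end RiemannSurface

namespace RiemannSurface

/-! ### Local coordinates and residues -/

section Residue

variable {X : Type*} [TopologicalSpace X] [ChartedSpace HalfPlane X] [IsRiemannSurface X]
  {p : X} {e : OpenPartialHomeomorph X ℂ}

instance isManifold_complexHalfModel_one : IsManifold complexHalfModel 1 X :=
  IsManifold.of_le (n := ∞) (by simp)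

/-- The chart at `p` expressed in a local coordinate at `p`. -/
noncomputable abbrev coordChange (p : X) (e : OpenPartialHomeomorph X ℂ) : ℂ → ℂ :=
  chart p ∘ e.symm

namespace IsLocalCoordinate

variable (he : IsLocalCoordinate p e)
include he

omit [IsRiemannSurface X] in
theorem symm_zero : e.symm 0 = p := by
  rw [← he.map_eq_zero, e.left_inv he.mem_source]

omit [IsRiemannSurface X] in
theorem zero_mem_target : (0 : ℂ) ∈ e.target := by
  rw [← he.map_eq_zero]
  exact e.map_source he.mem_source

omit [IsRiemannSurface X] in
theorem coordChange_zero : coordChange p e 0 = chart p p := by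
  simp only [coordChange, Function.comp_apply]
  rw [he.symm_zero]

omit [IsRiemannSurface X] in
theorem eventually_mem : ∀ᶠ w in 𝓝 (0 : ℂ), w ∈ e.target ∧ e.symm w ∈ (chart p).source := by
  have h1 := e.open_target.mem_nhds he.zero_mem_target
  have h2 : ContinuousAt e.symm 0 := e.continuousAt_symm he.zero_mem_target
  have h3 : (chart p).source ∈ 𝓝 (e.symm 0) := by
    rw [he.symm_zero]
    exact extChartAt_source_mem_nhds p
  exact inter_mem h1 (h2 h3)

/-- The composite is complex differentiable on an open subset of `ℂ`, which already implies
analyticity. -/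
theorem analyticAt_coordChange : AnalyticAt ℂ (coordChange p e) 0 := by
  refine DifferentiableOn.analyticAt (s := {w | w ∈ e.target ∧ e.symm w ∈ (chart p).source})
    (fun w hw => ?_) he.eventually_mem
  have h1 : MDifferentiableAt 𝓘(ℂ, ℂ) complexHalfModel e.symm w :=
    (he.holomorphic_symm w hw.1).mdifferentiableAt (e.open_target.mem_nhds hw.1)
  have h2 : MDifferentiableAt complexHalfModel 𝓘(ℂ, ℂ) (extChartAt complexHalfModel p)
      (e.symm w) := mdifferentiableAt_extChartAt (by
        have := hw.2
        rwa [extChartAt_source] at this)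
  exact (h2.comp w h1).differentiableAt.differentiableWithinAt

/-- By the chain rule its product with the derivative of the inverse coordinate change is one.
Interiority makes the inverse chart differentiable on a full neighbourhood, not merely within the
half-plane. -/
theorem deriv_coordChange_ne_zero (hp : realHalfModel.IsInteriorPoint p) :
    deriv (coordChange p e) 0 ≠ 0 := by
  have h1 : MDifferentiableWithinAt 𝓘(ℂ, ℂ) complexHalfModel
      (extChartAt complexHalfModel p).symm (range complexHalfModel) (chart p p) :=
    mdifferentiableWithinAt_extChartAt_symm (chart_mem_target p)
  have hr : range complexHalfModel ∈ 𝓝 (chart p p) :=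
    range_mem_nhds (im_pos_of_isInteriorPoint (mem_extChartAt_source p) hp)
  have h2 : MDifferentiableAt 𝓘(ℂ, ℂ) complexHalfModel
      (extChartAt complexHalfModel p).symm (chart p p) := h1.mdifferentiableAt hr
  have h3 : MDifferentiableAt complexHalfModel 𝓘(ℂ, ℂ) e p :=
    (he.holomorphic p he.mem_source).mdifferentiableAt (e.open_source.mem_nhds he.mem_source)
  have h4 : MDifferentiableAt 𝓘(ℂ, ℂ) 𝓘(ℂ, ℂ) (e ∘ (extChartAt complexHalfModel p).symm)
      (chart p p) := h3.comp_of_eq (chart p p) h2 (extChartAt_to_inv (I := complexHalfModel) p)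
  have h5 : DifferentiableAt ℂ (e ∘ (extChartAt complexHalfModel p).symm)
      (coordChange p e 0) := by
    rw [he.coordChange_zero]
    exact h4.differentiableAt
  have h6 : (e ∘ (extChartAt complexHalfModel p).symm) ∘ coordChange p e =ᶠ[𝓝 0] id := by
    filter_upwards [he.eventually_mem] with w hw
    have : (extChartAt complexHalfModel p).symm (chart p (e.symm w)) = e.symm w :=
      (chart p).left_inv hw.2
    simp only [Function.comp_apply, id]
    rw [this, e.right_inv hw.1]
  have h7 := h5.hasDerivAt.comp 0 he.analyticAt_coordChange.differentiableAt.hasDerivAt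
  have h8 := h7.congr_of_eventuallyEq h6.symm
  intro h0
  rw [h0, mul_zero] at h8
  exact zero_ne_one (h8.unique (hasDerivAt_id (0 : ℂ)))

theorem pullback_eq (α : DForm X 1) : ∀ᶠ w in 𝓝 (0 : ℂ), ∀ v : ℂ,
    ((α (e.symm w)).compContinuousLinearMap
      (mfderiv 𝓘(ℝ, ℂ) realHalfModel e.symm w) : ℂ [⋀^Fin 1]→L[ℝ] ℂ) ![v] =
        inChart p α (coordChange p e w) ![deriv (coordChange p e) w * v] := by
  filter_upwards [he.eventually_mem.eventually_nhds,
    he.analyticAt_coordChange.eventually_analyticAt] with w hw hψ v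
  have hw0 := hw.self_of_nhds
  have hd : HasFDerivAt (coordChange p e) ((ContinuousLinearMap.toSpanSingleton ℂ
      (deriv (coordChange p e) w)).restrictScalars ℝ) w :=
    hψ.differentiableAt.hasDerivAt.hasFDerivAt.restrictScalars ℝ
  have hl : (chart p).symm (coordChange p e w) = e.symm w := (chart p).left_inv hw0.2
  have hc := mdifferentiableWithinAt_extChartAt_symm (I := realHalfModel)
    ((chart p).map_source hw0.2)
  have hcomp := mfderivWithin_comp (I := 𝓘(ℝ, ℂ)) (I' := 𝓘(ℝ, ℂ)) (I'' := realHalfModel)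
    (f := coordChange p e) (s := univ) w hc
    hd.differentiableAt.mdifferentiableAt.mdifferentiableWithinAt
    (fun y _ => by simp [coordChange, chart, extChartAt]) (uniqueMDiffWithinAt_univ _)
  rw [mfderivWithin_univ, mfderivWithin_univ, mfderiv_eq_fderiv, hd.fderiv] at hcomp
  have heq : (chart p).symm ∘ coordChange p e =ᶠ[𝓝 w] e.symm := by
    filter_upwards [hw] with y hy using (chart p).left_inv hy.2
  have hm := heq.mfderiv_eq (I := 𝓘(ℝ, ℂ)) (I' := realHalfModel)
  have h1 := compContinuousLinearMap_congr α hl.symm (mfderiv 𝓘(ℝ, ℂ) realHalfModel e.symm w)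
    ((mfderivWithin 𝓘(ℝ, ℂ) realHalfModel (chart p).symm (range realHalfModel)
      (coordChange p e w)).comp ((ContinuousLinearMap.toSpanSingleton ℂ
      (deriv (coordChange p e) w)).restrictScalars ℝ))
    fun v => (DFunLike.congr_fun hm v).symm.trans (DFunLike.congr_fun hcomp v)
  rw [h1]
  have h2 : ((ContinuousLinearMap.toSpanSingleton ℂ (deriv (coordChange p e) w)).restrictScalars ℝ :
      ℂ → ℂ) ∘ ![v] = ![deriv (coordChange p e) w * v] := by
    ext i
    fin_cases i
    simp [mul_comm]
  exact congrArg (inChart p α (coordChange p e w)) h2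

end IsLocalCoordinate

section

variable (hp : realHalfModel.IsInteriorPoint p) {α : DForm X 1} {n m : ℕ} {f h b : ℂ → ℂ}
include hp

/-- The chart at an interior point, translated so that it vanishes there. -/
theorem exists_isLocalCoordinate : ∃ e : OpenPartialHomeomorph X ℂ, IsLocalCoordinate p e := by
  set c := chart p p with hc
  have hci : 0 < c.im := im_pos_of_isInteriorPoint (mem_extChartAt_source p) hp
  have htgt : ∀ z ∈ (chart p).target, 0 < z.im → (chart p).target ∈ 𝓝 z := fun z hz hzi => by
    have := target_mem_nhdsWithin hz
    rwa [nhdsWithin_eq_nhds.2 (range_mem_nhds hzi)] at this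
  have htr : Continuous fun w : ℂ => w + c := by fun_prop
  let e : OpenPartialHomeomorph X ℂ :=
    { toFun := fun x => chart p x - c
      invFun := fun w => (chart p).symm (w + c)
      source := {x ∈ (chart p).source | 0 < (chart p x).im}
      target := {w | w + c ∈ (chart p).target ∧ 0 < (w + c).im}
      map_source' := fun x hx => by
        refine ⟨?_, ?_⟩
        · rw [sub_add_cancel]
          exact (chart p).map_source hx.1
        · rw [sub_add_cancel]
          exact hx.2
      map_target' := fun w hw => by
        refine ⟨(chart p).map_target hw.1, ?_⟩
        rw [(chart p).right_inv hw.1]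
        exact hw.2
      left_inv' := fun x hx => by
        rw [sub_add_cancel, (chart p).left_inv hx.1]
      right_inv' := fun w hw => by
        rw [(chart p).right_inv hw.1, add_sub_cancel_right]
      open_source := (continuousOn_extChartAt p).isOpen_inter_preimage (isOpen_extChartAt_source p)
        (isOpen_lt continuous_const continuous_im)
      open_target := by
        refine isOpen_iff_mem_nhds.2 fun w hw => htr.continuousAt (inter_mem
          (htgt _ hw.1 hw.2) ((isOpen_lt continuous_const continuous_im).mem_nhds hw.2))
      continuousOn_toFun := ((continuousOn_extChartAt p).mono fun x hx => hx.1).sub continuousOn_const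
      continuousOn_invFun := (continuousOn_extChartAt_symm p).comp htr.continuousOn
        fun w hw => hw.1 }
  refine ⟨e, ⟨mem_extChartAt_source p, hci⟩, sub_self _, fun x hx => ?_, fun w hw => ?_⟩
  · have h1 : MDifferentiableAt complexHalfModel 𝓘(ℂ, ℂ) (extChartAt complexHalfModel p) x :=
      mdifferentiableAt_extChartAt (by
        have := hx.1
        rwa [extChartAt_source] at this)
    have h2 : MDifferentiableAt 𝓘(ℂ, ℂ) 𝓘(ℂ, ℂ) (fun z : ℂ => z - c)
        (extChartAt complexHalfModel p x) :=
      (differentiableAt_id.sub_const c).mdifferentiableAt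
    exact (h2.comp x h1).mdifferentiableWithinAt
  · have h1 : MDifferentiableWithinAt 𝓘(ℂ, ℂ) complexHalfModel
        (extChartAt complexHalfModel p).symm (range complexHalfModel) (w + c) :=
      mdifferentiableWithinAt_extChartAt_symm hw.1
    have h2 := h1.mdifferentiableAt (range_mem_nhds hw.2)
    have h3 : MDifferentiableAt 𝓘(ℂ, ℂ) 𝓘(ℂ, ℂ) (fun z : ℂ => z + c) w :=
      (differentiableAt_id.add_const c).mdifferentiableAt
    exact (h2.comp w h3).mdifferentiableWithinAt

theorem HasPolarExpansion.hasResidueAt (hα : HasPolarExpansion α p n f h m b) :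
    HasResidueAt α p (h (chart p p)) := by
  intro e he
  obtain ⟨hf, hh, hb, hexp⟩ := hα
  have h1 := tendsto_circle_integral_pullback (ψ := coordChange p e) (f := f) (h := h) (b := b)
    (α := fun z v => inChart p α z ![v]) he.analyticAt_coordChange
    (he.deriv_coordChange_ne_zero hp) n m
  rw [he.coordChange_zero] at h1
  refine (h1 hf.self_of_nhds hh hb hexp).congr' ?_
  filter_upwards [eventually_forall_circleMap_of_center
    ((he.pullback_eq α).filter_mono nhdsWithin_le_nhds)] with r hr
  refine intervalIntegral.integral_congr fun θ _ => ?_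
  exact (hr θ _).symm

omit hp [IsRiemannSurface X] in
-- This is the coordinate given by a translation of the chart; Stokes' theorem in the chart uses
-- exactly these circles.
theorem HasPolarExpansion.tendsto_circleIntegral (hα : HasPolarExpansion α p n f h m b) :
    Tendsto (fun r => ∫ θ in (0 : ℝ)..2 * Real.pi,
      inChart p α (circleMap (chart p p) r θ) ![deriv (circleMap (chart p p) r) θ]) (𝓝[>] 0)
      (𝓝 (2 * Real.pi * I * h (chart p p))) := by
  obtain ⟨hf, hh, hb, hexp⟩ := hα
  have hψ : AnalyticAt ℂ (fun w : ℂ => w + chart p p) 0 := by fun_prop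
  have hd : ∀ w, deriv (fun w : ℂ => w + chart p p) w = 1 := fun w => by simp
  have h1 := tendsto_circle_integral_pullback (ψ := fun w => w + chart p p) (f := f) (h := h)
    (b := b) (α := fun z v => inChart p α z ![v]) hψ (by rw [hd]; exact one_ne_zero) n m
  simp only [zero_add] at h1
  refine (h1 hf.self_of_nhds hh hb hexp).congr fun r => ?_
  refine intervalIntegral.integral_congr fun θ _ => ?_
  have e1 : circleMap 0 r θ + chart p p = circleMap (chart p p) r θ := by
    simp [circleMap, add_comm]
  simp only [hd, one_mul, deriv_circleMap, e1]

/-- `HasResidueAt` quantifies over all coordinates at `p`; uniqueness of limits applies because at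
least one exists. -/
theorem HasResidueAt.unique {r r' : ℂ} (hr : HasResidueAt α p r) (hr' : HasResidueAt α p r') :
    r = r' := by
  obtain ⟨e, he⟩ := exists_isLocalCoordinate hp
  have := tendsto_nhds_unique (hr e he) (hr' e he)
  exact mul_left_cancel₀ two_pi_I_ne_zero this

theorem HasResidueAt.residueAt_eq {r : ℂ} (hr : HasResidueAt α p r) : residueAt α p = r := by
  have hex : ∃ r, HasResidueAt α p r := ⟨r, hr⟩
  rw [residueAt, dif_pos hex]
  exact hex.choose_spec.unique hp hr

end

end Residue

end RiemannSurface

namespace RiemannSurface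

/-! ### Decompositions and the regularized integral -/

section Regularized

variable {X : Type*} [TopologicalSpace X] [ChartedSpace HalfPlane X] [T2Space X]
  [IsRiemannSurface X] {D : Finset X} {α : DForm X 1}

omit [T2Space X] [IsRiemannSurface X] in
theorem FunSmoothOff.sum {ι : Type*} (s : Finset ι) {f : ι → X → ℂ}
    (hf : ∀ i ∈ s, FunSmoothOff D (f i)) : FunSmoothOff D (fun x => ∑ i ∈ s, f i x) :=
  fun p z hz hzD => ContDiffWithinAt.sum fun i hi => hf i hi p z hz hzD

/-- A function on the surface with a prescribed isolated singularity. -/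
theorem exists_singular_function (D : Finset X) {p : X} (hp : realHalfModel.IsInteriorPoint p)
    {G : ℂ → ℂ} (hG : ∀ᶠ z in 𝓝[≠] (chart p p), ContDiffAt ℝ ∞ G z) :
    ∃ F : X → ℂ, FunSmoothOff {p} F ∧ (∀ᶠ z in 𝓝 (chart p p), F ((chart p).symm z) = G z) ∧
      ∀ q ∈ D, q ≠ p → ∀ᶠ x in 𝓝 q, F x = 0 := by
  -- The bump must be supported where `G` is smooth off the centre, so that the product has no other
  -- singularity.
  have hU : ∀ᶠ x in 𝓝 p, chart p x ≠ chart p p → ContDiffAt ℝ ∞ G (chart p x) :=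
    (continuousAt_extChartAt (I := realHalfModel) p).eventually (eventually_nhdsWithin_iff.1 hG)
  obtain ⟨ψ, hsm, hone, hsrc, -, hD', hψU⟩ := exists_bump D hp hU
  refine ⟨fun x => (ψ x : ℂ) * G (chart p x), FunSmoothOff.of_contMDiffAt fun x hx => ?_, ?_,
    fun q hq hqp => ?_⟩
  · by_cases hxs : x ∈ tsupport ψ
    · have hne : chart p x ≠ chart p p := fun h =>
        hx (by simpa using (chart p).injOn (hsrc hxs) (mem_extChartAt_source p) h)
      have h2 : ContMDiffAt realHalfModel 𝓘(ℝ, ℂ) ∞ (chart p) x := by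
        refine contMDiffAt_extChartAt' ?_
        have := hsrc hxs
        rwa [extChartAt_source] at this
      have h3 : ContMDiffAt realHalfModel 𝓘(ℝ, ℂ) ∞ (G ∘ chart p) x :=
        (hψU hxs hne).contMDiffAt.comp x h2
      exact ((hsm x).smul h3).congr_of_eventuallyEq (Eventually.of_forall fun y => real_smul.symm)
    · refine (contMDiffAt_const (c := (0 : ℂ))).congr_of_eventuallyEq ?_
      filter_upwards [(isClosed_tsupport ψ).isOpen_compl.mem_nhds hxs] with y hy
      rw [image_eq_zero_of_notMem_tsupport hy, ofReal_zero, zero_mul]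
  · filter_upwards [eventually_symm hp hone, target_mem_nhds hp] with z hz hzt
    rw [hz, ofReal_one, one_mul, (chart p).right_inv hzt]
  · filter_upwards [(isClosed_tsupport ψ).isOpen_compl.mem_nhds (hD' q hq hqp)] with y hy
    rw [image_eq_zero_of_notMem_tsupport hy, ofReal_zero, zero_mul]

/-- Taking for `β` the (0,1)-part of `α` itself would leave `a dz / z^n`, whose differential can
have a pole of order `n`. Subtracting a global `dF` first leaves only `h dz / z` as (1,0)-part near
each pole. -/
theorem exists_isDecomposition (hD : ∀ p ∈ D, realHalfModel.IsInteriorPoint p)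
    (hα : HasPoles D α) : ∃ η β, IsDecomposition D (extD α) η β := by
  classical
  have hexp : ∀ p ∈ D, ∃ n f h b, HasPolarExpansion α p n f h n b := fun p hp => by
    obtain ⟨n, hn⟩ := hα.2 p hp
    exact ⟨n, hn.exists_expansion (hD p hp) hα.1⟩
  choose! n f h b hexp using hexp
  set G : X → ℂ → ℂ := fun p z => ((z - chart p p) ^ n p)⁻¹ * f p z with hG
  have hGsm : ∀ p ∈ D, ∀ᶠ z in 𝓝[≠] (chart p p), ContDiffAt ℝ ∞ (G p) z := fun p hp => by
    filter_upwards [nhdsWithin_le_nhds (hexp p hp).1, self_mem_nhdsWithin] with z hz hne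
    exact (((contDiffAt_id.sub contDiffAt_const).pow _).inv
      (pow_ne_zero _ (sub_ne_zero.2 hne))).mul hz
  choose! F' hF'sm hF'G hF'0 using fun p (hp : p ∈ D) =>
    exists_singular_function D (hD p hp) (hGsm p hp)
  set F : X → ℂ := fun x => ∑ p ∈ D, F' p x with hF
  have hFsm : FunSmoothOff D F :=
    FunSmoothOff.sum D fun p hp => (hF'sm p hp).mono (by simpa using hp)
  have hFG : ∀ p ∈ D, ∀ᶠ z in 𝓝 (chart p p), F ((chart p).symm z) = G p z := by
    intro p hp
    have h1 : ∀ᶠ x in 𝓝 p, ∀ q ∈ D, q ≠ p → F' q x = 0 :=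
      (Finset.eventually_all D).2 fun q hq => by
        by_cases hqp : q = p
        · exact Eventually.of_forall fun x h => absurd hqp h
        · filter_upwards [hF'0 q hq p hp (Ne.symm hqp)] with x hx _ using hx
    filter_upwards [eventually_symm (hD p hp) h1, hF'G p hp] with z hz hzG
    rw [← hzG, hF]
    exact Finset.sum_eq_single_of_mem p hp hz
  set δ : DForm X 1 := α - extD (zeroForm F) with hδ
  have hδsm : SmoothOff D δ := hα.1.sub hFsm.zeroForm.extD
  set β : DForm X 1 := partZeroOne δ with hβ
  have hβsm : SmoothOff D β := hδsm.partZeroOne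
  have hdF : ∀ p ∈ D, ∀ᶠ z in 𝓝[≠] (chart p p), ∀ v,
      inChart p (extD (zeroForm F)) z ![v] = fderiv ℝ (G p) z v := by
    intro p hp
    filter_upwards [eventually_mem_target_notMem (hD p hp) D,
      nhdsWithin_le_nhds (hFG p hp).eventually_nhds] with z hz hzF v
    rw [inChart_extD_zeroForm hFsm hz.1 hz.2.2, fderivWithin_of_mem_nhds (range_mem_nhds hz.2.1)]
    have : F ∘ (chart p).symm =ᶠ[𝓝 z] G p := hzF
    rw [this.fderiv_eq]
  have hβexp : ∀ p ∈ D, ∀ᶠ z in 𝓝[≠] (chart p p), ∀ v,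
      inChart p β z ![v] = ((z - chart p p) ^ n p)⁻¹ * b p z * (starRingEnd ℂ) v := by
    intro p hp
    filter_upwards [eventually_mem_target_notMem (hD p hp) D, hdF p hp, (hexp p hp).2.2.2]
      with z hz hzF hzα v
    have h1 : ∀ v, inChart p δ z ![v] = (z - chart p p)⁻¹ * h p z * v +
        ((z - chart p p) ^ n p)⁻¹ * b p z * (starRingEnd ℂ) v := fun v => by
      have e : inChart p δ z ![v] = inChart p α z ![v] - inChart p (extD (zeroForm F)) z ![v] := rfl
      rw [e, hzα, hzF]
      ring
    rw [inChart_partZeroOne δ hz.1, typeZeroOne_apply, h1, h1]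
    simp only [map_mul, conj_I]
    linear_combination ((z - chart p p)⁻¹ * h p z * v / 2 -
      ((z - chart p p) ^ n p)⁻¹ * b p z * (starRingEnd ℂ) v / 2) * I_mul_I
  refine ⟨extD α - del β, β, ⟨?_, fun p hp => ?_⟩, ⟨hβsm, fun p hp => ⟨n p, ?_⟩⟩,
    isTypeZeroOne_partZeroOne D δ, fun p _ => (sub_add_cancel (extD α p) (del β p)).symm⟩
  · rw [del_eq_extD]
    exact hα.1.extD.sub hβsm.extD
  · have hγ : SmoothOff D (α - β) := hα.1.sub hβsm
    -- The `dz̄`-terms of `α` and `β` cancel exactly.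
    have hγexp : HasPolarExpansion (α - β) p (n p) (f p) (h p) 0 0 := by
      obtain ⟨h1, h2, -, h4⟩ := hexp p hp
      refine ⟨h1, h2, contDiffAt_const, ?_⟩
      filter_upwards [h4, hβexp p hp] with z hz hzβ v
      have e : inChart p (α - β) z ![v] = inChart p α z ![v] - inChart p β z ![v] := rfl
      rw [e, hz, hzβ]
      simp
    obtain ⟨η, hη, he⟩ := hγexp.extD (hD p hp) hγ
    refine ⟨η, hη, ?_⟩
    filter_upwards [he, eventually_mem_target_notMem (hD p hp) D] with z hz hzD
    rw [← hz]
    refine inChart_congr ?_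
    have hadd := extD_add hγ hβsm hzD.2.2
    rw [sub_add_cancel] at hadd
    rw [Pi.sub_apply, del_eq_extD, hadd, add_sub_cancel_right]
  -- The alternating form attached to complex conjugation is `dz̄`.
  · refine ⟨fun z => b p z • oneFormEquiv.symm conjCLE, (hexp p hp).2.2.1.smul contDiffAt_const, ?_⟩
    filter_upwards [hβexp p hp] with z hz
    refine oneForm_ext fun v => ?_
    rw [hz, mul_assoc]
    rfl

theorem HasPoles.extD (hD : ∀ p ∈ D, realHalfModel.IsInteriorPoint p) (hα : HasPoles D α) :
    HasPoles D (extD α) :=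
  ⟨hα.1.extD, fun p hp => (hα.2 p hp).elim fun n hn => ⟨n + 1, hn.extD (hD p hp) hα.1⟩⟩

variable [CompactSpace X]

/-- The regularized integral of an exact form, computed from any decomposition. -/
theorem IsDecomposition.integral_eq (hD : ∀ p ∈ D, realHalfModel.IsInteriorPoint p)
    (hα : HasPoles D α) {η : DForm X 2} {β : DForm X 1}
    (hdec : IsDecomposition D (extD α) η β) :
    AbsIntegrable η ∧ surfaceIntegral η + boundaryIntegral β =
      -(2 * Real.pi * I) * residue D α + boundaryIntegral α := by
  obtain ⟨hη, hβ, hβt, heq⟩ := hdec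
  have hγ : SmoothOff D (α - β) := hα.1.sub hβ.1
  have hηγ : ∀ x ∉ D, extD (α - β) x = η x := fun x hx => by
    have hadd := extD_add hγ hβ.1 hx
    rw [sub_add_cancel, heq x hx, del_eq_extD] at hadd
    exact (add_right_cancel hadd).symm
  -- The circle integrals of `α - β` have the limit belonging to `α`, as a (0,1)-form contributes
  -- none.
  have hexp : ∀ p ∈ D, Tendsto (fun r => ∫ θ in (0 : ℝ)..2 * Real.pi,
      inChart p (α - β) (circleMap (chart p p) r θ) ![deriv (circleMap (chart p p) r) θ]) (𝓝[>] 0)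
      (𝓝 (2 * Real.pi * I * residueAt α p)) := fun p hp => by
    obtain ⟨n, hn⟩ := hα.2 p hp
    obtain ⟨m, hm⟩ := hβ.2 p hp
    obtain ⟨f, h, b, he⟩ := hn.exists_expansion (hD p hp) hα.1
    obtain ⟨b', he'⟩ := hm.expansion_of_typeZeroOne (hD p hp) hβt
    rw [(he.hasResidueAt (hD p hp)).residueAt_eq (hD p hp)]
    exact (he.sub he').tendsto_circleIntegral
  obtain ⟨h1, h2⟩ := surfaceIntegral_extD hD hγ (fun p hp => by
    refine (hη.2 p hp).integrableAtFilter.congr_of_eventually_nhdsNE ?_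
    filter_upwards [eventually_mem_target_notMem (hD p hp) D] with z hz
    rw [inChart_congr (hηγ _ hz.2.2)]) hexp
  refine ⟨h1.congr hηγ, ?_⟩
  have h3 := boundaryIntegral_add hD hγ hβ.1
  rw [sub_add_cancel] at h3
  rw [← surfaceIntegral_congr hηγ, h2, h3, residue, Finset.mul_sum]
  simp only [neg_mul, Finset.sum_neg_distrib]
  ring


/-- The existence clause supplies a decomposition on which both universal clauses can be evaluated.
-/
theorem HasRegularizedIntegral.unique {w : DForm X 2} {c c' : ℂ}
    (h : HasRegularizedIntegral D w c) (h' : HasRegularizedIntegral D w c') : c = c' := by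
  obtain ⟨⟨η, β, hdec⟩, hc⟩ := h
  rw [← (hc η β hdec).2, (h'.2 η β hdec).2]

theorem HasRegularizedIntegral.regularizedIntegral_eq {w : DForm X 2} {c : ℂ}
    (h : HasRegularizedIntegral D w c) : regularizedIntegral D w = c := by
  have hex : ∃ c, HasRegularizedIntegral D w c := ⟨c, h⟩
  rw [regularizedIntegral, dif_pos hex]
  exact hex.choose_spec.unique h

end Regularized

end RiemannSurface

end

/-! ### The theorem -/

theorem theorem2p11 {X : Type*} [TopologicalSpace X] [T2Space X] [CompactSpace X]
    [ChartedSpace HalfPlane X] [IsRiemannSurface X] (D : Finset X)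
    (hD : ∀ p ∈ D, realHalfModel.IsInteriorPoint p)
    (α : RiemannSurface.DForm X 1) (hα : RiemannSurface.HasPoles D α) :
    RiemannSurface.HasPoles D (RiemannSurface.extD α) ∧
    (∀ p ∈ D, RiemannSurface.HasResidueAt α p (RiemannSurface.residueAt α p)) ∧
    RiemannSurface.HasRegularizedIntegral D (RiemannSurface.extD α)
      (RiemannSurface.regularizedIntegral D (RiemannSurface.extD α)) ∧
    RiemannSurface.regularizedIntegral D (RiemannSurface.extD α) =
      -(2 * Real.pi * Complex.I) * RiemannSurface.residue D α +
        RiemannSurface.boundaryIntegral α := by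
  have hreg : RiemannSurface.HasRegularizedIntegral D (RiemannSurface.extD α)
      (-(2 * Real.pi * Complex.I) * RiemannSurface.residue D α +
        RiemannSurface.boundaryIntegral α) :=
    ⟨RiemannSurface.exists_isDecomposition hD hα, fun η β hdec => hdec.integral_eq hD hα⟩
  refine ⟨hα.extD hD, fun p hp => ?_, ?_, hreg.regularizedIntegral_eq⟩
  · obtain ⟨n, hn⟩ := hα.2 p hp
    obtain ⟨f, h, b, he⟩ := hn.exists_expansion (hD p hp) hα.1
    have hr := he.hasResidueAt (hD p hp)
    rwa [hr.residueAt_eq (hD p hp)]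
  · rwa [hreg.regularizedIntegral_eq]
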